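/- Let $\Phi$ and $\tilde\Phi = 1-\Phi$ be the distribution function and the upper tail of $N(0,1)$, and let $z=\tilde\Phi^{-1}$ on $(0,1)$. For each $n$ observe $y\sim N_n(\mu,I)$, $\mu\in\mathbb R^n$. Given $q_n$, put $t[k]=z\bigl(kq_n/(2n)\bigr)$ for real $k>0$. Let $|y|_{(1)}\ge\dots\ge|y|_{(n)}$ be the ordered magnitudes and let $\hat k_F$ be the largest $k\in\{1,\dots,n\}$ with $|y|_{(k)}\ge t[k]$. The FDR estimator is $\hat\mu_{F,i}=y_i$ if $|y_i|\ge t[\hat k_F]$ and $\hat\mu_{F,i}=0$ otherwise; if no such $k$ exists, $\hat\mu_F=0$. For $0<r\le2$ the risk is $\rho(\hat\mu,\mu)=E_\mu\sum_{i=1}^n|\hat\mu_i-\mu_i|^r$. Assume that $q_n\to q\in[0,1)$ and, if $q=0$, that there is a constant $b_1>0$ with $q_n\ge b_1/\log n$ for all large $n$. Fix $0<r\le 2$ and $\alpha\in\mathbb R$. (i) ($\ell_0$ case.) Suppose that for some constants $b_2,b_3>0$ we have $\eta_n\in[n^{-1}\log^5 n,\;b_2n^{-b_3}]$ for all large $n$.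 Put $\tau_\eta=(2\log\eta_n^{-1})^{1/2}$, $k_n=n\eta_n$, and let $\mu_\alpha\in\mathbb R^n$ have coordinates $\mu_{\alpha,l}=t[k_n]+\alpha$ for $l\le k_n$ and $\mu_{\alpha,l}=0$ for $k_n<l\le n$. Then, as $n\to\infty$, $$\rho(\hat\mu_F,\mu_\alpha)=\Bigl[\tilde\Phi(\alpha)+\Phi(\alpha)\frac{q_n}{1-q_n}\Bigr]\,k_n\tau_\eta^r\,(1+o(1)).$$ (ii) (Weak-$\ell_p$ case.) Let $0<p<r$. Suppose that $\eta_n>0$ and that for some constants $b_2,b_3>0$ we have $\eta_n^p\in[n^{-1}\log^5 n,\;b_2n^{-b_3}]$ for all large $n$. Put $\tau_\eta=(2\log\eta_n^{-p})^{1/2}$, $k_n=n\eta_n^p\tau_\eta^{-p}$, and let $\mu_\alpha\in\mathbb R^n$ have coordinates $\mu_{\alpha,l}=\min\bigl(\eta_n n^{1/p}l^{-1/p},\;t[k_n]+\alpha\bigr)$, $1\le l\le n$. Then, as $n\to\infty$, $$\rho(\hat\mu_F,\mu_\alpha)=\Bigl[\tilde\Phi(\alpha)+\frac{p}{r-p}+\Phi(\alpha)\frac{q_n}{1-q_n}\Bigr]\,k_n\tau_\eta^r\,(1+o(1)).$$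 In both cases the expectations defining the risks are finite. -/

import Mathlib

open MeasureTheory ProbabilityTheory Filter Asymptotics
open scoped Topology

namespace GaussianFDR

noncomputable section

/-! ### Gaussian distribution function, tail and quantile -/

/-- The standard normal distribution function `Φ`. -/
def normalCdf (x : ℝ) : ℝ := (gaussianReal 0 1).real (Set.Iic x)

/-- The standard normal upper tail `Φ̃(x) = P(Z > x)`. -/
def normalTail (x : ℝ) : ℝ := (gaussianReal 0 1).real (Set.Ioi x)

/-- The upper-tail normal quantile `z = Φ̃⁻¹`; used for arguments in `(0, 1)`, where it is the
unique solution of `Φ̃ (z u) = u`. -/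
def upperQuantile (u : ℝ) : ℝ := sSup {x : ℝ | u ≤ normalTail x}

/-- The FDR boundary `t[k] = z (k q / (2 n))`, for real `k`. -/
def fdrBoundary (n : ℕ) (q k : ℝ) : ℝ := upperQuantile (k * q / (2 * n))

/-! ### The FDR estimator -/

/-- The ordered magnitudes `|y|_(1) ≥ |y|_(2) ≥ … ≥ |y|_(n)`; the value at `k : Fin n` is
`|y|_(k+1)`. -/
def orderedAbs {n : ℕ} (y : Fin n → ℝ) (k : Fin n) : ℝ :=
  |y (Tuple.sort (fun i => -|y i|) k)|

/-- The FDR index: the largest `k ∈ {1, …, n}` with `|y|_(k) ≥ t[k]`, and `0` if there is none. -/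
def fdrIndex {n : ℕ} (q : ℝ) (y : Fin n → ℝ) : ℕ :=
  {k : Fin n | fdrBoundary n q ((k : ℝ) + 1) ≤ orderedAbs y k}.toFinite.toFinset.sup
    (fun k => (k : ℕ) + 1)

/-- The FDR estimator: hard thresholding at `t[k̂]`, where `k̂` is the FDR index. If `k̂ = 0` the
threshold is `z 0 = +∞` and the estimate is zero. -/
def fdrEstimator {n : ℕ} (q : ℝ) (y : Fin n → ℝ) (i : Fin n) : ℝ :=
  open Classical in
  if 0 < fdrIndex q y ∧ fdrBoundary n q (fdrIndex q y) ≤ |y i| then y i else 0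

/-! ### Model, loss and risk -/

/-- The law `N_n(μ, I)` of the observations. -/
def observationLaw {n : ℕ} (μ : Fin n → ℝ) : Measure (Fin n → ℝ) :=
  Measure.pi fun i => gaussianReal (μ i) 1

/-- The loss `‖x - μ‖_r^r`. -/
def lrLoss {n : ℕ} (r : ℝ) (x μ : Fin n → ℝ) : ℝ := ∑ i, |x i - μ i| ^ r

/-- The risk `ρ(μ̂, μ) = E_μ ‖μ̂(y) - μ‖_r^r`. -/
def risk {n : ℕ} (r : ℝ) (est : (Fin n → ℝ) → Fin n → ℝ) (μ : Fin n → ℝ) : ℝ :=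
  ∫ y, lrLoss r (est y) μ ∂(observationLaw μ)

/-! ### Assumptions -/

/-- The false discovery control assumption: `q_n → q ∈ [0, 1)`, and if `q = 0` then
`q_n ≥ b₁ / log n` for some constant `b₁ > 0`. -/
def FalseDiscoveryControl (q : ℕ → ℝ) : Prop :=
  ∃ qlim : ℝ, 0 ≤ qlim ∧ qlim < 1 ∧ Tendsto q atTop (𝓝 qlim) ∧
    (qlim = 0 → ∃ b₁ : ℝ, 0 < b₁ ∧ ∀ᶠ n : ℕ in atTop, b₁ / Real.log n ≤ q n)

/-- The sparsity assumption on a sequence `s`: `s_n ∈ [n⁻¹ log⁵ n, b₂ n^{-b₃}]` for some constants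
`b₂, b₃ > 0`. It is applied with `s_n = η_n` for `ℓ_0` and `s_n = η_n ^ p` for weak `ℓ_p`. -/
def SparsityRange (s : ℕ → ℝ) : Prop :=
  ∃ b₂ b₃ : ℝ, 0 < b₂ ∧ 0 < b₃ ∧
    ∀ᶠ n : ℕ in atTop, (n : ℝ)⁻¹ * Real.log n ^ 5 ≤ s n ∧ s n ≤ b₂ * (n : ℝ) ^ (-b₃)

/-! ### The least-favorable family, `ℓ_0` case -/

/-- `τ_η = (2 log η⁻¹)^{1/2}`. -/
def tauL0 (η : ℝ) : ℝ := Real.sqrt (2 * Real.log η⁻¹)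

/-- `k_n = n η`. -/
def effNumL0 (n : ℕ) (η : ℝ) : ℝ := n * η

/-- The configuration with coordinates `t[k_n] + α` for `l ≤ k_n` and `0` for `k_n < l ≤ n`
(the coordinate `l` is the value at `l - 1 : Fin n`). -/
def meanL0 (n : ℕ) (q η α : ℝ) (l : Fin n) : ℝ :=
  open Classical in
  if (l : ℝ) + 1 ≤ effNumL0 n η then fdrBoundary n q (effNumL0 n η) + α else 0

/-! ### The least-favorable family, weak `ℓ_p` case -/

/-- `τ_η = (2 log η^{-p})^{1/2}`. -/
def tauWeak (p η : ℝ) : ℝ := Real.sqrt (2 * Real.log (η ^ (-p)))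

/-- `k_n = n η^p τ_η^{-p}`. -/
def effNumWeak (n : ℕ) (p η : ℝ) : ℝ := n * η ^ p * tauWeak p η ^ (-p)

/-- The extremal sequence `η n^{1/p} l^{-1/p}` of the weak `ℓ_p` ball
(the coordinate `l` is the value at `l - 1 : Fin n`). -/
def extremalWeak (n : ℕ) (p η : ℝ) (l : Fin n) : ℝ :=
  η * (n : ℝ) ^ (1 / p) * ((l : ℝ) + 1) ^ (-(1 / p))

/-- The extremal sequence truncated from above at `m_α = t[k_n] + α`. -/
def meanWeak (n : ℕ) (q p η α : ℝ) (l : Fin n) : ℝ :=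
  min (extremalWeak n p η l) (fdrBoundary n q (effNumWeak n p η) + α)

end

end GaussianFDR

/-!
The false discovery rate estimator thresholds at `t[k̂]`, where `k̂` is the last `k` for which the
number `N(t[k])` of coordinates with `|y_i| ≥ t[k]` is at least `k`. The proof shows that `k̂ / k_n`
concentrates, so that the estimator behaves like hard thresholding at a fixed level, and then
computes the risk of that.

*Where the index concentrates.* The boundary is calibrated so that pure noise exceeds `t[k]` about
`q_n k` times, and `t[κ k_n] - t[k_n] → 0` for each fixed `κ`, so that each of the roughly `k_n`
coordinates at height `t[k_n] + α` exceeds `t[κ k_n]` with probability tending to `Φ(α)`. Hence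
`E N(t[κ k_n]) ≈ (Φ(α) + q κ) k_n` (`TopGroupMeans.tendsto_sum_exceedProb`), which crosses `κ k_n`
at `κ = Φ(α) / (1 - q)`. Chernoff bounds (`prob_le_exceedCount_le`, `prob_exceedCount_le_le`)
confine `k̂ / k_n` to any interval around this value. Control of all `k` above the crossing point is
reduced to a single one by the monotone likelihood ratio of the two-sided normal test: it makes
`k ↦ E N(t[k]) / k` nonincreasing (`exceedProb_mul_le`, `sum_exceedProb_le`). As `k_n / log n → ∞`,
the exceptional event has probability at most `n⁻⁴`, and its contribution to the risk is negligible
(`tendsto_integral_indexEscape`).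

*The risk.* The loss consists of the noise of the kept coordinates, which decreases in the
threshold, and of the means of the missed ones, which increase in it. Off the exceptional event it
therefore lies between two sums of one-coordinate terms at fixed thresholds (`risk_bounds`). The
kept noise is asymptotically `q κ k_n τ^r`, produced by the near-zero coordinates
(`TopGroupMeans.tendsto_sum_exceedLoss`); the missed means give `Φ̃(α) k_n τ^r` from the top group
and the whole `r`-th power mass of the other means, of which only a negligible part is detected
(`TopGroupMeans.tendsto_sum_missed`). Letting `κ` tend to `Φ(α) / (1 - q)` from both sides gives the
limit (`tendsto_risk_div`).

*The two configurations.* `TopGroupMeans` isolates what is needed of the mean vectors. In the `ℓ_0`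
case all means outside the top group vanish. In the weak `ℓ_p` case they follow
`η n^{1/p} l^{-1/p}` for `l` beyond about `k_n`, and `∑ l^{-r/p}` over these `l`, compared with an
integral, yields the mass `p / (r - p)` (`tendsto_sum_Ico_rpow`).
-/

namespace GaussianFDR

/-! ### The normal density and tail -/

/-- The standard normal density. -/
noncomputable def normalDensity (x : ℝ) : ℝ := gaussianPDFReal 0 1 x

lemma normalDensity_eq (x : ℝ) :
    normalDensity x = (Real.sqrt (2 * Real.pi))⁻¹ * Real.exp (-x ^ 2 / 2) := by
  simp [normalDensity, gaussianPDFReal]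

lemma normalDensity_pos (x : ℝ) : 0 < normalDensity x :=
  gaussianPDFReal_pos 0 1 x one_ne_zero

lemma normalDensity_neg (x : ℝ) : normalDensity (-x) = normalDensity x := by
  simp [normalDensity_eq]

lemma normalDensity_le_one (x : ℝ) : normalDensity x ≤ 1 := by
  rw [normalDensity_eq]
  have h1 : (1 : ℝ) ≤ Real.sqrt (2 * Real.pi) := by
    rw [Real.one_le_sqrt]; linarith [Real.pi_gt_three]
  have h2 : Real.exp (-x ^ 2 / 2) ≤ 1 := by
    rw [Real.exp_le_one_iff]; nlinarith [sq_nonneg x]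
  exact mul_le_one₀ (inv_le_one_of_one_le₀ h1) (Real.exp_pos _).le h2

lemma gaussianPDFReal_eq_shift (m x : ℝ) : gaussianPDFReal m 1 x = normalDensity (x - m) := by
  simp [normalDensity, gaussianPDFReal]

lemma normalDensity_sub (x m : ℝ) :
    normalDensity (x - m) = Real.exp (m * x - m ^ 2 / 2) * normalDensity x := by
  simp only [normalDensity_eq]
  rw [mul_left_comm, ← Real.exp_add]
  congr 2; ring

lemma hasDerivAt_normalDensity (x : ℝ) : HasDerivAt normalDensity (-x * normalDensity x) x := by
  have h : HasDerivAt (fun x : ℝ => (Real.sqrt (2 * Real.pi))⁻¹ * Real.exp (-x ^ 2 / 2))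
      ((Real.sqrt (2 * Real.pi))⁻¹ * (Real.exp (-x ^ 2 / 2) * (-(2 * x) / 2))) x := by
    have := (((hasDerivAt_pow 2 x).neg.div_const 2).exp).const_mul (Real.sqrt (2 * Real.pi))⁻¹
    simpa using this
  have h2 : normalDensity = fun x : ℝ => (Real.sqrt (2 * Real.pi))⁻¹ * Real.exp (-x ^ 2 / 2) := by
    ext x; exact normalDensity_eq x
  rw [h2]
  convert h using 1
  ring

lemma integrable_normalDensity : Integrable normalDensity := integrable_gaussianPDFReal 0 1

lemma continuous_normalDensity : Continuous normalDensity :=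
  continuous_iff_continuousAt.2 fun x => (hasDerivAt_normalDensity x).continuousAt

lemma integral_gaussianReal_eq (m : ℝ) (f : ℝ → ℝ) :
    ∫ x, f x ∂(gaussianReal m 1) = ∫ x, normalDensity (x - m) * f x := by
  rw [integral_gaussianReal_eq_integral_smul one_ne_zero]
  simp only [gaussianPDFReal_eq_shift, smul_eq_mul]

lemma integrable_abs_rpow_gaussianReal (m : ℝ) {r : ℝ} (hr : 0 ≤ r) :
    Integrable (fun x => |x| ^ r) (gaussianReal m 1) := by
  have h := (memLp_id_gaussianReal (μ := m) (v := 1) ⟨r, hr⟩).integrable_norm_rpow'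
  exact h

lemma integrable_pow_mul_normalDensity (k : ℕ) : Integrable fun x => x ^ k * normalDensity x := by
  have h : Integrable (fun x : ℝ => x ^ (k : ℝ) * Real.exp (-(1 / 2) * x ^ 2)) :=
    integrable_rpow_mul_exp_neg_mul_sq (by norm_num)
      (lt_of_lt_of_le (by norm_num) (Nat.cast_nonneg k))
  refine (h.const_mul (Real.sqrt (2 * Real.pi))⁻¹).congr (ae_of_all _ fun x => ?_)
  simp only [Real.rpow_natCast, normalDensity_eq]
  rw [show -x ^ 2 / 2 = -(1 / 2) * x ^ 2 by ring]; ring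

lemma gaussianReal_real_eq_integral (m : ℝ) (s : Set ℝ) :
    (gaussianReal m 1).real s = ∫ x in s, normalDensity (x - m) := by
  rw [measureReal_def, gaussianReal_apply_eq_integral m one_ne_zero, ENNReal.toReal_ofReal]
  · simp only [gaussianPDFReal_eq_shift]
  · exact integral_nonneg fun x => gaussianPDFReal_nonneg _ _ _

lemma gaussianReal_real_Ioi (m x : ℝ) :
    (gaussianReal m 1).real (Set.Ioi x) = normalTail (x - m) := by
  have h := gaussianReal_map_add_const (μ := 0) (v := 1) m
  rw [zero_add] at h
  rw [← h, normalTail, map_measureReal_apply (by fun_prop) measurableSet_Ioi]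
  congr 1
  ext y; simp [sub_lt_iff_lt_add]

lemma gaussianReal_real_Ici (m x : ℝ) :
    (gaussianReal m 1).real (Set.Ici x) = normalTail (x - m) := by
  rw [← gaussianReal_real_Ioi]
  have := nullSingletonClass_gaussianReal (μ := m) (v := 1) one_ne_zero
  exact measureReal_congr Ioi_ae_eq_Ici.symm

lemma gaussianReal_real_Iic (m x : ℝ) :
    (gaussianReal m 1).real (Set.Iic x) = normalTail (m - x) := by
  have h := gaussianReal_map_neg (μ := -m) (v := 1)
  rw [neg_neg] at h
  rw [← h, map_measureReal_apply (by fun_prop) measurableSet_Iic]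
  have h2 : (fun y : ℝ => -y) ⁻¹' Set.Iic x = Set.Ici (-x) := by ext y; simp
  rw [h2, gaussianReal_real_Ici]
  congr 1; ring

lemma normalCdf_eq (x : ℝ) : normalCdf x = normalTail (-x) := by
  rw [normalCdf, gaussianReal_real_Iic]; simp

lemma normalTail_eq_integral (x : ℝ) : normalTail x = ∫ y in Set.Ioi x, normalDensity y := by
  rw [normalTail, gaussianReal_real_eq_integral]; simp

lemma normalTail_nonneg (x : ℝ) : 0 ≤ normalTail x := measureReal_nonneg

lemma normalTail_neg (x : ℝ) : normalTail (-x) = 1 - normalTail x := by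
  rw [← normalCdf_eq, normalCdf, normalTail, ← Set.compl_Iic, probReal_compl_eq_one_sub
    measurableSet_Iic]
  ring

lemma normalTail_zero : normalTail 0 = 1 / 2 := by
  have := normalTail_neg 0
  rw [neg_zero] at this; linarith

lemma normalTail_sub_eq {x y : ℝ} (h : x ≤ y) :
    normalTail x - normalTail y = ∫ u in x..y, normalDensity u := by
  rw [normalTail_eq_integral, normalTail_eq_integral, intervalIntegral.integral_of_le h,
    ← Set.Ioc_union_Ioi_eq_Ioi h, setIntegral_union (Set.Ioc_disjoint_Ioi le_rfl) measurableSet_Ioi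
    integrable_normalDensity.integrableOn integrable_normalDensity.integrableOn]
  ring

lemma normalTail_strictAnti : StrictAnti normalTail := by
  intro x y h
  have h1 := normalTail_sub_eq h.le
  have h2 : 0 < ∫ u in x..y, normalDensity u :=
    intervalIntegral.intervalIntegral_pos_of_pos (continuous_normalDensity.intervalIntegrable _ _)
      normalDensity_pos h
  linarith

lemma normalTail_antitone : Antitone normalTail := normalTail_strictAnti.antitone

lemma continuous_normalTail : Continuous normalTail := by
  have h : LipschitzWith 1 normalTail := by
    refine LipschitzWith.of_le_add fun x y => ?_
    rcases le_total x y with h | h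
    · have h1 := normalTail_sub_eq h
      have h2 : ∫ u in x..y, normalDensity u ≤ ∫ u in x..y, (1 : ℝ) :=
        intervalIntegral.integral_mono_on h (continuous_normalDensity.intervalIntegrable _ _)
          (by simp) fun u _ => normalDensity_le_one u
      simp only [intervalIntegral.integral_const, smul_eq_mul, mul_one] at h2
      rw [Real.dist_eq, abs_sub_comm]
      linarith [le_abs_self (y - x)]
    · linarith [normalTail_antitone h, dist_nonneg (x := x) (y := y)]
  exact h.continuous

lemma normalTail_pos (x : ℝ) : 0 < normalTail x :=
  (normalTail_nonneg (x + 1)).trans_lt (normalTail_strictAnti (by linarith))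

lemma normalTail_lt_one (x : ℝ) : normalTail x < 1 := by
  have := normalTail_neg x; have := normalTail_pos (-x); linarith

/-- Shifting the density: on `(x, ∞)` one has `φ(y + c) ≤ e^{-cx - c²/2} φ(y)`. -/
lemma normalTail_add_le (x : ℝ) {c : ℝ} (hc : 0 ≤ c) :
    normalTail (x + c) ≤ Real.exp (-c * x - c ^ 2 / 2) * normalTail x := by
  have h1 : normalTail (x + c) = ∫ y in Set.Ioi x, normalDensity (y + c) := by
    have := gaussianReal_real_Ioi (-c) x
    rw [gaussianReal_real_eq_integral] at this
    simpa using this.symm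
  rw [h1, normalTail_eq_integral, ← integral_const_mul]
  refine setIntegral_mono_on (integrable_normalDensity.comp_add_right c).integrableOn
    (integrable_normalDensity.const_mul _).integrableOn measurableSet_Ioi fun y hy => ?_
  have h2 := normalDensity_sub y (-c)
  rw [sub_neg_eq_add] at h2
  rw [h2]
  refine mul_le_mul_of_nonneg_right (Real.exp_le_exp.2 ?_) (normalDensity_pos y).le
  have : x < y := hy
  nlinarith

lemma normalTail_le_exp {x : ℝ} (hx : 0 ≤ x) : normalTail x ≤ Real.exp (-x ^ 2 / 2) / 2 := by
  have h := normalTail_add_le 0 hx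
  rw [zero_add, normalTail_zero] at h
  refine h.trans (le_of_eq ?_)
  rw [show -x * 0 - x ^ 2 / 2 = -x ^ 2 / 2 by ring]; ring

lemma tendsto_exp_neg_mul_sq {c : ℝ} (hc : 0 < c) :
    Tendsto (fun x : ℝ => Real.exp (-c * x ^ 2)) atTop (𝓝 0) := by
  refine Real.tendsto_exp_atBot.comp ?_
  have : Tendsto (fun x : ℝ => c * x ^ 2) atTop atTop :=
    (tendsto_pow_atTop two_ne_zero).const_mul_atTop hc
  refine (tendsto_neg_atTop_atBot.comp this).congr fun x => ?_
  simp only [Function.comp, neg_mul]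

lemma tendsto_normalTail_atTop : Tendsto normalTail atTop (𝓝 0) := by
  have h := tendsto_exp_neg_mul_sq (c := 1 / 2) (by norm_num)
  refine squeeze_zero' (Eventually.of_forall normalTail_nonneg) ?_ h
  filter_upwards [eventually_ge_atTop 0] with x hx
  refine (normalTail_le_exp hx).trans ?_
  rw [show -(1 / 2) * x ^ 2 = -x ^ 2 / 2 by ring]
  linarith [Real.exp_pos (-x ^ 2 / 2)]

lemma tendsto_mul_normalDensity_atTop :
    Tendsto (fun x => x * normalDensity x) atTop (𝓝 0) := by
  have h : Tendsto (fun x : ℝ => x ^ 1 * Real.exp (-x)) atTop (𝓝 0) :=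
    Real.tendsto_pow_mul_exp_neg_atTop_nhds_zero 1
  refine squeeze_zero' ?_ ?_ h
  · filter_upwards [eventually_ge_atTop 0] with x hx
    exact mul_nonneg hx (normalDensity_pos x).le
  · filter_upwards [eventually_ge_atTop 2] with x hx
    rw [pow_one]
    refine mul_le_mul_of_nonneg_left ?_ (by linarith)
    rw [normalDensity_eq]
    have h1 : (1 : ℝ) ≤ Real.sqrt (2 * Real.pi) := by
      rw [Real.one_le_sqrt]; linarith [Real.pi_gt_three]
    refine (mul_le_of_le_one_left (Real.exp_pos _).le (inv_le_one_of_one_le₀ h1)).trans ?_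
    exact Real.exp_le_exp.2 (by nlinarith)

lemma tendsto_normalDensity_div_atTop :
    Tendsto (fun x => normalDensity x / x) atTop (𝓝 0) := by
  refine squeeze_zero' ?_ ?_ tendsto_mul_normalDensity_atTop
  · filter_upwards [eventually_ge_atTop 0] with x hx
    exact div_nonneg (normalDensity_pos x).le hx
  · filter_upwards [eventually_ge_atTop 1] with x hx
    rw [mul_comm]
    refine (div_le_self (normalDensity_pos x).le hx).trans ?_
    exact le_mul_of_one_le_right (normalDensity_pos x).le hx

/-- Truncated second moment, by integration by parts. -/
lemma setIntegral_sq_mul_normalDensity (x : ℝ) :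
    ∫ y in Set.Ioi x, y ^ 2 * normalDensity y = x * normalDensity x + normalTail x := by
  have hd : ∀ y ∈ Set.Ici x, HasDerivAt (fun y => -(y * normalDensity y))
      (y ^ 2 * normalDensity y - normalDensity y) y := by
    intro y _
    have := ((hasDerivAt_id y).mul (hasDerivAt_normalDensity y)).neg
    exact this.congr_deriv (by simp; ring)
  have hi : IntegrableOn (fun y => y ^ 2 * normalDensity y - normalDensity y) (Set.Ioi x) :=
    ((integrable_pow_mul_normalDensity 2).sub integrable_normalDensity).integrableOn
  have h := integral_Ioi_of_hasDerivAt_of_tendsto' hd hi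
    (by simpa using tendsto_mul_normalDensity_atTop.neg)
  rw [integral_sub (integrable_pow_mul_normalDensity 2).integrableOn
    integrable_normalDensity.integrableOn, ← normalTail_eq_integral] at h
  linarith

/-- The lower bound for Mills' ratio, from `(-φ(y) / y)' = φ(y) (1 + y⁻²)`. -/
lemma normalDensity_le_mul_normalTail {x : ℝ} (hx : 0 < x) :
    normalDensity x ≤ (x + 1 / x) * normalTail x := by
  have hd : ∀ y ∈ Set.Ici x, HasDerivAt (fun y => -(normalDensity y / y))
      (normalDensity y * (1 + 1 / y ^ 2)) y := by
    intro y hy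
    have hy0 : y ≠ 0 := (hx.trans_le hy).ne'
    have := ((hasDerivAt_normalDensity y).div (hasDerivAt_id y) hy0).neg
    exact this.congr_deriv (by simp; field_simp; ring)
  have h0 : Tendsto (fun y => -(normalDensity y / y)) atTop (𝓝 0) := by
    simpa using tendsto_normalDensity_div_atTop.neg
  have hpos : ∀ y ∈ Set.Ioi x, 0 ≤ normalDensity y * (1 + 1 / y ^ 2) := fun y _ =>
    mul_nonneg (normalDensity_pos y).le (by positivity)
  have hi := integrableOn_Ioi_deriv_of_nonneg' hd hpos h0
  have h := integral_Ioi_of_hasDerivAt_of_tendsto' hd hi h0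
  have h2 : ∫ y in Set.Ioi x, normalDensity y * (1 + 1 / y ^ 2)
      ≤ ∫ y in Set.Ioi x, normalDensity y * (1 + 1 / x ^ 2) := by
    refine setIntegral_mono_on hi (integrable_normalDensity.mul_const _).integrableOn
      measurableSet_Ioi fun y hy => ?_
    have : x ≤ y := le_of_lt hy
    refine mul_le_mul_of_nonneg_left ?_ (normalDensity_pos y).le
    gcongr
  rw [integral_mul_const, ← normalTail_eq_integral, h] at h2
  have h3 : normalDensity x / x ≤ normalTail x * (1 + 1 / x ^ 2) := by linarith
  rw [div_le_iff₀ hx] at h3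
  refine h3.trans (le_of_eq ?_)
  field_simp

/-- Since `r ≤ 2`, on `y > x` one has `y^r ≤ x^{r-2} y²`, which reduces the truncated `r`-th moment
to the second one. -/
lemma setIntegral_rpow_mul_normalDensity_le {r x : ℝ} (hr2 : r ≤ 2) (hx : 0 < x) :
    ∫ y in Set.Ioi x, |y| ^ r * normalDensity y ≤ x ^ r * (1 + 2 / x ^ 2) * normalTail x := by
  have h1 : ∫ y in Set.Ioi x, |y| ^ r * normalDensity y
      ≤ ∫ y in Set.Ioi x, (x ^ r / x ^ 2) * (y ^ 2 * normalDensity y) := by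
    refine integral_mono_of_nonneg
      (ae_of_all _ fun y => mul_nonneg (by positivity) (normalDensity_pos y).le)
      ((integrable_pow_mul_normalDensity 2).const_mul _).integrableOn ?_
    filter_upwards [ae_restrict_mem measurableSet_Ioi] with y hy
    have hy : x < y := hy
    have hy0 : 0 < y := hx.trans hy
    rw [← mul_assoc]
    refine mul_le_mul_of_nonneg_right ?_ (normalDensity_pos y).le
    have h3 : (y / x) ^ r ≤ (y / x) ^ (2 : ℝ) :=
      Real.rpow_le_rpow_of_exponent_le ((one_le_div hx).2 hy.le) hr2
    rw [Real.div_rpow hy0.le hx.le, div_le_iff₀ (by positivity), Real.rpow_two, div_pow] at h3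
    rw [abs_of_pos hy0]
    refine h3.trans (le_of_eq (by ring))
  rw [integral_const_mul, setIntegral_sq_mul_normalDensity] at h1
  refine h1.trans ?_
  have h2 := mul_le_mul_of_nonneg_left (normalDensity_le_mul_normalTail hx) hx.le
  have h3 : x * normalDensity x + normalTail x ≤ (x ^ 2 + 2) * normalTail x := by
    have : x * ((x + 1 / x) * normalTail x) = (x ^ 2 + 1) * normalTail x := by field_simp
    linarith
  refine (mul_le_mul_of_nonneg_left h3 (by positivity)).trans (le_of_eq ?_)
  field_simp

/-! ### The upper quantile -/

lemma exists_normalTail_eq {u : ℝ} (h0 : 0 < u) (h1 : u < 1) : ∃ x, normalTail x = u := by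
  have ht := tendsto_normalTail_atTop
  obtain ⟨b, hb⟩ := (ht.eventually (gt_mem_nhds h0)).exists
  obtain ⟨a, ha⟩ := (ht.eventually (gt_mem_nhds (sub_pos.2 h1))).exists
  have ha' : u < normalTail (-a) := by rw [normalTail_neg]; linarith
  have := intermediate_value_univ b (-a) continuous_normalTail
  exact this ⟨hb.le, ha'.le⟩

lemma upperQuantile_normalTail (x : ℝ) : upperQuantile (normalTail x) = x := by
  have : {y : ℝ | normalTail x ≤ normalTail y} = Set.Iic x := by
    ext y; simp [normalTail_strictAnti.le_iff_ge]
  rw [upperQuantile, this, csSup_Iic]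

lemma normalTail_upperQuantile {u : ℝ} (h0 : 0 < u) (h1 : u < 1) :
    normalTail (upperQuantile u) = u := by
  obtain ⟨x, rfl⟩ := exists_normalTail_eq h0 h1
  rw [upperQuantile_normalTail]

lemma upperQuantile_le_upperQuantile {u v : ℝ} (h0 : 0 < u) (huv : u ≤ v) (h1 : v < 1) :
    upperQuantile v ≤ upperQuantile u := by
  rw [← normalTail_strictAnti.le_iff_ge, normalTail_upperQuantile h0 (huv.trans_lt h1),
    normalTail_upperQuantile (h0.trans_le huv) h1]
  exact huv

lemma upperQuantile_pos {u : ℝ} (h0 : 0 < u) (h1 : u < 1 / 2) : 0 < upperQuantile u := by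
  rw [← normalTail_strictAnti.lt_iff_gt, normalTail_upperQuantile h0 (by linarith), normalTail_zero]
  exact h1

lemma tendsto_upperQuantile : Tendsto upperQuantile (𝓝[>] 0) atTop := by
  refine tendsto_atTop.2 fun b => ?_
  have h : Set.Ioo 0 (normalTail b) ∈ 𝓝[>] (0 : ℝ) := Ioo_mem_nhdsGT (normalTail_pos b)
  filter_upwards [h] with u hu
  rw [← normalTail_strictAnti.le_iff_ge, normalTail_upperQuantile hu.1
    (hu.2.trans (normalTail_lt_one b))]
  exact hu.2.le

/-- Changing the level by a constant factor moves the quantile by `o(1)`, because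
`Φ̃(x - c) / Φ̃(x) → ∞` for each `c > 0`. -/
lemma tendsto_upperQuantile_mul_sub {κ : ℝ} (hκ : 0 < κ) :
    Tendsto (fun u => upperQuantile (κ * u) - upperQuantile u) (𝓝[>] 0) (𝓝 0) := by
  have key : ∀ κ : ℝ, 1 ≤ κ → ∀ c : ℝ, 0 < c →
      ∀ᶠ u in 𝓝[>] (0 : ℝ), upperQuantile u - upperQuantile (κ * u) < c := by
    intro κ hκ c hc
    have h1 : Tendsto (fun u => Real.exp (-c * (upperQuantile u - c) - c ^ 2 / 2)) (𝓝[>] 0)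
        (𝓝 0) := by
      refine Real.tendsto_exp_atBot.comp ?_
      have : Tendsto (fun u => c * upperQuantile u - c ^ 2 / 2) (𝓝[>] 0) atTop :=
        tendsto_atTop_add_const_right _ _ (tendsto_upperQuantile.const_mul_atTop hc)
      refine (tendsto_neg_atTop_atBot.comp this).congr fun u => ?_
      simp only [Function.comp]; ring
    have h2 : ∀ᶠ u in 𝓝[>] (0 : ℝ), u ∈ Set.Ioo (0 : ℝ) (1 / κ) :=
      Ioo_mem_nhdsGT (by positivity)
    filter_upwards [h1.eventually (gt_mem_nhds (show (0 : ℝ) < 1 / (κ + 1) by positivity)), h2]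
      with u hu hu2
    have hκu : κ * u < 1 := by
      have := hu2.2; rw [lt_div_iff₀ (by positivity)] at this; linarith
    have hu0 : 0 < u := hu2.1
    have hu1 : u < 1 := by nlinarith
    have h3 := normalTail_add_le (upperQuantile u - c) hc.le
    rw [sub_add_cancel, normalTail_upperQuantile hu0 hu1] at h3
    have h4 : κ * u < normalTail (upperQuantile u - c) := by
      have h5 : u ≤ 1 / (κ + 1) * normalTail (upperQuantile u - c) :=
        h3.trans (mul_le_mul_of_nonneg_right hu.le (normalTail_nonneg _))
      rw [div_mul_eq_mul_div, le_div_iff₀ (by positivity)] at h5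
      nlinarith
    rw [← normalTail_upperQuantile (by positivity) hκu, normalTail_strictAnti.lt_iff_gt] at h4
    linarith
  rw [Metric.tendsto_nhds]
  intro c hc
  rcases le_total 1 κ with h | h
  · have h2 : ∀ᶠ u in 𝓝[>] (0 : ℝ), u ∈ Set.Ioo (0 : ℝ) (1 / κ) :=
      Ioo_mem_nhdsGT (by positivity)
    filter_upwards [key κ h c hc, h2] with u hu hu2
    have hκu : κ * u < 1 := by
      have := hu2.2; rw [lt_div_iff₀ (by positivity)] at this; linarith
    have := upperQuantile_le_upperQuantile hu2.1 (le_mul_of_one_le_left hu2.1.le h) hκu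
    rw [Real.dist_eq, sub_zero, abs_of_nonpos (by linarith)]; linarith
  · have h2 : ∀ᶠ u in 𝓝[>] (0 : ℝ), u ∈ Set.Ioo (0 : ℝ) 1 := Ioo_mem_nhdsGT (by positivity)
    have h3 : Tendsto (fun u : ℝ => κ * u) (𝓝[>] 0) (𝓝[>] 0) := by
      refine tendsto_nhdsWithin_iff.2 ⟨?_, ?_⟩
      · have : Tendsto (fun u : ℝ => κ * u) (𝓝 0) (𝓝 (κ * 0)) := tendsto_id.const_mul κ
        rw [mul_zero] at this
        exact this.mono_left nhdsWithin_le_nhds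
      · filter_upwards [self_mem_nhdsWithin] with u hu
        exact mul_pos hκ hu
    filter_upwards [h3.eventually (key κ⁻¹ (one_le_inv_iff₀.2 ⟨hκ, h⟩) c hc), h2] with u hu hu2
    rw [inv_mul_cancel_left₀ hκ.ne'] at hu
    have := upperQuantile_le_upperQuantile (mul_pos hκ hu2.1) (mul_le_of_le_one_left hu2.1.le h)
      hu2.2
    rw [Real.dist_eq, sub_zero, abs_of_nonneg (by linarith)]; linarith

/-- The quantile is asymptotic to `(2 log u⁻¹)^{1/2}` as `u → 0`; stated with both sides squared. -/
lemma tendsto_upperQuantile_sq_div_log :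
    Tendsto (fun u => upperQuantile u ^ 2 / (2 * Real.log u⁻¹)) (𝓝[>] 0) (𝓝 1) := by
  have h : Tendsto (fun x : ℝ => 2 * Real.log (normalTail x)⁻¹ / x ^ 2) atTop (𝓝 1) := by
    have hup : Tendsto (fun x : ℝ =>
        1 + 2 * ((Real.log (2 * x)  + Real.log (Real.sqrt (2 * Real.pi))) / x ^ 2)) atTop
        (𝓝 1) := by
      have h1 : Tendsto (fun x : ℝ => Real.log x / x ^ 2) atTop (𝓝 0) := by
        have := (isLittleO_log_rpow_atTop (r := 2) (by norm_num)).tendsto_div_nhds_zero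
        simpa using this
      have h2 : ∀ c : ℝ, Tendsto (fun x : ℝ => c / x ^ 2) atTop (𝓝 0) := fun c =>
        tendsto_const_nhds.div_atTop (tendsto_pow_atTop two_ne_zero)
      have h3 : Tendsto (fun x : ℝ => 1 + 2 * (Real.log 2 / x ^ 2 + Real.log x / x ^ 2
          + Real.log (Real.sqrt (2 * Real.pi)) / x ^ 2)) atTop (𝓝 (1 + 2 * (0 + 0 + 0))) :=
        ((((h2 _).add h1).add (h2 _)).const_mul 2).const_add 1
      simp only [add_zero, mul_zero] at h3
      refine h3.congr' ?_
      filter_upwards [eventually_gt_atTop 0] with x hx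
      rw [Real.log_mul two_ne_zero hx.ne']; ring
    refine tendsto_of_tendsto_of_tendsto_of_le_of_le' tendsto_const_nhds hup ?_ ?_
    · filter_upwards [eventually_gt_atTop 0] with x hx
      have h1 := normalTail_le_exp hx.le
      have h2 : normalTail x ≤ Real.exp (-x ^ 2 / 2) := by
        linarith [Real.exp_pos (-x ^ 2 / 2)]
      have h3 := Real.log_le_log (normalTail_pos x) h2
      rw [Real.log_exp] at h3
      rw [Real.log_inv, le_div_iff₀ (by positivity)]; linarith
    · filter_upwards [eventually_ge_atTop 1] with x hx
      have hx0 : 0 < x := by linarith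
      have h1 := normalDensity_le_mul_normalTail hx0
      have h2 : x + 1 / x ≤ 2 * x := by
        have : 1 / x ≤ 1 := (div_le_one hx0).2 hx
        linarith
      have h3 : normalDensity x ≤ 2 * x * normalTail x :=
        h1.trans (mul_le_mul_of_nonneg_right h2 (normalTail_nonneg x))
      have h4 := Real.log_le_log (normalDensity_pos x) h3
      rw [normalDensity_eq, Real.log_mul (by positivity) (by positivity), Real.log_exp,
        Real.log_inv, Real.log_mul (by positivity) (normalTail_pos x).ne'] at h4
      rw [Real.log_inv, div_le_iff₀ (by positivity)]
      have h5 : (1 + 2 * ((Real.log (2 * x) + Real.log (Real.sqrt (2 * Real.pi))) / x ^ 2)) * x ^ 2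
          = x ^ 2 + 2 * (Real.log (2 * x) + Real.log (Real.sqrt (2 * Real.pi))) := by
        field_simp
      rw [h5]; linarith
  have h2 := (h.comp tendsto_upperQuantile).inv₀ one_ne_zero
  rw [inv_one] at h2
  refine h2.congr' ?_
  have h3 : ∀ᶠ u in 𝓝[>] (0 : ℝ), u ∈ Set.Ioo (0 : ℝ) 1 := Ioo_mem_nhdsGT (by positivity)
  filter_upwards [h3] with u hu
  simp only [Function.comp, inv_div, normalTail_upperQuantile hu.1 hu.2]

/-- The tail is locally flat at scale `o(1 / x)`. -/
lemma normalTail_sub_le {x h : ℝ} (hx : 0 < x) (hh : 0 ≤ h) (hge : h ≤ x) :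
    normalTail (x - h) ≤ (1 + h * (x + 1 / x) * Real.exp (x * h)) * normalTail x := by
  have h1 := normalTail_sub_eq (sub_le_self x hh)
  have h2 : ∫ u in (x - h)..x, normalDensity u ≤ ∫ u in (x - h)..x, normalDensity (x - h) := by
    refine intervalIntegral.integral_mono_on (sub_le_self x hh)
      (continuous_normalDensity.intervalIntegrable _ _) (by simp) fun u hu => ?_
    simp only [normalDensity_eq]
    refine mul_le_mul_of_nonneg_left (Real.exp_le_exp.2 ?_) (by positivity)
    have := hu.1
    nlinarith [sub_nonneg.2 hge]
  simp only [intervalIntegral.integral_const, smul_eq_mul, sub_sub_cancel] at h2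
  have h3 : normalDensity (x - h) ≤ Real.exp (x * h) * ((x + 1 / x) * normalTail x) := by
    rw [normalDensity_sub]
    refine mul_le_mul (Real.exp_le_exp.2 ?_) (normalDensity_le_mul_normalTail hx)
      (normalDensity_pos x).le (Real.exp_pos _).le
    nlinarith [sq_nonneg h]
  have h4 := mul_le_mul_of_nonneg_left h3 hh
  nlinarith

/-! ### One coordinate: exceedance probability and exceedance loss -/

/-- The probability that `y ~ N(μ, 1)` exceeds `T` in magnitude. -/
noncomputable def exceedProb (μ T : ℝ) : ℝ := (gaussianReal μ 1).real {y | T ≤ |y|}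

/-- The part of `E |y - μ|^r`, `y ~ N(μ, 1)`, that comes from `|y| ≥ T`. -/
noncomputable def exceedLoss (r μ T : ℝ) : ℝ :=
  ∫ y in {y | T ≤ |y|}, |y - μ| ^ r ∂(gaussianReal μ 1)

lemma measurableSet_le_abs (T : ℝ) : MeasurableSet {y : ℝ | T ≤ |y|} :=
  measurableSet_le measurable_const measurable_norm

lemma measurable_abs_sub_rpow (r μ : ℝ) : Measurable fun y : ℝ => |y - μ| ^ r :=
  (measurable_id.sub_const μ).abs.pow_const r

lemma exceedProb_nonneg (μ T : ℝ) : 0 ≤ exceedProb μ T := measureReal_nonneg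

lemma exceedProb_le_one (μ T : ℝ) : exceedProb μ T ≤ 1 := measureReal_le_one

lemma setOf_le_abs_eq (T : ℝ) : {y : ℝ | T ≤ |y|} = Set.Iic (-T) ∪ Set.Ici T := by
  ext y
  simp only [Set.mem_ofPred_eq, le_abs, Set.mem_union, Set.mem_Ici, Set.mem_Iic]
  rw [or_comm, le_neg]

lemma exceedProb_eq (μ : ℝ) {T : ℝ} (hT : 0 < T) :
    exceedProb μ T = normalTail (T - μ) + normalTail (T + μ) := by
  rw [exceedProb, setOf_le_abs_eq, measureReal_union _ measurableSet_Ici, gaussianReal_real_Ici,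
    gaussianReal_real_Iic, add_comm, sub_neg_eq_add, add_comm μ]
  rw [Set.disjoint_left]
  intro y hy hy'
  simp only [Set.mem_Iic, Set.mem_Ici] at hy hy'
  linarith

lemma normalDensity_sub_add (μ x : ℝ) : normalDensity (x - μ) + normalDensity (x + μ)
    = 2 * Real.exp (-μ ^ 2 / 2) * Real.cosh (μ * x) * normalDensity x := by
  have h := normalDensity_sub x (-μ)
  rw [sub_neg_eq_add] at h
  rw [h, normalDensity_sub, Real.cosh_eq, ← add_mul, neg_sq, sub_eq_add_neg, sub_eq_add_neg,
    Real.exp_add, Real.exp_add, neg_mul, neg_div]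
  ring

/-- The two-sided test of a zero mean has monotone likelihood ratio: the exceedance probability
under mean `μ`, relative to that under mean zero, increases with the threshold. -/
lemma normalTail_pair_mul_le (μ : ℝ) {s t : ℝ} (hs : 0 ≤ s) (hst : s ≤ t) :
    (normalTail (s - μ) + normalTail (s + μ)) * normalTail t
      ≤ (normalTail (t - μ) + normalTail (t + μ)) * normalTail s := by
  set L : ℝ → ℝ := fun x => 2 * Real.exp (-μ ^ 2 / 2) * Real.cosh (μ * x) with hL
  have hF : ∀ x, normalTail (x - μ) + normalTail (x + μ)
      = ∫ y in Set.Ioi x, (normalDensity (y - μ) + normalDensity (y + μ)) := by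
    intro x
    rw [integral_add (integrable_normalDensity.comp_sub_right μ).integrableOn
      (integrable_normalDensity.comp_add_right μ).integrableOn, ← gaussianReal_real_Ioi,
      gaussianReal_real_eq_integral]
    congr 1
    have := gaussianReal_real_Ioi (-μ) x
    rw [gaussianReal_real_eq_integral] at this
    simpa using this.symm
  have hi : Integrable fun y => normalDensity (y - μ) + normalDensity (y + μ) :=
    (integrable_normalDensity.comp_sub_right μ).add (integrable_normalDensity.comp_add_right μ)
  have hmono : ∀ x y, 0 ≤ x → x ≤ y → L x ≤ L y := by
    intro x y hx hxy
    refine mul_le_mul_of_nonneg_left (Real.cosh_le_cosh.2 ?_) (by positivity)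
    rw [abs_mul, abs_mul, abs_of_nonneg hx, abs_of_nonneg (hx.trans hxy)]
    exact mul_le_mul_of_nonneg_left hxy (abs_nonneg _)
  have ht : 0 ≤ t := hs.trans hst
  have h1 : L t * normalTail t ≤ normalTail (t - μ) + normalTail (t + μ) := by
    rw [hF, normalTail_eq_integral, ← integral_const_mul]
    refine setIntegral_mono_on (integrable_normalDensity.const_mul _).integrableOn
      hi.integrableOn measurableSet_Ioi fun y hy => ?_
    rw [normalDensity_sub_add]
    exact mul_le_mul_of_nonneg_right (hmono t y ht (le_of_lt hy)) (normalDensity_pos y).le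
  have h2 : normalTail (s - μ) + normalTail (s + μ) ≤ normalTail (t - μ) + normalTail (t + μ)
      + L t * (normalTail s - normalTail t) := by
    rw [hF, hF, ← Set.Ioc_union_Ioi_eq_Ioi hst, setIntegral_union (Set.Ioc_disjoint_Ioi le_rfl)
      measurableSet_Ioi hi.integrableOn hi.integrableOn, normalTail_sub_eq hst,
      intervalIntegral.integral_of_le hst, ← integral_const_mul, add_comm]
    refine add_le_add le_rfl ?_
    refine setIntegral_mono_on hi.integrableOn (integrable_normalDensity.const_mul _).integrableOn
      measurableSet_Ioc fun y hy => ?_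
    rw [normalDensity_sub_add]
    exact mul_le_mul_of_nonneg_right (hmono y t (hs.trans hy.1.le) hy.2) (normalDensity_pos y).le
  have h3 := mul_le_mul_of_nonneg_right h2 (normalTail_nonneg t)
  have h4 := mul_le_mul_of_nonneg_right h1 (sub_nonneg.2 (normalTail_antitone hst))
  nlinarith

lemma exceedProb_mul_le (μ : ℝ) {s t : ℝ} (hs : 0 < s) (hst : s ≤ t) :
    exceedProb μ s * normalTail t ≤ exceedProb μ t * normalTail s := by
  rw [exceedProb_eq μ hs, exceedProb_eq μ (hs.trans_le hst)]
  exact normalTail_pair_mul_le μ hs.le hst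

lemma two_mul_normalTail_le_exceedProb (μ : ℝ) {T : ℝ} (hT : 0 < T) :
    2 * normalTail T ≤ exceedProb μ T := by
  have h := normalTail_pair_mul_le μ le_rfl hT.le
  rw [exceedProb_eq μ hT]
  rw [zero_sub, zero_add, normalTail_neg, normalTail_zero] at h
  linarith

lemma exceedProb_le_two_mul {μ h T : ℝ} (hμ : |μ| ≤ h) (hT : 0 < T) :
    exceedProb μ T ≤ 2 * normalTail (T - h) := by
  have hμ := abs_le.1 hμ
  rw [exceedProb_eq μ hT]
  have h1 : normalTail (T - μ) ≤ normalTail (T - h) := normalTail_antitone (by linarith)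
  have h2 : normalTail (T + μ) ≤ normalTail (T - h) := normalTail_antitone (by linarith)
  linarith

lemma exceedLoss_eq (r μ T : ℝ) :
    exceedLoss r μ T = ∫ z in {z | T ≤ |z + μ|}, |z| ^ r ∂(gaussianReal 0 1) := by
  have h := gaussianReal_map_add_const (μ := 0) (v := 1) μ
  rw [zero_add] at h
  rw [exceedLoss, ← h, setIntegral_map (measurableSet_le_abs T)
    (measurable_abs_sub_rpow r μ).aestronglyMeasurable (by fun_prop)]
  simp only [add_sub_cancel_right]
  rfl

lemma exceedProb_eq_noise (μ T : ℝ) :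
    exceedProb μ T = (gaussianReal 0 1).real {z | T ≤ |z + μ|} := by
  have h := gaussianReal_map_add_const (μ := 0) (v := 1) μ
  rw [zero_add] at h
  rw [exceedProb, ← h, map_measureReal_apply (by fun_prop) (measurableSet_le_abs T)]
  rfl

lemma exceedLoss_nonneg (r μ T : ℝ) : 0 ≤ exceedLoss r μ T :=
  integral_nonneg fun _ => by positivity

lemma integral_abs_rpow_le {r : ℝ} (hr0 : 0 < r) (hr2 : r ≤ 2) :
    ∫ z, |z| ^ r ∂(gaussianReal 0 1) ≤ 2 := by
  have h2 : ∫ z, z ^ 2 ∂(gaussianReal 0 1) = 1 := by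
    have := variance_fun_id_gaussianReal (μ := 0) (v := 1)
    rw [variance_of_integral_eq_zero (by fun_prop) (integral_id_gaussianReal)] at this
    simpa using this
  have hi : Integrable (fun z : ℝ => z ^ 2) (gaussianReal 0 1) := by
    simpa using integrable_abs_rpow_gaussianReal 0 (r := 2) (by norm_num)
  calc ∫ z, |z| ^ r ∂(gaussianReal 0 1) ≤ ∫ z, (1 + z ^ 2) ∂(gaussianReal 0 1) := by
        refine integral_mono (integrable_abs_rpow_gaussianReal 0 hr0.le)
          ((integrable_const _).add hi) fun z => ?_
        rcases le_total |z| 1 with h | h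
        · have := Real.rpow_le_one (abs_nonneg z) h hr0.le
          simp only; nlinarith [sq_nonneg z]
        · have := Real.rpow_le_rpow_of_exponent_le h hr2
          rw [Real.rpow_two, sq_abs] at this
          simp only; linarith
    _ = 2 := by rw [integral_add (integrable_const _) hi, h2]; simp; norm_num

lemma exceedLoss_le_two {r : ℝ} (hr0 : 0 < r) (hr2 : r ≤ 2) (μ T : ℝ) : exceedLoss r μ T ≤ 2 := by
  rw [exceedLoss_eq]
  exact (setIntegral_le_integral (integrable_abs_rpow_gaussianReal 0 hr0.le)
    (ae_of_all _ fun z => by positivity)).trans (integral_abs_rpow_le hr0 hr2)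

lemma setIntegral_le_abs_rpow_le {r x : ℝ} (hr0 : 0 < r) (hr2 : r ≤ 2) (hx : 0 < x) :
    ∫ z in {z | x ≤ |z|}, |z| ^ r ∂(gaussianReal 0 1)
      ≤ x ^ r * (1 + 2 / x ^ 2) * (2 * normalTail x) := by
  have hi : Integrable fun z => normalDensity z * |z| ^ r := by
    have h := integrable_abs_rpow_gaussianReal 0 hr0.le
    rw [gaussianReal_of_var_ne_zero _ one_ne_zero, integrable_withDensity_iff_integrable_smul'
      (measurable_gaussianPDF _ _) (ae_of_all _ fun _ => gaussianPDF_lt_top)] at h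
    simpa [toReal_gaussianPDF, normalDensity] using h
  have h1 : ∫ z in {z | x ≤ |z|}, |z| ^ r ∂(gaussianReal 0 1)
      = 2 * ∫ z in Set.Ioi x, |z| ^ r * normalDensity z := by
    rw [← integral_indicator (measurableSet_le_abs x), integral_gaussianReal_eq]
    simp only [sub_zero, ← Set.indicator_mul_right _ (fun z => normalDensity z)]
    rw [integral_indicator (measurableSet_le_abs x), setOf_le_abs_eq, setIntegral_union _
      measurableSet_Ici hi.integrableOn hi.integrableOn, integral_Ici_eq_integral_Ioi,
      ← integral_comp_neg_Ioi x (fun z => normalDensity z * |z| ^ r)]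
    · simp only [normalDensity_neg, abs_neg, mul_comm]
      ring
    · rw [Set.disjoint_left]
      intro y hy hy'
      simp only [Set.mem_Iic, Set.mem_Ici] at hy hy'
      linarith
  rw [h1]
  have := setIntegral_rpow_mul_normalDensity_le hr2 hx
  linarith

lemma exceedLoss_le {r μ h T : ℝ} (hr0 : 0 < r) (hr2 : r ≤ 2) (hμ : |μ| ≤ h) (hT : h < T) :
    exceedLoss r μ T ≤ (T - h) ^ r * (1 + 2 / (T - h) ^ 2) * (2 * normalTail (T - h)) := by
  rw [exceedLoss_eq]
  refine le_trans ?_ (setIntegral_le_abs_rpow_le hr0 hr2 (sub_pos.2 hT))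
  refine setIntegral_mono_set (integrable_abs_rpow_gaussianReal 0 hr0.le).integrableOn
    (ae_of_all _ fun z => by positivity) (LE.le.eventuallyLE fun z hz => ?_)
  simp only [Set.mem_ofPred_eq] at hz ⊢
  have := abs_add_le z μ
  linarith

lemma le_exceedLoss {r μ h T : ℝ} (hr0 : 0 < r) (hμ : |μ| ≤ h) (hT : h ≤ T) :
    (T - h) ^ r * exceedProb μ T ≤ exceedLoss r μ T := by
  rw [exceedLoss_eq, exceedProb_eq_noise, mul_comm, ← smul_eq_mul, ← setIntegral_const]
  refine setIntegral_mono_on (integrable_const _).integrableOn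
    (integrable_abs_rpow_gaussianReal 0 hr0.le).integrableOn
    (measurableSet_le measurable_const (by fun_prop)) fun z hz => ?_
  refine Real.rpow_le_rpow (sub_nonneg.2 hT) ?_ hr0.le
  simp only [Set.mem_ofPred_eq] at hz
  have := abs_add_le z μ
  linarith

/-! ### The FDR index through exceedance counts -/

open Classical in
/-- The number of coordinates of magnitude at least `T`. -/
noncomputable def exceedCount {n : ℕ} (T : ℝ) (y : Fin n → ℝ) : ℕ :=
  (Finset.univ.filter fun i => T ≤ |y i|).card

lemma exceedCount_le {n : ℕ} (T : ℝ) (y : Fin n → ℝ) : exceedCount T y ≤ n := by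
  classical
  exact (Finset.card_filter_le _ _).trans (by simp)

lemma exceedCount_antitone {n : ℕ} (y : Fin n → ℝ) : Antitone fun T => exceedCount T y := by
  classical
  intro s t hst
  exact Finset.card_le_card (Finset.monotone_filter_right _ fun i _ h => hst.trans h)

lemma exceedCount_eq_sum {n : ℕ} (T : ℝ) (y : Fin n → ℝ) :
    (exceedCount T y : ℝ) = ∑ i, Set.indicator {x : ℝ | T ≤ |x|} 1 (y i) := by
  classical
  rw [exceedCount, Finset.card_filter]
  push_cast
  refine Finset.sum_congr rfl fun i _ => ?_
  by_cases h : T ≤ |y i| <;> simp [h]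

lemma measurable_exceedCount {n : ℕ} (T : ℝ) :
    Measurable fun y : Fin n → ℝ => (exceedCount T y : ℝ) := by
  simp only [exceedCount_eq_sum]
  refine Finset.measurable_sum _ fun i _ => ?_
  exact (measurable_one.indicator (measurableSet_le_abs T)).comp (measurable_pi_apply i)

lemma le_orderedAbs_iff {n : ℕ} (y : Fin n → ℝ) (k : Fin n) (T : ℝ) :
    T ≤ orderedAbs y k ↔ (k : ℕ) + 1 ≤ exceedCount T y := by
  classical
  have hanti : Antitone (orderedAbs y) := by
    intro a b hab
    have := Tuple.monotone_sort (fun i => -|y i|) hab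
    simpa [orderedAbs] using this
  rw [← Tuple.lt_card_ge_iff_apply_ge_of_antitone hanti, ← Nat.succ_le_iff, exceedCount]
  have : (Finset.univ.filter fun i => T ≤ orderedAbs y i).card
      = (Finset.univ.filter fun i => T ≤ |y i|).card := by
    refine Finset.card_equiv (Tuple.sort fun i => -|y i|) fun i => ?_
    rw [Finset.mem_filter, Finset.mem_filter]
    simp [orderedAbs]
  rw [← this]

lemma le_fdrIndex {n : ℕ} (q : ℝ) (y : Fin n → ℝ) {k : ℕ} (hk : 1 ≤ k)
    (h : k ≤ exceedCount (fdrBoundary n q k) y) : k ≤ fdrIndex q y := by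
  have hkn : k ≤ n := h.trans (exceedCount_le _ _)
  obtain ⟨j, rfl⟩ : ∃ j, k = j + 1 := ⟨k - 1, by omega⟩
  have hmem : (⟨j, hkn⟩ : Fin n) ∈
      {k : Fin n | fdrBoundary n q ((k : ℝ) + 1) ≤ orderedAbs y k}.toFinite.toFinset := by
    simp only [Set.Finite.mem_toFinset, Set.mem_ofPred_eq, le_orderedAbs_iff]
    simpa using h
  exact Finset.le_sup (f := fun k : Fin n => (k : ℕ) + 1) hmem

lemma fdrIndex_le_exceedCount {n : ℕ} (q : ℝ) (y : Fin n → ℝ) (h : 0 < fdrIndex q y) :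
    fdrIndex q y ≤ exceedCount (fdrBoundary n q (fdrIndex q y)) y := by
  set S := {k : Fin n | fdrBoundary n q ((k : ℝ) + 1) ≤ orderedAbs y k}.toFinite.toFinset with hS
  have hne : S.Nonempty := by
    by_contra hne
    rw [Finset.not_nonempty_iff_eq_empty] at hne
    have h0 : fdrIndex q y = S.sup fun k : Fin n => (k : ℕ) + 1 := rfl
    simp [h0, hne] at h
  obtain ⟨k, hk, hk2⟩ := Finset.exists_mem_eq_sup S hne (fun k : Fin n => (k : ℕ) + 1)
  have hk3 : fdrIndex q y = (k : ℕ) + 1 := hk2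
  rw [hk3]
  simp only [hS, Set.Finite.mem_toFinset, Set.mem_ofPred_eq, le_orderedAbs_iff] at hk
  push_cast
  exact hk

lemma fdrIndex_le {n : ℕ} (q : ℝ) (y : Fin n → ℝ) : fdrIndex q y ≤ n := by
  rcases Nat.eq_zero_or_pos (fdrIndex q y) with h | h
  · omega
  · exact (fdrIndex_le_exceedCount q y h).trans (exceedCount_le _ _)

lemma le_fdrIndex_iff {n : ℕ} (q : ℝ) (y : Fin n → ℝ) {m : ℕ} (hm : 1 ≤ m) :
    m ≤ fdrIndex q y ↔ ∃ k, m ≤ k ∧ k ≤ exceedCount (fdrBoundary n q k) y := by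
  constructor
  · intro h
    exact ⟨_, h, fdrIndex_le_exceedCount q y (hm.trans h)⟩
  · rintro ⟨k, hk, hk2⟩
    exact hk.trans (le_fdrIndex q y (hm.trans hk) hk2)

lemma measurable_fdrIndex {n : ℕ} (q : ℝ) : Measurable fun y : Fin n → ℝ => fdrIndex q y := by
  refine measurable_of_Ici fun m => ?_
  rcases Nat.eq_zero_or_pos m with rfl | hm
  · simp
  · have : (fun y : Fin n → ℝ => fdrIndex q y) ⁻¹' Set.Ici m
        = ⋃ k : ℕ, {_y | m ≤ k} ∩ {y | (k : ℝ) ≤ exceedCount (fdrBoundary n q k) y} := by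
      ext y
      simp [le_fdrIndex_iff q y hm]
    rw [this]
    exact MeasurableSet.iUnion fun k => (MeasurableSet.const _).inter
      (measurableSet_le measurable_const (measurable_exceedCount (fdrBoundary n q k)))

lemma measurable_fdrEstimator {n : ℕ} (q : ℝ) (i : Fin n) :
    Measurable fun y : Fin n → ℝ => fdrEstimator q y i := by
  unfold fdrEstimator
  refine Measurable.ite ?_ (measurable_pi_apply i) measurable_const
  have h1 : Measurable fun y : Fin n → ℝ => fdrIndex q y := measurable_fdrIndex q
  have h2 : Measurable fun y : Fin n → ℝ => fdrBoundary n q (fdrIndex q y) :=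
    (measurable_from_nat (f := fun m : ℕ => fdrBoundary n q m)).comp h1
  exact (measurableSet_lt measurable_const h1).inter
    (measurableSet_le h2 (measurable_pi_apply i).abs)

/-! ### Integrability and the sandwich by fixed thresholds -/

/-- The loss of a coordinate that is kept when `|x| ≥ a` and for which the mean is charged when
`|x| < b`. With `a = b` it is the loss of hard thresholding at `a`. -/
noncomputable def bracketLoss (r μ a b x : ℝ) : ℝ :=
  Set.indicator {x | a ≤ |x|} (fun x => |x - μ| ^ r) x
    + Set.indicator {x | b ≤ |x|}ᶜ (fun _ => |μ| ^ r) x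

lemma bracketLoss_nonneg (r μ a b x : ℝ) : 0 ≤ bracketLoss r μ a b x :=
  add_nonneg (Set.indicator_nonneg (fun _ _ => by positivity) _)
    (Set.indicator_nonneg (fun _ _ => by positivity) _)

/-- A bound for the loss of a coordinate that holds for every threshold. -/
noncomputable def envelope (r μ x : ℝ) : ℝ := |x - μ| ^ r + |μ| ^ r

lemma bracketLoss_le_envelope (r μ a b x : ℝ) : bracketLoss r μ a b x ≤ envelope r μ x :=
  add_le_add (Set.indicator_le_self' (fun _ _ => by positivity) _)
    (Set.indicator_le_self' (fun _ _ => by positivity) _)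

lemma fdrEstimator_loss_eq {n : ℕ} (r q : ℝ) (μ y : Fin n → ℝ) (i : Fin n)
    (h : 0 < fdrIndex q y) : |fdrEstimator q y i - μ i| ^ r
      = bracketLoss r (μ i) (fdrBoundary n q (fdrIndex q y)) (fdrBoundary n q (fdrIndex q y))
          (y i) := by
  by_cases h2 : fdrBoundary n q (fdrIndex q y) ≤ |y i|
  · simp [fdrEstimator, bracketLoss, h, h2]
  · simp [fdrEstimator, bracketLoss, h2]

lemma bracketLoss_mono {a a' b b' : ℝ} (ha : a' ≤ a) (hb : b ≤ b') (r μ x : ℝ) :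
    bracketLoss r μ a b x ≤ bracketLoss r μ a' b' x := by
  refine add_le_add ?_ ?_
  · exact Set.indicator_le_indicator_of_subset (fun y hy => ha.trans hy)
      (fun _ => by positivity) _
  · refine Set.indicator_le_indicator_of_subset ?_ (fun _ => by positivity) _
    exact Set.compl_subset_compl.2 fun y hy => hb.trans hy

lemma fdrEstimator_loss_le_envelope {n : ℕ} (r q : ℝ) (μ y : Fin n → ℝ) (i : Fin n) :
    |fdrEstimator q y i - μ i| ^ r ≤ envelope r (μ i) (y i) := by
  have h1 : 0 ≤ |y i - μ i| ^ r := by positivity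
  have h2 : 0 ≤ |μ i| ^ r := by positivity
  unfold fdrEstimator envelope
  split_ifs
  · linarith
  · rw [zero_sub, abs_neg]; linarith

instance isProbabilityMeasure_observationLaw {n : ℕ} (μ : Fin n → ℝ) :
    IsProbabilityMeasure (observationLaw μ) := by
  unfold observationLaw; infer_instance

lemma measurePreserving_eval_observationLaw {n : ℕ} (μ : Fin n → ℝ) (i : Fin n) :
    MeasurePreserving (fun y : Fin n → ℝ => y i) (observationLaw μ) (gaussianReal (μ i) 1) :=
  measurePreserving_eval (fun i => gaussianReal (μ i) 1) i

lemma integrable_abs_sub_rpow_gaussianReal (μ : ℝ) {r : ℝ} (hr : 0 ≤ r) :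
    Integrable (fun x => |x - μ| ^ r) (gaussianReal μ 1) := by
  have h := gaussianReal_map_add_const (μ := 0) (v := 1) μ
  rw [zero_add] at h
  rw [← h, integrable_map_measure (measurable_abs_sub_rpow r μ).aestronglyMeasurable (by fun_prop)]
  simpa [Function.comp_def] using integrable_abs_rpow_gaussianReal 0 hr

lemma integrable_noise {n : ℕ} (μ : Fin n → ℝ) (i : Fin n) {r : ℝ} (hr : 0 ≤ r) :
    Integrable (fun y : Fin n → ℝ => |y i - μ i| ^ r) (observationLaw μ) :=
  (measurePreserving_eval_observationLaw μ i).integrable_comp_of_integrable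
    (integrable_abs_sub_rpow_gaussianReal (μ i) hr)

lemma integrable_envelope {n : ℕ} (μ : Fin n → ℝ) (i : Fin n) {r : ℝ} (hr : 0 ≤ r) :
    Integrable (fun y : Fin n → ℝ => envelope r (μ i) (y i)) (observationLaw μ) :=
  (integrable_noise μ i hr).add (integrable_const _)

lemma integrable_fdr_loss {n : ℕ} (q : ℝ) (μ : Fin n → ℝ) {r : ℝ} (hr : 0 ≤ r) :
    Integrable (fun y => lrLoss r (fdrEstimator q y) μ) (observationLaw μ) := by
  refine integrable_finsetSum _ fun i _ => ?_
  refine (integrable_envelope μ i hr).mono' ?_ (ae_of_all _ fun y => ?_)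
  · exact ((((measurable_fdrEstimator q i).sub_const _).abs).pow_const r).aestronglyMeasurable
  · rw [Real.norm_of_nonneg (by positivity)]
    exact fdrEstimator_loss_le_envelope r q μ y i

lemma integrable_bracketLoss_gaussianReal (μ a b : ℝ) {r : ℝ} (hr : 0 ≤ r) :
    Integrable (bracketLoss r μ a b) (gaussianReal μ 1) :=
  ((integrable_abs_sub_rpow_gaussianReal μ hr).indicator (measurableSet_le_abs a)).add
    ((integrable_const _).indicator (measurableSet_le_abs b).compl)

lemma integrable_bracketLoss {n : ℕ} (μ : Fin n → ℝ) (i : Fin n) (a b : ℝ) {r : ℝ} (hr : 0 ≤ r) :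
    Integrable (fun y : Fin n → ℝ => bracketLoss r (μ i) a b (y i)) (observationLaw μ) :=
  (measurePreserving_eval_observationLaw μ i).integrable_comp_of_integrable
    (integrable_bracketLoss_gaussianReal (μ i) a b hr)

lemma integral_bracketLoss {n : ℕ} (μ : Fin n → ℝ) (i : Fin n) (a b : ℝ) {r : ℝ} (hr : 0 ≤ r) :
    ∫ y, bracketLoss r (μ i) a b (y i) ∂(observationLaw μ)
      = exceedLoss r (μ i) a + |μ i| ^ r * (1 - exceedProb (μ i) b) := by
  have hmp := measurePreserving_eval_observationLaw μ i
  have h1 : ∫ y, bracketLoss r (μ i) a b (y i) ∂(observationLaw μ)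
      = ∫ x, bracketLoss r (μ i) a b x ∂(gaussianReal (μ i) 1) := by
    rw [← hmp.map_eq, integral_map hmp.measurable.aemeasurable]
    rw [hmp.map_eq]
    exact (integrable_bracketLoss_gaussianReal (μ i) a b hr).aestronglyMeasurable
  rw [h1]
  unfold bracketLoss
  rw [integral_add ((integrable_abs_sub_rpow_gaussianReal _ hr).indicator (measurableSet_le_abs a))
    ((integrable_const _).indicator (measurableSet_le_abs b).compl),
    integral_indicator (measurableSet_le_abs a),
    integral_indicator (measurableSet_le_abs b).compl, setIntegral_const,
    probReal_compl_eq_one_sub (measurableSet_le_abs b), smul_eq_mul, mul_comm (|μ i| ^ r)]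
  rfl

/-! ### Concentration of exceedance counts -/

/-- The count is a sum of independent Bernoulli variables, so its moment generating function is
dominated by that of a Poisson variable of the same mean. -/
lemma mgf_exceedCount_le {n : ℕ} (μ : Fin n → ℝ) (T s : ℝ) :
    mgf (fun y => (exceedCount T y : ℝ)) (observationLaw μ) s
      ≤ Real.exp ((∑ i, exceedProb (μ i) T) * (Real.exp s - 1)) := by
  have h1 : ∀ y : Fin n → ℝ, Real.exp (s * (exceedCount T y : ℝ))
      = ∏ i, (1 + Set.indicator {x : ℝ | T ≤ |x|} (fun _ => Real.exp s - 1) (y i)) := by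
    intro y
    rw [exceedCount_eq_sum, Finset.mul_sum, Real.exp_sum]
    refine Finset.prod_congr rfl fun i _ => ?_
    by_cases h : T ≤ |y i| <;> simp [h]
  have h2 : ∀ i, ∫ x, (1 + Set.indicator {x : ℝ | T ≤ |x|} (fun _ => Real.exp s - 1) x)
      ∂(gaussianReal (μ i) 1) = 1 + exceedProb (μ i) T * (Real.exp s - 1) := by
    intro i
    rw [integral_add (integrable_const _) ((integrable_const _).indicator (measurableSet_le_abs T)),
      integral_indicator (measurableSet_le_abs T), setIntegral_const]
    simp [exceedProb]
  unfold mgf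
  simp only [h1]
  unfold observationLaw
  rw [integral_fintype_prod_eq_prod
    (fun _ x => 1 + Set.indicator {x : ℝ | T ≤ |x|} (fun _ => Real.exp s - 1) x)]
  simp only [h2]
  rw [Finset.sum_mul, Real.exp_sum]
  refine Finset.prod_le_prod (fun i _ => ?_) fun i _ => ?_
  · nlinarith [exceedProb_nonneg (μ i) T, exceedProb_le_one (μ i) T, Real.exp_pos s]
  · rw [add_comm]
    exact Real.add_one_le_exp _

lemma integrable_exp_mul_exceedCount {n : ℕ} (μ : Fin n → ℝ) (T s : ℝ) :
    Integrable (fun y => Real.exp (s * (exceedCount T y : ℝ))) (observationLaw μ) := by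
  refine Integrable.of_bound (C := Real.exp (|s| * n)) ?_ (ae_of_all _ fun y => ?_)
  · exact ((measurable_exceedCount T).const_mul s).exp.aestronglyMeasurable
  · rw [Real.norm_of_nonneg (Real.exp_pos _).le]
    refine Real.exp_le_exp.2 ?_
    have h : (exceedCount T y : ℝ) ≤ n := by exact_mod_cast exceedCount_le T y
    exact mul_le_mul (le_abs_self s) h (Nat.cast_nonneg _) (abs_nonneg s)

/-- Chernoff bound for an exceedance count above its mean. -/
lemma prob_le_exceedCount_le {n : ℕ} (μ : Fin n → ℝ) {T δ k : ℝ} (hδ0 : 0 < δ) (hδ1 : δ ≤ 1)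
    (hk : 0 ≤ k) (hM : ∑ i, exceedProb (μ i) T ≤ (1 - δ) * k) :
    (observationLaw μ).real {y | k ≤ (exceedCount T y : ℝ)} ≤ Real.exp (-(δ ^ 2 / 8) * k) := by
  have h := measure_ge_le_exp_mul_mgf (μ := observationLaw μ)
    (X := fun y => (exceedCount T y : ℝ)) k (t := δ / 2) (by positivity)
    (integrable_exp_mul_exceedCount μ T _)
  refine h.trans ((mul_le_mul_of_nonneg_left (mgf_exceedCount_le μ T _)
    (Real.exp_pos _).le).trans ?_)
  rw [← Real.exp_add]
  refine Real.exp_le_exp.2 ?_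
  have h1 := Real.abs_exp_sub_one_sub_id_le (x := δ / 2)
    (by rw [abs_of_pos (by positivity)]; linarith)
  have h2 := (abs_le.1 h1).2
  have h3 : 0 ≤ Real.exp (δ / 2) - 1 := by linarith [Real.add_one_le_exp (δ / 2)]
  have h4 := mul_le_mul_of_nonneg_right hM h3
  have h5 : (1 - δ) * k * (Real.exp (δ / 2) - 1) ≤ (1 - δ) * k * (δ / 2 + (δ / 2) ^ 2) :=
    mul_le_mul_of_nonneg_left (by linarith) (mul_nonneg (by linarith) hk)
  have h6 : (1 - δ) * (δ / 2 + (δ / 2) ^ 2) ≤ δ / 2 - δ ^ 2 / 8 := by nlinarith [pow_pos hδ0 3]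
  have h7 := mul_le_mul_of_nonneg_right h6 hk
  nlinarith

/-- Chernoff bound for an exceedance count below its mean. -/
lemma prob_exceedCount_le_le {n : ℕ} (μ : Fin n → ℝ) {T δ k : ℝ} (hδ0 : 0 < δ) (hδ1 : δ ≤ 1)
    (hk : 0 ≤ k) (hM : (1 + δ) * k ≤ ∑ i, exceedProb (μ i) T) :
    (observationLaw μ).real {y | (exceedCount T y : ℝ) ≤ k} ≤ Real.exp (-(δ ^ 2 / 8) * k) := by
  have h := measure_le_le_exp_mul_mgf (μ := observationLaw μ)
    (X := fun y => (exceedCount T y : ℝ)) k (t := -(δ / 4)) (by linarith)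
    (integrable_exp_mul_exceedCount μ T _)
  refine h.trans ((mul_le_mul_of_nonneg_left (mgf_exceedCount_le μ T _)
    (Real.exp_pos _).le).trans ?_)
  rw [← Real.exp_add]
  refine Real.exp_le_exp.2 ?_
  have h1 := Real.abs_exp_sub_one_sub_id_le (x := -(δ / 4))
    (by rw [abs_neg, abs_of_pos (by positivity)]; linarith)
  have h2 := (abs_le.1 h1).2
  have h3 : Real.exp (-(δ / 4)) - 1 ≤ 0 := by
    have : Real.exp (-(δ / 4)) ≤ 1 := Real.exp_le_one_iff.2 (by linarith)
    linarith
  have h4 := mul_le_mul_of_nonpos_right hM h3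
  have h5 : (1 + δ) * k * (Real.exp (-(δ / 4)) - 1) ≤ (1 + δ) * k * (-(δ / 4) + (-(δ / 4)) ^ 2) :=
    mul_le_mul_of_nonneg_left (by linarith) (mul_nonneg (by linarith) hk)
  have h6 : (1 + δ) * (-(δ / 4) + (-(δ / 4)) ^ 2) ≤ -(δ / 4) - δ ^ 2 / 8 := by
    nlinarith [pow_pos hδ0 3, pow_pos hδ0 2]
  have h7 := mul_le_mul_of_nonneg_right h6 hk
  nlinarith

/-! ### Localisation of the FDR index -/

/-- The event on which the FDR index is not known to lie between `k₁` and `k₂`: too few coordinates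
exceed `t[k₁]`, or `t[k]` is exceeded at least `k` times for some `k ≥ k₂`. -/
def indexEscape (n : ℕ) (q k₁ k₂ : ℝ) : Set (Fin n → ℝ) :=
  {y | (exceedCount (fdrBoundary n q k₁) y : ℝ) ≤ k₁} ∪
    ⋃ k ∈ (Finset.range (n + 1)).filter (fun k : ℕ => k₂ ≤ (k : ℝ)),
      {y | (k : ℝ) ≤ exceedCount (fdrBoundary n q k) y}

lemma measurableSet_indexEscape (n : ℕ) (q k₁ k₂ : ℝ) :
    MeasurableSet (indexEscape n q k₁ k₂) := by
  refine (measurableSet_le (measurable_exceedCount _) measurable_const).union ?_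
  exact Finset.measurableSet_biUnion _ fun k _ =>
    measurableSet_le measurable_const (measurable_exceedCount _)

lemma fdrBoundary_antitone {n : ℕ} {q k l : ℝ} (hn : 0 < n) (hq0 : 0 < q) (hq1 : q < 1)
    (hk : 0 < k) (hkl : k ≤ l) (hl : l ≤ n) : fdrBoundary n q l ≤ fdrBoundary n q k := by
  have hn' : (0 : ℝ) < n := Nat.cast_pos.2 hn
  refine upperQuantile_le_upperQuantile (by positivity) (by gcongr) ?_
  rw [div_lt_one (by positivity)]
  nlinarith

lemma normalTail_fdrBoundary {n : ℕ} {q k : ℝ} (hn : 0 < n) (hq0 : 0 < q) (hq1 : q < 1)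
    (hk : 0 < k) (hkn : k ≤ n) : normalTail (fdrBoundary n q k) = k * q / (2 * n) := by
  have hn' : (0 : ℝ) < n := Nat.cast_pos.2 hn
  refine normalTail_upperQuantile (by positivity) ?_
  rw [div_lt_one (by positivity)]
  nlinarith

lemma fdrBoundary_pos {n : ℕ} {q k : ℝ} (hn : 0 < n) (hq0 : 0 < q) (hq1 : q < 1)
    (hk : 0 < k) (hkn : k ≤ n) : 0 < fdrBoundary n q k := by
  have hn' : (0 : ℝ) < n := Nat.cast_pos.2 hn
  refine upperQuantile_pos (by positivity) ?_
  rw [div_lt_div_iff₀ (by positivity) two_pos]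
  nlinarith

/-- Off the escape event `t[k₂] ≤ t[k̂] ≤ t[k₁]`. -/
lemma fdrIndex_bounds_of_notMem {n : ℕ} {q k₁ k₂ : ℝ} (hn : 0 < n) (hq0 : 0 < q) (hq1 : q < 1)
    (hk₁ : 0 < k₁) (hk₂ : k₂ ≤ n) {y : Fin n → ℝ} (hy : y ∉ indexEscape n q k₁ k₂) :
    0 < fdrIndex q y ∧ fdrBoundary n q (fdrIndex q y) ≤ fdrBoundary n q k₁ ∧
      fdrBoundary n q k₂ ≤ fdrBoundary n q (fdrIndex q y) := by
  simp only [indexEscape, Set.mem_union, not_or, Set.mem_iUnion, not_exists, Finset.mem_filter,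
    Finset.mem_range, and_imp, Set.mem_ofPred_eq, not_le] at hy
  obtain ⟨h1, h2⟩ := hy
  set m := exceedCount (fdrBoundary n q k₁) y with hm
  have hmn : (m : ℝ) ≤ n := by exact_mod_cast exceedCount_le _ y
  have hm1 : 1 ≤ m := by
    have : (0 : ℝ) < m := hk₁.trans h1
    exact_mod_cast this
  have hmk : m ≤ fdrIndex q y := by
    refine le_fdrIndex q y hm1 ?_
    exact exceedCount_antitone y (fdrBoundary_antitone hn hq0 hq1 hk₁ h1.le hmn)
  have hpos : 0 < fdrIndex q y := hm1.trans hmk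
  have hle : (fdrIndex q y : ℝ) ≤ n := by exact_mod_cast fdrIndex_le q y
  have hk1le : k₁ ≤ fdrIndex q y := h1.le.trans (by exact_mod_cast hmk)
  refine ⟨hpos, fdrBoundary_antitone hn hq0 hq1 hk₁ hk1le hle, ?_⟩
  have hlt : (fdrIndex q y : ℝ) < k₂ := by
    by_contra hge
    have h3 := h2 _ (Nat.lt_succ_of_le (fdrIndex_le q y)) (not_lt.1 hge)
    have h4 := fdrIndex_le_exceedCount q y hpos
    have h5 : (fdrIndex q y : ℝ) ≤ exceedCount (fdrBoundary n q (fdrIndex q y)) y := by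
      exact_mod_cast h4
    linarith
  exact fdrBoundary_antitone hn hq0 hq1 (by exact_mod_cast hpos) hlt.le hk₂

/-- By the monotone likelihood ratio, `k ↦ E N(t[k]) / k` is nonincreasing. Hence a single bound
at `k₂` controls the exceedance counts at all `k ≥ k₂`. -/
lemma sum_exceedProb_le {n : ℕ} (μ : Fin n → ℝ) {q k₂ k c : ℝ} (hn : 0 < n) (hq0 : 0 < q)
    (hq1 : q < 1) (hk₂ : 0 < k₂) (hk : k₂ ≤ k) (hkn : k ≤ n)
    (hM : ∑ i, exceedProb (μ i) (fdrBoundary n q k₂) ≤ c * k₂) :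
    ∑ i, exceedProb (μ i) (fdrBoundary n q k) ≤ c * k := by
  have hn' : (0 : ℝ) < n := Nat.cast_pos.2 hn
  have hk0 : 0 < k := hk₂.trans_le hk
  have h : ∀ i, exceedProb (μ i) (fdrBoundary n q k)
      ≤ exceedProb (μ i) (fdrBoundary n q k₂) * (k / k₂) := by
    intro i
    have h1 := exceedProb_mul_le (μ i) (fdrBoundary_pos hn hq0 hq1 hk0 hkn)
      (fdrBoundary_antitone hn hq0 hq1 hk₂ hk hkn)
    rw [normalTail_fdrBoundary hn hq0 hq1 hk0 hkn,
      normalTail_fdrBoundary hn hq0 hq1 hk₂ (hk.trans hkn), ← mul_div_assoc, ← mul_div_assoc,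
      div_le_div_iff_of_pos_right (by positivity)] at h1
    rw [← mul_div_assoc, le_div_iff₀ hk₂]
    exact le_of_mul_le_mul_right (by linarith) hq0
  refine (Finset.sum_le_sum fun i _ => h i).trans ?_
  rw [← Finset.sum_mul]
  refine (mul_le_mul_of_nonneg_right hM (by positivity)).trans (le_of_eq ?_)
  field_simp

/-- Chernoff at `k₁` from below and at every `k ≥ k₂` from above, with a union bound over `k`. -/
lemma prob_indexEscape_le {n : ℕ} (μ : Fin n → ℝ) {q k₁ k₂ δ : ℝ} (hn : 0 < n) (hq0 : 0 < q)
    (hq1 : q < 1) (hδ0 : 0 < δ) (hδ1 : δ ≤ 1) (hk₁ : 0 < k₁) (hk₁₂ : k₁ ≤ k₂)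
    (hM₁ : (1 + δ) * k₁ ≤ ∑ i, exceedProb (μ i) (fdrBoundary n q k₁))
    (hM₂ : ∑ i, exceedProb (μ i) (fdrBoundary n q k₂) ≤ (1 - δ) * k₂) :
    (observationLaw μ).real (indexEscape n q k₁ k₂)
      ≤ (n + 2) * Real.exp (-(δ ^ 2 / 8) * k₁) := by
  refine (measureReal_union_le _ _).trans ?_
  have h1 := prob_exceedCount_le_le μ hδ0 hδ1 hk₁.le hM₁
  have h2 : (observationLaw μ).real
      (⋃ k ∈ (Finset.range (n + 1)).filter (fun k : ℕ => k₂ ≤ (k : ℝ)),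
        {y | (k : ℝ) ≤ exceedCount (fdrBoundary n q k) y})
      ≤ (n + 1) * Real.exp (-(δ ^ 2 / 8) * k₁) := by
    refine (measureReal_biUnion_finset_le _ _).trans ?_
    refine (Finset.sum_le_card_nsmul _ _ (Real.exp (-(δ ^ 2 / 8) * k₁)) fun k hk => ?_).trans ?_
    · simp only [Finset.mem_filter, Finset.mem_range] at hk
      have hkn : (k : ℝ) ≤ n := by exact_mod_cast Nat.lt_succ_iff.1 hk.1
      have hk₂ : 0 < k₂ := hk₁.trans_le hk₁₂
      refine (prob_le_exceedCount_le μ hδ0 hδ1 (hk₂.le.trans hk.2)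
        (sum_exceedProb_le μ hn hq0 hq1 hk₂ hk.2 hkn hM₂)).trans (Real.exp_le_exp.2 ?_)
      nlinarith [sq_nonneg δ, hk₁₂.trans hk.2]
    · rw [nsmul_eq_mul]
      refine mul_le_mul_of_nonneg_right ?_ (Real.exp_pos _).le
      have := Finset.card_filter_le (Finset.range (n + 1)) (fun k : ℕ => k₂ ≤ (k : ℝ))
      rw [Finset.card_range] at this
      exact_mod_cast this
  linarith

/-- On an event of probability at most `π` the noise contributes little, since
`|z|^r 1_B ≤ x |z|^{2r} + 1_B / x`. -/
lemma setIntegral_envelope_le {n : ℕ} (μ : Fin n → ℝ) {r x : ℝ} (hr : 0 < r) (hx : 0 < x)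
    {B : Set (Fin n → ℝ)} (hB : MeasurableSet B) :
    ∫ y in B, ∑ i, envelope r (μ i) (y i) ∂(observationLaw μ)
      ≤ n * (x * ∫ z, |z| ^ (2 * r) ∂(gaussianReal 0 1) + (observationLaw μ).real B / x)
        + (observationLaw μ).real B * ∑ i, |μ i| ^ r := by
  set P := observationLaw μ with hP
  have h2r : 0 ≤ 2 * r := by linarith
  rw [integral_finsetSum _ fun i _ => (integrable_envelope μ i hr.le).integrableOn]
  have h : ∀ i, ∫ y in B, envelope r (μ i) (y i) ∂P
      ≤ (x * ∫ z, |z| ^ (2 * r) ∂(gaussianReal 0 1) + P.real B / x) + P.real B * |μ i| ^ r := by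
    intro i
    unfold envelope
    rw [integral_add (integrable_noise μ i hr.le).integrableOn (integrable_const _),
      setIntegral_const, smul_eq_mul]
    refine add_le_add ?_ le_rfl
    have h1 : ∫ y, |y i - μ i| ^ (2 * r) ∂P = ∫ z, |z| ^ (2 * r) ∂(gaussianReal 0 1) := by
      have hmp := measurePreserving_eval_observationLaw μ i
      have h2 := gaussianReal_map_add_const (μ := 0) (v := 1) (μ i)
      rw [zero_add] at h2
      have h3 : ∫ y, |y i - μ i| ^ (2 * r) ∂P
          = ∫ w, |w - μ i| ^ (2 * r) ∂(gaussianReal (μ i) 1) := by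
        rw [← hmp.map_eq, integral_map hmp.measurable.aemeasurable]
        exact (measurable_abs_sub_rpow _ _).aestronglyMeasurable
      rw [h3, ← h2, integral_map (by fun_prop) (measurable_abs_sub_rpow _ _).aestronglyMeasurable]
      simp only [add_sub_cancel_right]
    rw [← h1, ← integral_const_mul, ← integral_indicator hB]
    have h4 : P.real B / x = ∫ y, B.indicator (fun _ => 1 / x) y ∂P := by
      rw [integral_indicator hB, setIntegral_const, smul_eq_mul]; ring
    rw [h4, ← integral_add ((integrable_noise μ i h2r).const_mul x)
      ((integrable_const _).indicator hB)]
    refine integral_mono ((integrable_noise μ i hr.le).indicator hB)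
      (((integrable_noise μ i h2r).const_mul x).add ((integrable_const _).indicator hB))
      fun y => ?_
    by_cases hy : y ∈ B
    · simp only [Set.indicator_of_mem hy]
      set a := |y i - μ i| ^ r with ha
      have h5 : |y i - μ i| ^ (2 * r) = a ^ 2 := by
        rw [ha, mul_comm, Real.rpow_mul (abs_nonneg _), Real.rpow_two]
      rw [h5]
      have h6 : x * a ^ 2 + 1 / x - a = (x * a - 1 / 2) ^ 2 / x + 3 / 4 / x := by
        field_simp; ring
      have : 0 ≤ (x * a - 1 / 2) ^ 2 / x + 3 / 4 / x := by positivity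
      linarith
    · simp only [Set.indicator_of_notMem hy, add_zero]
      positivity
  refine (Finset.sum_le_sum fun i _ => h i).trans (le_of_eq ?_)
  rw [Finset.sum_add_distrib, Finset.sum_const, ← Finset.mul_sum]
  simp
  ring

/-- The FDR risk is sandwiched by the risks of fixed thresholds `t[k₁]`, `t[k₂]`, up to the
contribution of the event that the FDR index escapes from `[k₁, k₂]`. -/
lemma risk_bounds {n : ℕ} (μ : Fin n → ℝ) {r q k₁ k₂ : ℝ} (hr : 0 ≤ r) (hn : 0 < n) (hq0 : 0 < q)
    (hq1 : q < 1) (hk₁ : 0 < k₁) (hk₂ : k₂ ≤ n) :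
    risk r (fdrEstimator q) μ ≤ ∑ i, exceedLoss r (μ i) (fdrBoundary n q k₂)
        + ∑ i, |μ i| ^ r * (1 - exceedProb (μ i) (fdrBoundary n q k₁))
        + ∫ y in indexEscape n q k₁ k₂, ∑ i, envelope r (μ i) (y i) ∂(observationLaw μ) ∧
    ∑ i, exceedLoss r (μ i) (fdrBoundary n q k₁)
        + ∑ i, |μ i| ^ r * (1 - exceedProb (μ i) (fdrBoundary n q k₂))
      ≤ risk r (fdrEstimator q) μ
        + ∫ y in indexEscape n q k₁ k₂, ∑ i, envelope r (μ i) (y i) ∂(observationLaw μ) := by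
  set B := indexEscape n q k₁ k₂ with hBdef
  have hB : MeasurableSet B := measurableSet_indexEscape n q k₁ k₂
  have hE : Integrable (fun y => ∑ i, envelope r (μ i) (y i)) (observationLaw μ) :=
    integrable_finsetSum _ fun i _ => integrable_envelope μ i hr
  have hsum : ∀ a b, ∑ i, exceedLoss r (μ i) a + ∑ i, |μ i| ^ r * (1 - exceedProb (μ i) b)
      = ∫ y, ∑ i, bracketLoss r (μ i) a b (y i) ∂(observationLaw μ) := by
    intro a b
    rw [integral_finsetSum _ fun i _ => integrable_bracketLoss μ i a b hr,
      ← Finset.sum_add_distrib]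
    exact Finset.sum_congr rfl fun i _ => (integral_bracketLoss μ i a b hr).symm
  have hI : ∀ a b, Integrable (fun y => ∑ i, bracketLoss r (μ i) a b (y i)) (observationLaw μ) :=
    fun a b => integrable_finsetSum _ fun i _ => integrable_bracketLoss μ i a b hr
  have hL := integrable_fdr_loss q μ hr
  have hEnn : ∀ y : Fin n → ℝ, 0 ≤ ∑ i, envelope r (μ i) (y i) := fun y =>
    Finset.sum_nonneg fun i _ => by unfold envelope; positivity
  rw [hsum, hsum, ← integral_indicator hB, risk, ← integral_add (hI _ _) (hE.indicator hB),
    ← integral_add hL (hE.indicator hB)]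
  refine ⟨integral_mono hL ((hI _ _).add (hE.indicator hB)) fun y => ?_,
    integral_mono (hI _ _) (hL.add (hE.indicator hB)) fun y => ?_⟩
  · by_cases hy : y ∈ B
    · simp only [Set.indicator_of_mem hy]
      have h1 : lrLoss r (fdrEstimator q y) μ ≤ ∑ i, envelope r (μ i) (y i) :=
        Finset.sum_le_sum fun i _ => fdrEstimator_loss_le_envelope r q μ y i
      have h2 : 0 ≤ ∑ i, bracketLoss r (μ i) (fdrBoundary n q k₂) (fdrBoundary n q k₁) (y i) :=
        Finset.sum_nonneg fun i _ => bracketLoss_nonneg _ _ _ _ _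
      linarith
    · simp only [Set.indicator_of_notMem hy, add_zero]
      obtain ⟨h0, h1, h2⟩ := fdrIndex_bounds_of_notMem hn hq0 hq1 hk₁ hk₂ hy
      refine Finset.sum_le_sum fun i _ => ?_
      rw [fdrEstimator_loss_eq r q μ y i h0]
      exact bracketLoss_mono h2 h1 _ _ _
  · by_cases hy : y ∈ B
    · simp only [Set.indicator_of_mem hy]
      have h1 : ∑ i, bracketLoss r (μ i) (fdrBoundary n q k₁) (fdrBoundary n q k₂) (y i)
          ≤ ∑ i, envelope r (μ i) (y i) :=
        Finset.sum_le_sum fun i _ => bracketLoss_le_envelope _ _ _ _ _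
      have h2 : 0 ≤ lrLoss r (fdrEstimator q y) μ :=
        Finset.sum_nonneg fun i _ => by positivity
      linarith
    · simp only [Set.indicator_of_notMem hy, add_zero]
      obtain ⟨h0, h1, h2⟩ := fdrIndex_bounds_of_notMem hn hq0 hq1 hk₁ hk₂ hy
      refine Finset.sum_le_sum fun i _ => ?_
      rw [fdrEstimator_loss_eq r q μ y i h0]
      exact bracketLoss_mono h1 h2 _ _ _

/-! ### Reduction of the risk asymptotics to fixed thresholds -/

/-- The escape event does not affect the risk to first order: its probability is at most
`(n + 2) e^{-c k_n} ≤ n⁻⁴`, against a polynomially bounded loss. -/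
lemma tendsto_integral_indexEscape {r : ℝ} (hr : 0 < r) {q : ℕ → ℝ}
    (hqev : ∀ᶠ n in atTop, 0 < q n ∧ q n < 1) {μ : ∀ n, Fin n → ℝ} {k w : ℕ → ℝ}
    (hk : Tendsto (fun n : ℕ => k n / Real.log n) atTop atTop)
    (hw : ∀ᶠ n in atTop, 1 ≤ w n)
    (hμ : ∀ᶠ n in atTop, ∀ i, |μ n i| ^ r ≤ n) {κ₁ κ₂ δ : ℝ} (hδ0 : 0 < δ) (hδ1 : δ ≤ 1)
    (hκ₁ : 0 < κ₁) (hκ : κ₁ ≤ κ₂)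
    (hM₁ : ∀ᶠ n in atTop, (1 + δ) * (κ₁ * k n)
      ≤ ∑ i, exceedProb (μ n i) (fdrBoundary n (q n) (κ₁ * k n)))
    (hM₂ : ∀ᶠ n in atTop, ∑ i, exceedProb (μ n i) (fdrBoundary n (q n) (κ₂ * k n))
      ≤ (1 - δ) * (κ₂ * k n)) :
    Tendsto (fun n => (∫ y in indexEscape n (q n) (κ₁ * k n) (κ₂ * k n),
      ∑ i, envelope r (μ n i) (y i) ∂(observationLaw (μ n))) / w n) atTop (𝓝 0) := by
  set K := ∫ z, |z| ^ (2 * r) ∂(gaussianReal 0 1) with hK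
  have hK0 : 0 ≤ K := integral_nonneg fun _ => by positivity
  have hlim : Tendsto (fun n : ℕ => (K + 2) / (n : ℝ)) atTop (𝓝 0) :=
    tendsto_const_nhds.div_atTop tendsto_natCast_atTop_atTop
  refine squeeze_zero' ?_ ?_ hlim
  · filter_upwards [hw] with n hn
    refine div_nonneg (integral_nonneg fun y => ?_) (by linarith)
    exact Finset.sum_nonneg fun i _ => by unfold envelope; positivity
  set c := δ ^ 2 / 8 * κ₁ with hc
  have hc0 : 0 < c := by positivity
  filter_upwards [hw, hμ, hM₁, hM₂, hqev, hk.eventually_ge_atTop (6 / c), eventually_ge_atTop 2]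
    with n hw hμ hM₁ hM₂ hq hkn hn2
  have hn2' : (2 : ℝ) ≤ n := by exact_mod_cast hn2
  have hn0 : (0 : ℝ) < n := by linarith
  have hlog : 0 < Real.log n := Real.log_pos (by linarith)
  rw [div_le_div_iff₀ hc0 hlog] at hkn
  have hk0 : 0 < k n := by
    by_contra h
    nlinarith [mul_nonpos_of_nonpos_of_nonneg (not_lt.1 h) hc0.le]
  have hP := prob_indexEscape_le (μ n) (by omega) hq.1 hq.2 hδ0 hδ1 (mul_pos hκ₁ hk0)
    (mul_le_mul_of_nonneg_right hκ hk0.le) hM₁ hM₂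
  set π := (observationLaw (μ n)).real (indexEscape n (q n) (κ₁ * k n) (κ₂ * k n)) with hπ
  have hπ0 : 0 ≤ π := measureReal_nonneg
  have hexp : Real.exp (-(δ ^ 2 / 8) * (κ₁ * k n)) ≤ 1 / (n : ℝ) ^ 6 := by
    have h1 : (1 : ℝ) / (n : ℝ) ^ 6 = Real.exp (-(6 * Real.log n)) := by
      rw [Real.exp_neg, one_div, mul_comm, Real.exp_mul, Real.exp_log hn0]; norm_cast
    rw [h1]
    exact Real.exp_le_exp.2 (by rw [hc] at hkn; linarith)
  have hπ4 : π ≤ 1 / (n : ℝ) ^ 4 := by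
    refine hP.trans ((mul_le_mul_of_nonneg_left hexp (by positivity)).trans ?_)
    rw [mul_one_div, div_le_div_iff₀ (by positivity) (by positivity)]
    have : (n : ℝ) + 2 ≤ (n : ℝ) ^ 2 := by nlinarith
    calc ((n : ℝ) + 2) * (n : ℝ) ^ 4 ≤ (n : ℝ) ^ 2 * (n : ℝ) ^ 4 := by gcongr
      _ = 1 * (n : ℝ) ^ 6 := by ring
  have hE := setIntegral_envelope_le (μ n) hr (x := 1 / (n : ℝ) ^ 2) (by positivity)
    (measurableSet_indexEscape n (q n) (κ₁ * k n) (κ₂ * k n))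
  rw [← hπ, ← hK] at hE
  have hsum : ∑ i, |μ n i| ^ r ≤ (n : ℝ) ^ 2 := by
    refine (Finset.sum_le_sum fun i _ => hμ i).trans (le_of_eq ?_)
    simp; ring
  have h1 : n * (1 / (n : ℝ) ^ 2 * K + π / (1 / (n : ℝ) ^ 2)) + π * ∑ i, |μ n i| ^ r
      ≤ n * (1 / (n : ℝ) ^ 2 * K + 1 / (n : ℝ) ^ 4 / (1 / (n : ℝ) ^ 2))
        + 1 / (n : ℝ) ^ 4 * (n : ℝ) ^ 2 := by
    gcongr
  have h2 : n * (1 / (n : ℝ) ^ 2 * K + 1 / (n : ℝ) ^ 4 / (1 / (n : ℝ) ^ 2))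
        + 1 / (n : ℝ) ^ 4 * (n : ℝ) ^ 2 = (K + 1) / n + 1 / (n : ℝ) ^ 2 := by
    field_simp
  have h3 : 1 / (n : ℝ) ^ 2 ≤ 1 / n :=
    one_div_le_one_div_of_le hn0 (by nlinarith)
  have h4 : (K + 2) / (n : ℝ) = (K + 1) / n + 1 / n := by ring
  refine (div_le_self ?_ hw).trans ?_
  · exact integral_nonneg fun y => Finset.sum_nonneg fun i _ => by unfold envelope; positivity
  · linarith

/-- Suppose that at each threshold `t[κ k_n]` the expected number of exceedances is
`(φ + q κ + o(1)) k_n`. The self-consistency equation `φ + q κ = κ` then pins the FDR index at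
`k_n φ / (1 - q)`, and the limits `q κ` and `c` of the normalised fixed-threshold losses give the
limit of the normalised risk. -/
theorem tendsto_risk_div {r : ℝ} (hr : 0 < r) {q : ℕ → ℝ} {q₀ : ℝ} (hq1 : q₀ < 1)
    (hq : Tendsto q atTop (𝓝 q₀)) (hqpos : ∀ᶠ n in atTop, 0 < q n) {μ : ∀ n, Fin n → ℝ}
    {k w : ℕ → ℝ} (hk : Tendsto (fun n : ℕ => k n / Real.log n) atTop atTop)
    (hkn : Tendsto (fun n : ℕ => k n / n) atTop (𝓝 0)) (hw : ∀ᶠ n in atTop, 1 ≤ w n)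
    (hμ : ∀ᶠ n in atTop, ∀ i, |μ n i| ^ r ≤ n) {φ c : ℝ} (hφ : 0 < φ)
    (h1 : ∀ κ, 0 < κ → Tendsto (fun n =>
      (∑ i, exceedProb (μ n i) (fdrBoundary n (q n) (κ * k n))) / k n) atTop (𝓝 (φ + q₀ * κ)))
    (h2 : ∀ κ, 0 < κ → Tendsto (fun n =>
      (∑ i, exceedLoss r (μ n i) (fdrBoundary n (q n) (κ * k n))) / w n) atTop (𝓝 (q₀ * κ)))
    (h3 : ∀ κ, 0 < κ → Tendsto (fun n =>
      (∑ i, |μ n i| ^ r * (1 - exceedProb (μ n i) (fdrBoundary n (q n) (κ * k n)))) / w n) atTop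
        (𝓝 c)) :
    Tendsto (fun n => risk r (fdrEstimator (q n)) (μ n) / w n) atTop
      (𝓝 (c + φ * (q₀ / (1 - q₀)))) := by
  have hq1' : 0 < 1 - q₀ := by linarith
  set κs := φ / (1 - q₀) with hκs
  have hκs0 : 0 < κs := by positivity
  have hself : φ + q₀ * κs = κs := by rw [hκs]; field_simp; ring
  have hqev : ∀ᶠ n in atTop, 0 < q n ∧ q n < 1 := hqpos.and (hq.eventually (gt_mem_nhds hq1))
  have hkpos : ∀ᶠ n : ℕ in atTop, 0 < k n := by
    filter_upwards [hk.eventually_ge_atTop 1, eventually_ge_atTop 2] with n h hn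
    have hlog : 0 < Real.log n := Real.log_pos (by exact_mod_cast hn)
    rw [le_div_iff₀ hlog] at h
    linarith
  have hle : ∀ κ : ℝ, 0 < κ → ∀ᶠ n : ℕ in atTop, κ * k n ≤ n := by
    intro κ hκ
    filter_upwards [hkn.eventually (gt_mem_nhds (show (0 : ℝ) < 1 / κ by positivity)),
      eventually_gt_atTop 0] with n h hn
    have hn' : (0 : ℝ) < n := Nat.cast_pos.2 hn
    rw [div_lt_div_iff₀ hn' hκ] at h
    linarith
  -- the counts at `κ₁ k_n` and `κ₂ k_n` are on the correct sides, with a fixed relative margin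
  have hM : ∀ κ₁ κ₂ : ℝ, 0 < κ₁ → κ₁ < κs → κs < κ₂ → ∃ δ : ℝ, 0 < δ ∧ δ ≤ 1 ∧
      (∀ᶠ n in atTop, (1 + δ) * (κ₁ * k n)
        ≤ ∑ i, exceedProb (μ n i) (fdrBoundary n (q n) (κ₁ * k n))) ∧
      (∀ᶠ n in atTop, ∑ i, exceedProb (μ n i) (fdrBoundary n (q n) (κ₂ * k n))
        ≤ (1 - δ) * (κ₂ * k n)) := by
    intro κ₁ κ₂ hκ₁ hlt₁ hlt₂
    have hκ₂ : 0 < κ₂ := hκs0.trans hlt₂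
    have ha : κ₁ < φ + q₀ * κ₁ := by nlinarith
    have hb : φ + q₀ * κ₂ < κ₂ := by nlinarith
    have hc1 : Tendsto (fun δ : ℝ => (1 + δ) * κ₁) (𝓝 0) (𝓝 ((1 + 0) * κ₁)) := by
      exact (tendsto_id.const_add 1).mul_const κ₁
    have hc2 : Tendsto (fun δ : ℝ => (1 - δ) * κ₂) (𝓝 0) (𝓝 ((1 - 0) * κ₂)) := by
      exact (tendsto_id.const_sub 1).mul_const κ₂
    rw [add_zero, one_mul] at hc1
    rw [sub_zero, one_mul] at hc2
    have hev : ∀ᶠ δ : ℝ in 𝓝[>] 0, ((1 + δ) * κ₁ < φ + q₀ * κ₁ ∧ φ + q₀ * κ₂ < (1 - δ) * κ₂) ∧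
        δ ∈ Set.Ioc (0 : ℝ) 1 :=
      (((hc1.eventually (gt_mem_nhds ha)).and (hc2.eventually (lt_mem_nhds hb))).filter_mono
        nhdsWithin_le_nhds).and (Ioc_mem_nhdsGT one_pos)
    obtain ⟨δ, ⟨hd1, hd2⟩, hd3⟩ := hev.exists
    refine ⟨δ, hd3.1, hd3.2, ?_, ?_⟩
    · filter_upwards [(h1 κ₁ hκ₁).eventually (lt_mem_nhds hd1), hkpos] with n hn hk0
      rw [lt_div_iff₀ hk0] at hn
      linarith
    · filter_upwards [(h1 κ₂ hκ₂).eventually (gt_mem_nhds hd2), hkpos] with n hn hk0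
      rw [div_lt_iff₀ hk0] at hn
      linarith
  have hlimit : c + φ * (q₀ / (1 - q₀)) = q₀ * κs + c := by rw [hκs]; ring
  rw [hlimit]
  have hcont : Tendsto (fun κ : ℝ => q₀ * κ + c) (𝓝 κs) (𝓝 (q₀ * κs + c)) := by
    exact (tendsto_id.const_mul q₀).add_const c
  refine tendsto_order.2 ⟨fun a ha => ?_, fun a ha => ?_⟩
  · have hev : ∀ᶠ κ : ℝ in 𝓝[<] κs, a < q₀ * κ + c ∧ κ ∈ Set.Ioo 0 κs :=
      ((hcont.eventually (lt_mem_nhds ha)).filter_mono nhdsWithin_le_nhds).and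
        (Ioo_mem_nhdsLT hκs0)
    obtain ⟨κ₁, hκa, hκ₁⟩ := hev.exists
    have hκ₂ : κs < κs + 1 := by linarith
    obtain ⟨δ, hδ0, hδ1, hM₁, hM₂⟩ := hM κ₁ (κs + 1) hκ₁.1 hκ₁.2 hκ₂
    have hE := tendsto_integral_indexEscape hr hqev hk hw hμ hδ0 hδ1 hκ₁.1
      (hκ₁.2.trans hκ₂).le hM₁ hM₂
    have hlim := ((h2 κ₁ hκ₁.1).add (h3 (κs + 1) (by linarith))).sub hE
    rw [sub_zero] at hlim
    filter_upwards [hlim.eventually (lt_mem_nhds hκa), hkpos, hqev, hle (κs + 1) (by linarith), hw,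
      eventually_gt_atTop 0] with n hn hk0 hq hle hw hn0
    refine hn.trans_le ?_
    have hb := (risk_bounds (μ n) hr.le hn0 hq.1 hq.2 (mul_pos hκ₁.1 hk0) hle).2
    rw [← add_div, ← sub_div]
    exact div_le_div_of_nonneg_right (by linarith) (by linarith)
  · have hev : ∀ᶠ κ : ℝ in 𝓝[>] κs, q₀ * κ + c < a ∧ κ ∈ Set.Ioi κs :=
      ((hcont.eventually (gt_mem_nhds ha)).filter_mono nhdsWithin_le_nhds).and
        self_mem_nhdsWithin
    obtain ⟨κ₂, hκa, hκ₂⟩ := hev.exists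
    have hκ₂' : κs < κ₂ := hκ₂
    have hκ₁ : κs / 2 < κs := by linarith
    obtain ⟨δ, hδ0, hδ1, hM₁, hM₂⟩ := hM (κs / 2) κ₂ (by linarith) hκ₁ hκ₂'
    have hE := tendsto_integral_indexEscape hr hqev hk hw hμ hδ0 hδ1 (by linarith)
      (hκ₁.trans hκ₂').le hM₁ hM₂
    have hlim := ((h2 κ₂ (by linarith)).add (h3 (κs / 2) (by linarith))).add hE
    rw [add_zero] at hlim
    filter_upwards [hlim.eventually (gt_mem_nhds hκa), hkpos, hqev, hle κ₂ (by linarith), hw,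
      eventually_gt_atTop 0] with n hn hk0 hq hle hw hn0
    refine lt_of_le_of_lt ?_ hn
    have hb := (risk_bounds (μ n) hr.le hn0 hq.1 hq.2 (mul_pos (by linarith : 0 < κs / 2) hk0)
      hle).1
    rw [← add_div, ← add_div]
    exact div_le_div_of_nonneg_right (by linarith) (by linarith)

/-! ### Mean vectors with a top group at `t[k_n] + α` -/

open Classical in
/-- The features of a sequence of mean vectors `μ n` that determine the risk. About `k n`
coordinates, those in `A n`, sit at the top level `t[k n] + α`. Of the others, a negligible
proportion of `k n` are near the top (at scale `τ n`), few exceed `τ n ^ (-2)`, and the `r`-th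
powers of their means add up to `(S + o(1)) k τ^r`. -/
structure TopGroupMeans (r α S : ℝ) (q : ℕ → ℝ) (μ : ∀ n, Fin n → ℝ) (k τ : ℕ → ℝ)
    (A : ∀ n, Finset (Fin n)) : Prop where
  tendsto_tau : Tendsto τ atTop atTop
  tendsto_num_div_log : Tendsto (fun n : ℕ => k n / Real.log n) atTop atTop
  sparse : ∀ M : ℕ, Tendsto (fun n : ℕ => k n * τ n ^ M / n) atTop (𝓝 0)
  tendsto_boundary_div : Tendsto (fun n => fdrBoundary n (q n) (k n) / τ n) atTop (𝓝 1)
  mean_top : ∀ᶠ n in atTop, ∀ i ∈ A n, μ n i = fdrBoundary n (q n) (k n) + α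
  tendsto_card_top : Tendsto (fun n => ((A n).card : ℝ) / k n) atTop (𝓝 1)
  mean_nonneg : ∀ᶠ n in atTop, ∀ i, 0 ≤ μ n i
  mean_le : ∀ᶠ n in atTop, ∀ i, μ n i ≤ fdrBoundary n (q n) (k n) + α
  count_near : ∀ ε : ℝ, 0 < ε → ∃ δ : ℝ, 0 < δ ∧ δ < 1 ∧ ∀ᶠ n in atTop,
    (((A n)ᶜ.filter fun i => (1 - δ) * τ n < μ n i).card : ℝ) ≤ ε * k n
  count_mid : ∃ M : ℕ, ∀ᶠ n in atTop,
    ((Finset.univ.filter fun i => (τ n ^ 2)⁻¹ < μ n i).card : ℝ) ≤ k n * τ n ^ M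
  tendsto_mass : Tendsto (fun n => (∑ i ∈ (A n)ᶜ, |μ n i| ^ r) / (k n * τ n ^ r)) atTop (𝓝 S)

namespace TopGroupMeans

variable {r α S : ℝ} {q : ℕ → ℝ} {μ : ∀ n, Fin n → ℝ} {k τ : ℕ → ℝ} {A : ∀ n, Finset (Fin n)}

lemma num_pos (H : TopGroupMeans r α S q μ k τ A) : ∀ᶠ n in atTop, 1 ≤ k n := by
  have h := Real.tendsto_log_atTop.comp (tendsto_natCast_atTop_atTop (R := ℝ))
  filter_upwards [H.tendsto_num_div_log.eventually_ge_atTop 1, h.eventually_ge_atTop 1]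
    with n h1 h2
  simp only [Function.comp] at h2
  rw [le_div_iff₀ (by linarith)] at h1
  linarith

lemma tendsto_num_div (H : TopGroupMeans r α S q μ k τ A) :
    Tendsto (fun n : ℕ => k n / n) atTop (𝓝 0) := by
  simpa using H.sparse 0

lemma num_mul_le (H : TopGroupMeans r α S q μ k τ A) (κ : ℝ) (hκ : 0 < κ) :
    ∀ᶠ n : ℕ in atTop, κ * k n ≤ n := by
  filter_upwards [H.tendsto_num_div.eventually (gt_mem_nhds (show (0 : ℝ) < 1 / κ by positivity)),
    eventually_gt_atTop 0] with n h hn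
  have hn' : (0 : ℝ) < n := Nat.cast_pos.2 hn
  rw [div_lt_div_iff₀ hn' hκ] at h
  linarith

lemma tendsto_level (H : TopGroupMeans r α S q μ k τ A)
    (hq : ∀ᶠ n in atTop, 0 < q n ∧ q n < 1) :
    Tendsto (fun n : ℕ => k n * q n / (2 * n)) atTop (𝓝[>] 0) := by
  refine tendsto_nhdsWithin_iff.2 ⟨?_, ?_⟩
  · refine squeeze_zero' ?_ ?_ H.tendsto_num_div
    · filter_upwards [hq, H.num_pos] with n h1 h2
      have := h1.1
      positivity
    · filter_upwards [hq, H.num_pos, eventually_gt_atTop 0] with n h1 h2 hn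
      have hn' : (0 : ℝ) < n := Nat.cast_pos.2 hn
      rw [div_le_div_iff₀ (by positivity) hn']
      have : k n * q n ≤ k n := mul_le_of_le_one_right (by linarith) h1.2.le
      nlinarith
  · filter_upwards [hq, H.num_pos, eventually_gt_atTop 0] with n h1 h2 hn
    have := h1.1
    have hn' : (0 : ℝ) < n := Nat.cast_pos.2 hn
    exact Set.mem_Ioi.2 (by positivity)

lemma tendsto_boundary_sub (H : TopGroupMeans r α S q μ k τ A)
    (hq : ∀ᶠ n in atTop, 0 < q n ∧ q n < 1) {κ : ℝ} (hκ : 0 < κ) :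
    Tendsto (fun n => fdrBoundary n (q n) (κ * k n) - fdrBoundary n (q n) (k n)) atTop (𝓝 0) := by
  refine ((tendsto_upperQuantile_mul_sub hκ).comp (H.tendsto_level hq)).congr fun n => ?_
  simp only [Function.comp, fdrBoundary, mul_assoc, mul_div_assoc]

lemma tendsto_boundary_mul_div (H : TopGroupMeans r α S q μ k τ A)
    (hq : ∀ᶠ n in atTop, 0 < q n ∧ q n < 1) {κ : ℝ} (hκ : 0 < κ) :
    Tendsto (fun n => fdrBoundary n (q n) (κ * k n) / τ n) atTop (𝓝 1) := by
  have h := H.tendsto_boundary_div.add ((H.tendsto_boundary_sub hq hκ).div_atTop H.tendsto_tau)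
  rw [add_zero] at h
  refine h.congr fun n => ?_
  rw [← add_div]; congr 1; ring

lemma eventually_boundary (H : TopGroupMeans r α S q μ k τ A)
    (hq : ∀ᶠ n in atTop, 0 < q n ∧ q n < 1) {κ : ℝ} (hκ : 0 < κ) : ∀ᶠ n : ℕ in atTop,
      0 < fdrBoundary n (q n) (κ * k n) ∧
        2 * normalTail (fdrBoundary n (q n) (κ * k n)) = κ * k n * q n / n := by
  filter_upwards [hq, H.num_pos, H.num_mul_le κ hκ, eventually_gt_atTop 0] with n h1 h2 h3 h4
  have hpos : 0 < κ * k n := by positivity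
  refine ⟨fdrBoundary_pos h4 h1.1 h1.2 hpos h3, ?_⟩
  rw [normalTail_fdrBoundary h4 h1.1 h1.2 hpos h3]
  have hn' : (0 : ℝ) < n := Nat.cast_pos.2 h4
  field_simp

/-- The near-zero coordinates are indistinguishable from pure noise: lowering the threshold by
`τ ^ (-2)` does not change the expected number of exceedances to first order. -/
lemma tendsto_lowered_tail (H : TopGroupMeans r α S q μ k τ A) {q₀ : ℝ}
    (hq : ∀ᶠ n in atTop, 0 < q n ∧ q n < 1) (hq₀ : Tendsto q atTop (𝓝 q₀)) {κ : ℝ} (hκ : 0 < κ) :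
    Tendsto (fun n : ℕ => n * (2 * normalTail (fdrBoundary n (q n) (κ * k n) - (τ n ^ 2)⁻¹)) / k n)
      atTop (𝓝 (q₀ * κ)) := by
  set T : ℕ → ℝ := fun n => fdrBoundary n (q n) (κ * k n) with hT
  have hTτ : Tendsto (fun n => T n / τ n) atTop (𝓝 1) := H.tendsto_boundary_mul_div hq hκ
  have hTinf : Tendsto T atTop atTop := by
    have := H.tendsto_tau.atTop_mul_pos one_pos hTτ
    refine this.congr' ?_
    filter_upwards [H.tendsto_tau.eventually_gt_atTop 0] with n hn
    field_simp
  have hτinv : Tendsto (fun n => (τ n)⁻¹) atTop (𝓝 0) := tendsto_inv_atTop_zero.comp H.tendsto_tau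
  have hTh : Tendsto (fun n => T n * (τ n ^ 2)⁻¹) atTop (𝓝 0) := by
    have h := hTτ.mul hτinv
    rw [mul_zero] at h
    refine h.congr fun n => ?_
    rw [pow_two, mul_inv]; ring
  have hh : Tendsto (fun n => (τ n ^ 2)⁻¹) atTop (𝓝 0) := by
    have h := hτinv.mul hτinv
    rw [mul_zero] at h
    refine h.congr fun n => ?_
    rw [pow_two, mul_inv]
  have hTinv : Tendsto (fun n => 1 / T n) atTop (𝓝 0) := tendsto_const_nhds.div_atTop hTinf
  have hfac : Tendsto (fun n => 1 + (τ n ^ 2)⁻¹ * (T n + 1 / T n) * Real.exp (T n * (τ n ^ 2)⁻¹))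
      atTop (𝓝 1) := by
    have h := ((hTh.add (hh.mul hTinv)).mul (Real.continuous_exp.continuousAt.tendsto.comp hTh))
    have h' := h.const_add 1
    simp only [mul_zero, add_zero, zero_mul] at h'
    refine h'.congr fun n => ?_
    simp only [Function.comp]; ring
  have hbase : Tendsto (fun n : ℕ => n * (2 * normalTail (T n)) / k n) atTop (𝓝 (q₀ * κ)) := by
    refine (hq₀.mul_const κ).congr' ?_
    filter_upwards [H.eventually_boundary hq hκ, H.num_pos, eventually_gt_atTop 0] with n h1 h2 h3
    have hn' : (0 : ℝ) < n := Nat.cast_pos.2 h3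
    rw [h1.2]
    field_simp
  have hup := hfac.mul hbase
  rw [one_mul] at hup
  refine tendsto_of_tendsto_of_tendsto_of_le_of_le' hbase hup ?_ ?_
  · filter_upwards [H.num_pos] with n h2
    have h3 : normalTail (T n) ≤ normalTail (T n - (τ n ^ 2)⁻¹) :=
      normalTail_antitone (sub_le_self _ (by positivity))
    gcongr
  · filter_upwards [H.num_pos, H.eventually_boundary hq hκ, hh.eventually (gt_mem_nhds one_pos),
      hTinf.eventually_ge_atTop 1] with n h2 h3 h4 h5
    have h6 := normalTail_sub_le h3.1 (h := (τ n ^ 2)⁻¹) (by positivity) (h4.le.trans h5)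
    rw [mul_div_assoc']
    refine div_le_div_of_nonneg_right ?_ (by linarith)
    have h7 := mul_le_mul_of_nonneg_left h6 (show (0 : ℝ) ≤ n * 2 by positivity)
    linarith

/-- Upper bound for a sum over the coordinates outside the top group, split at `(1 - δ) τ` and
`τ ^ (-2)`: the few near the top contribute a small multiple of `k`, those of intermediate size
contribute exponentially small terms, and the near-zero ones contribute `n * d ~ L k`. -/
lemma eventually_sum_div_lt (H : TopGroupMeans r α S q μ k τ A) {f : ℕ → ℝ → ℝ} {d : ℕ → ℝ}
    {C L : ℝ} (hC : 0 < C)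
    (hf : ∀ᶠ n in atTop, ∀ m, 0 ≤ m → m ≤ fdrBoundary n (q n) (k n) + α → f n m ≤ C)
    (hmid : ∀ δ, 0 < δ → δ < 1 → ∃ C', ∀ᶠ n in atTop, ∀ m, 0 ≤ m → m ≤ (1 - δ) * τ n →
      f n m ≤ C' * Real.exp (-(δ ^ 2 / 8) * τ n ^ 2))
    (hd : ∀ᶠ n in atTop, 0 ≤ d n ∧ ∀ m, 0 ≤ m → m ≤ (τ n ^ 2)⁻¹ → f n m ≤ d n)
    (hL : Tendsto (fun n : ℕ => n * d n / k n) atTop (𝓝 L)) {a : ℝ} (ha : L < a) :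
    ∀ᶠ n in atTop, (∑ i ∈ (A n)ᶜ, f n (μ n i)) / k n < a := by
  classical
  set ε := (a - L) / (2 * C) with hε
  have hε0 : 0 < ε := div_pos (by linarith) (by positivity)
  obtain ⟨δ, hδ0, hδ1, hnear⟩ := H.count_near ε hε0
  obtain ⟨M, hM⟩ := H.count_mid
  obtain ⟨C', hC'⟩ := hmid δ hδ0 hδ1
  have hexp : Tendsto (fun n => |C'| * (τ n ^ M * Real.exp (-(δ ^ 2 / 8) * τ n ^ 2))) atTop
      (𝓝 0) := by
    have h1 : Tendsto (fun x : ℝ => x ^ M * Real.exp (-x)) atTop (𝓝 0) :=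
      Real.tendsto_pow_mul_exp_neg_atTop_nhds_zero M
    have h2 : Tendsto (fun x : ℝ => x ^ M * Real.exp (-(δ ^ 2 / 8) * x ^ 2)) atTop (𝓝 0) := by
      refine squeeze_zero' ?_ ?_ h1
      · filter_upwards [eventually_ge_atTop 0] with x hx
        positivity
      · filter_upwards [eventually_ge_atTop (8 / δ ^ 2), eventually_ge_atTop 0] with x hx hx0
        refine mul_le_mul_of_nonneg_left (Real.exp_le_exp.2 ?_) (by positivity)
        rw [div_le_iff₀ (by positivity)] at hx
        nlinarith
    have h3 := (h2.comp H.tendsto_tau).const_mul |C'|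
    rw [mul_zero] at h3
    exact h3
  have hlim : Tendsto (fun n : ℕ => C * ε
      + |C'| * (τ n ^ M * Real.exp (-(δ ^ 2 / 8) * τ n ^ 2)) + n * d n / k n) atTop
      (𝓝 (C * ε + 0 + L)) := (hexp.const_add _).add hL
  have hlt : C * ε + 0 + L < a := by
    have : C * ε = (a - L) / 2 := by rw [hε]; field_simp
    rw [this]; linarith
  filter_upwards [hlim.eventually (gt_mem_nhds hlt), hf, hnear, hM, hC', hd, H.num_pos,
    H.mean_nonneg, H.mean_le] with n hn hf hnear hM hC' hd hk hnn hle
  refine lt_of_le_of_lt ?_ hn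
  have hk0 : 0 < k n := by linarith
  set E := Real.exp (-(δ ^ 2 / 8) * τ n ^ 2) with hE
  have hE0 : 0 < E := Real.exp_pos _
  have hpt : ∀ i ∈ (A n)ᶜ, f n (μ n i) ≤
      (if (1 - δ) * τ n < μ n i then C else 0)
        + (if (τ n ^ 2)⁻¹ < μ n i then |C'| * E else 0) + d n := by
    intro i _
    have hA : 0 ≤ |C'| * E := by positivity
    have hd0 := hd.1
    split_ifs with h1 h2 h2
    · linarith [hf _ (hnn i) (hle i)]
    · linarith [hf _ (hnn i) (hle i)]
    · have := hC' _ (hnn i) (not_lt.1 h1)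
      have h3 : C' * E ≤ |C'| * E := mul_le_mul_of_nonneg_right (le_abs_self _) hE0.le
      linarith
    · linarith [hd.2 _ (hnn i) (not_lt.1 h2)]
  have h1 : ∑ i ∈ (A n)ᶜ, (if (1 - δ) * τ n < μ n i then C else 0) ≤ C * (ε * k n) := by
    rw [← Finset.sum_filter, Finset.sum_const, nsmul_eq_mul, mul_comm]
    exact mul_le_mul_of_nonneg_left hnear hC.le
  have h2 : ∑ i ∈ (A n)ᶜ, (if (τ n ^ 2)⁻¹ < μ n i then |C'| * E else 0)
      ≤ |C'| * E * (k n * τ n ^ M) := by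
    rw [← Finset.sum_filter, Finset.sum_const, nsmul_eq_mul, mul_comm]
    refine mul_le_mul_of_nonneg_left (le_trans ?_ hM) (by positivity)
    exact_mod_cast Finset.card_le_card (Finset.filter_subset_filter _ (Finset.subset_univ _))
  have h3 : ∑ i ∈ (A n)ᶜ, d n ≤ n * d n := by
    rw [Finset.sum_const, nsmul_eq_mul]
    refine mul_le_mul_of_nonneg_right ?_ hd.1
    have := Finset.card_le_univ (A n)ᶜ
    rw [Fintype.card_fin] at this
    exact_mod_cast this
  have h4 := Finset.sum_le_sum hpt
  rw [Finset.sum_add_distrib, Finset.sum_add_distrib] at h4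
  rw [div_le_iff₀ hk0, add_mul, add_mul, div_mul_cancel₀ _ hk0.ne']
  calc _ ≤ _ := h4
    _ ≤ C * (ε * k n) + |C'| * E * (k n * τ n ^ M) + n * d n := by gcongr
    _ = _ := by ring

lemma tendsto_boundary_atTop (H : TopGroupMeans r α S q μ k τ A)
    (hq : ∀ᶠ n in atTop, 0 < q n ∧ q n < 1) {κ : ℝ} (hκ : 0 < κ) :
    Tendsto (fun n => fdrBoundary n (q n) (κ * k n)) atTop atTop := by
  have := H.tendsto_tau.atTop_mul_pos one_pos (H.tendsto_boundary_mul_div hq hκ)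
  refine this.congr' ?_
  filter_upwards [H.tendsto_tau.eventually_gt_atTop 0] with n hn
  field_simp

lemma tendsto_inv_tau_sq (H : TopGroupMeans r α S q μ k τ A) :
    Tendsto (fun n => (τ n ^ 2)⁻¹) atTop (𝓝 0) :=
  tendsto_inv_atTop_zero.comp ((tendsto_pow_atTop two_ne_zero).comp H.tendsto_tau)

lemma tendsto_card_top_div (H : TopGroupMeans r α S q μ k τ A) :
    Tendsto (fun n : ℕ => ((A n).card : ℝ) / n) atTop (𝓝 0) := by
  have h := H.tendsto_card_top.mul H.tendsto_num_div
  rw [mul_zero] at h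
  refine h.congr' ?_
  filter_upwards [H.num_pos] with n hn
  have : k n ≠ 0 := by linarith
  field_simp

lemma tendsto_exceedProb_top (H : TopGroupMeans r α S q μ k τ A)
    (hq : ∀ᶠ n in atTop, 0 < q n ∧ q n < 1) {κ : ℝ} (hκ : 0 < κ) :
    Tendsto (fun n => exceedProb (fdrBoundary n (q n) (k n) + α) (fdrBoundary n (q n) (κ * k n)))
      atTop (𝓝 (normalCdf α)) := by
  have h1 := (continuous_normalTail.tendsto (0 - α)).comp
    ((H.tendsto_boundary_sub hq hκ).sub_const α)
  have hT := H.tendsto_boundary_atTop hq hκ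
  have ht : Tendsto (fun n => fdrBoundary n (q n) (k n)) atTop atTop := by
    simpa using H.tendsto_boundary_atTop hq one_pos
  have h2 := tendsto_normalTail_atTop.comp (hT.atTop_add_atTop
    (tendsto_atTop_add_const_right _ α ht))
  have h3 := h1.add h2
  rw [add_zero, zero_sub, ← normalCdf_eq] at h3
  refine h3.congr' ?_
  filter_upwards [hT.eventually_gt_atTop 0] with n hn
  rw [exceedProb_eq _ hn]
  simp only [Function.comp, sub_sub]

/-- Coordinates with means at most `(1 - δ) τ` exceed the threshold with exponentially small
probability. -/
lemma eventually_mid (H : TopGroupMeans r α S q μ k τ A)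
    (hq : ∀ᶠ n in atTop, 0 < q n ∧ q n < 1) {κ δ : ℝ} (hκ : 0 < κ) (hδ : 0 < δ) :
    ∀ᶠ n in atTop, δ / 2 * τ n ≤ fdrBoundary n (q n) (κ * k n) - (1 - δ) * τ n ∧
      2 * normalTail (fdrBoundary n (q n) (κ * k n) - (1 - δ) * τ n)
        ≤ Real.exp (-(δ ^ 2 / 8) * τ n ^ 2) := by
  filter_upwards [(H.tendsto_boundary_mul_div hq hκ).eventually
    (lt_mem_nhds (show 1 - δ / 2 < 1 by linarith)), H.tendsto_tau.eventually_gt_atTop 0]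
    with n h1 h2
  rw [lt_div_iff₀ h2] at h1
  have h3 : δ / 2 * τ n ≤ fdrBoundary n (q n) (κ * k n) - (1 - δ) * τ n := by nlinarith
  refine ⟨h3, ?_⟩
  have h0 : 0 ≤ δ / 2 * τ n := by positivity
  have h4 := normalTail_le_exp (h0.trans h3)
  have h5 : Real.exp (-(fdrBoundary n (q n) (κ * k n) - (1 - δ) * τ n) ^ 2 / 2)
      ≤ Real.exp (-(δ ^ 2 / 8) * τ n ^ 2) := by
    refine Real.exp_le_exp.2 ?_
    have := pow_le_pow_left₀ h0 h3 2
    nlinarith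
  linarith

/-! ### Limits at a fixed threshold -/

/-- The top group contributes `Φ(α)`, and all the others together contribute as pure noise. -/
lemma tendsto_sum_exceedProb (H : TopGroupMeans r α S q μ k τ A) {q₀ : ℝ}
    (hq : ∀ᶠ n in atTop, 0 < q n ∧ q n < 1) (hq₀ : Tendsto q atTop (𝓝 q₀)) {κ : ℝ} (hκ : 0 < κ) :
    Tendsto (fun n => (∑ i, exceedProb (μ n i) (fdrBoundary n (q n) (κ * k n))) / k n) atTop
      (𝓝 (normalCdf α + q₀ * κ)) := by
  have htop : Tendsto (fun n =>
      (∑ i ∈ A n, exceedProb (μ n i) (fdrBoundary n (q n) (κ * k n))) / k n) atTop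
      (𝓝 (normalCdf α)) := by
    have h := H.tendsto_card_top.mul (H.tendsto_exceedProb_top hq hκ)
    rw [one_mul] at h
    refine h.congr' ?_
    filter_upwards [H.mean_top] with n hn
    rw [Finset.sum_congr rfl fun i hi => by rw [hn i hi], Finset.sum_const, nsmul_eq_mul]
    ring
  have hrest : Tendsto (fun n =>
      (∑ i ∈ (A n)ᶜ, exceedProb (μ n i) (fdrBoundary n (q n) (κ * k n))) / k n) atTop
      (𝓝 (q₀ * κ)) := by
    refine tendsto_order.2 ⟨fun a ha => ?_, fun a ha => ?_⟩
    · have hlow : Tendsto (fun n : ℕ => (1 - ((A n).card : ℝ) / n) * (q n * κ)) atTop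
          (𝓝 ((1 - 0) * (q₀ * κ))) := (H.tendsto_card_top_div.const_sub 1).mul (hq₀.mul_const κ)
      rw [sub_zero, one_mul] at hlow
      filter_upwards [hlow.eventually (lt_mem_nhds ha), H.num_pos, H.eventually_boundary hq hκ,
        eventually_gt_atTop 0] with n h1 h2 h3 h4
      refine h1.trans_le ?_
      have hn : (0 : ℝ) < n := Nat.cast_pos.2 h4
      rw [le_div_iff₀ (by linarith)]
      have h5 : ∑ i ∈ (A n)ᶜ, (κ * k n * q n / n)
          ≤ ∑ i ∈ (A n)ᶜ, exceedProb (μ n i) (fdrBoundary n (q n) (κ * k n)) :=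
        Finset.sum_le_sum fun i _ => h3.2 ▸ two_mul_normalTail_le_exceedProb _ h3.1
      refine le_trans (le_of_eq ?_) h5
      rw [Finset.sum_const, nsmul_eq_mul, Finset.card_compl, Fintype.card_fin, Nat.cast_sub]
      · field_simp
      · simpa using Finset.card_le_univ (A n)
    · refine H.eventually_sum_div_lt (f := fun n m => exceedProb m (fdrBoundary n (q n) (κ * k n)))
        (d := fun n => 2 * normalTail (fdrBoundary n (q n) (κ * k n) - (τ n ^ 2)⁻¹)) one_pos
        (Eventually.of_forall fun n m _ _ => exceedProb_le_one _ _) (fun δ hδ0 hδ1 => ⟨1, ?_⟩) ?_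
        (H.tendsto_lowered_tail hq hq₀ hκ) ha
      · filter_upwards [H.eventually_mid hq hκ hδ0, H.eventually_boundary hq hκ]
          with n h1 h2 m h3 h4
        rw [one_mul]
        exact (exceedProb_le_two_mul ((abs_of_nonneg h3).trans_le h4) h2.1).trans h1.2
      · filter_upwards [H.eventually_boundary hq hκ] with n h2
        refine ⟨mul_nonneg two_pos.le (normalTail_nonneg _), fun m h3 h4 => ?_⟩
        exact exceedProb_le_two_mul ((abs_of_nonneg h3).trans_le h4) h2.1
  refine (htop.add hrest).congr fun n => ?_
  rw [← add_div, Finset.sum_add_sum_compl]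

/-- The noise of the kept coordinates comes from the about `q κ k` false discoveries, each of
magnitude `≈ τ`; the noise of the top group is only of order `k`. -/
lemma tendsto_sum_exceedLoss (H : TopGroupMeans r α S q μ k τ A) (hr0 : 0 < r) (hr2 : r ≤ 2)
    {q₀ : ℝ} (hq : ∀ᶠ n in atTop, 0 < q n ∧ q n < 1) (hq₀ : Tendsto q atTop (𝓝 q₀)) {κ : ℝ}
    (hκ : 0 < κ) :
    Tendsto (fun n => (∑ i, exceedLoss r (μ n i) (fdrBoundary n (q n) (κ * k n)))
      / (k n * τ n ^ r)) atTop (𝓝 (q₀ * κ)) := by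
  have hτr : Tendsto (fun n => τ n ^ r) atTop atTop := (tendsto_rpow_atTop hr0).comp H.tendsto_tau
  have hTh : Tendsto (fun n => fdrBoundary n (q n) (κ * k n) - (τ n ^ 2)⁻¹) atTop atTop := by
    simpa only [sub_eq_add_neg] using
      (H.tendsto_boundary_atTop hq hκ).atTop_add H.tendsto_inv_tau_sq.neg
  have hratio : Tendsto (fun n => ((fdrBoundary n (q n) (κ * k n) - (τ n ^ 2)⁻¹) / τ n) ^ r) atTop
      (𝓝 1) := by
    have h := (H.tendsto_boundary_mul_div hq hκ).sub (H.tendsto_inv_tau_sq.div_atTop H.tendsto_tau)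
    rw [sub_zero] at h
    have h2 := h.rpow_const (p := r) (Or.inl one_ne_zero)
    rw [Real.one_rpow] at h2
    refine h2.congr fun n => ?_
    rw [sub_div]
  have htop : Tendsto (fun n =>
      (∑ i ∈ A n, exceedLoss r (μ n i) (fdrBoundary n (q n) (κ * k n))) / (k n * τ n ^ r)) atTop
      (𝓝 0) := by
    have h : Tendsto (fun n => 2 * (((A n).card : ℝ) / k n) / τ n ^ r) atTop (𝓝 0) :=
      (H.tendsto_card_top.const_mul 2).div_atTop hτr
    refine squeeze_zero' ?_ ?_ h
    · filter_upwards [H.num_pos, H.tendsto_tau.eventually_gt_atTop 0] with n h1 h2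
      exact div_nonneg (Finset.sum_nonneg fun i _ => exceedLoss_nonneg _ _ _) (by positivity)
    · filter_upwards [H.num_pos, H.tendsto_tau.eventually_gt_atTop 0] with n h1 h2
      have h3 : ∑ i ∈ A n, exceedLoss r (μ n i) (fdrBoundary n (q n) (κ * k n)) ≤ ∑ i ∈ A n, 2 :=
        Finset.sum_le_sum fun i _ => exceedLoss_le_two hr0 hr2 _ _
      rw [Finset.sum_const, nsmul_eq_mul] at h3
      rw [mul_div_assoc', div_div, mul_comm 2]
      exact div_le_div_of_nonneg_right h3 (by positivity)
  have hrest : Tendsto (fun n =>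
      (∑ i ∈ (A n)ᶜ, exceedLoss r (μ n i) (fdrBoundary n (q n) (κ * k n)) / τ n ^ r) / k n) atTop
      (𝓝 (q₀ * κ)) := by
    refine tendsto_order.2 ⟨fun a ha => ?_, fun a ha => ?_⟩
    · classical
      obtain ⟨M, hM⟩ := H.count_mid
      have hlow : Tendsto (fun n : ℕ =>
          ((fdrBoundary n (q n) (κ * k n) - (τ n ^ 2)⁻¹) / τ n) ^ r *
            ((1 - ((A n).card : ℝ) / n - k n * τ n ^ M / n) * (q n * κ))) atTop
          (𝓝 (1 * ((1 - 0 - 0) * (q₀ * κ)))) :=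
        hratio.mul (((H.tendsto_card_top_div.const_sub 1).sub (H.sparse M)).mul (hq₀.mul_const κ))
      rw [sub_zero, sub_zero, one_mul, one_mul] at hlow
      filter_upwards [hlow.eventually (lt_mem_nhds ha), H.num_pos, H.eventually_boundary hq hκ,
        eventually_gt_atTop 0, hM, hTh.eventually_gt_atTop 0, H.tendsto_tau.eventually_gt_atTop 0,
        H.mean_nonneg, hq] with n h1 h2 h3 h4 hM h5 h6 h7 h8
      refine h1.trans_le ?_
      have hn : (0 : ℝ) < n := Nat.cast_pos.2 h4
      set T := fdrBoundary n (q n) (κ * k n) with hT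
      rw [le_div_iff₀ (by linarith), ← Finset.sum_div, le_div_iff₀ (by positivity),
        Real.div_rpow h5.le h6.le]
      -- each near-zero coordinate contributes at least the corresponding pure noise term
      have h9 : ∑ i ∈ (A n)ᶜ.filter (fun i => ¬ (τ n ^ 2)⁻¹ < μ n i),
          (T - (τ n ^ 2)⁻¹) ^ r * (κ * k n * q n / n) ≤ ∑ i ∈ (A n)ᶜ, exceedLoss r (μ n i) T := by
        refine le_trans (Finset.sum_le_sum fun i hi => ?_)
          (Finset.sum_le_sum_of_subset_of_nonneg (Finset.filter_subset _ _)
            fun i _ _ => exceedLoss_nonneg _ _ _)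
        have hi2 := (Finset.mem_filter.1 hi).2
        refine le_trans ?_ (le_exceedLoss hr0 ((abs_of_nonneg (h7 i)).trans_le (not_lt.1 hi2))
          (by linarith))
        refine mul_le_mul_of_nonneg_left ?_ (by positivity)
        exact h3.2 ▸ two_mul_normalTail_le_exceedProb _ h3.1
      refine le_trans ?_ h9
      rw [Finset.sum_const, nsmul_eq_mul]
      have h10 := Finset.card_filter_add_card_filter_not (s := (A n)ᶜ)
        (p := fun i => (τ n ^ 2)⁻¹ < μ n i)
      have h11 : (((A n)ᶜ.filter fun i => (τ n ^ 2)⁻¹ < μ n i).card : ℝ) ≤ k n * τ n ^ M := by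
        refine le_trans ?_ hM
        exact_mod_cast Finset.card_le_card (Finset.filter_subset_filter _ (Finset.subset_univ _))
      have h12 : (((A n)ᶜ.filter fun i => (τ n ^ 2)⁻¹ < μ n i).card : ℝ)
          + (((A n)ᶜ.filter fun i => ¬ (τ n ^ 2)⁻¹ < μ n i).card : ℝ) = n - (A n).card := by
        rw [← Nat.cast_add, h10, Finset.card_compl, Fintype.card_fin, Nat.cast_sub]
        simpa using Finset.card_le_univ (A n)
      have h13 : (n : ℝ) - (A n).card - k n * τ n ^ M
          ≤ (((A n)ᶜ.filter fun i => ¬ (τ n ^ 2)⁻¹ < μ n i).card : ℝ) := by linarith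
      have h14 : 0 ≤ (T - (τ n ^ 2)⁻¹) ^ r * (κ * k n * q n / n) := by
        have := h8.1; positivity
      refine le_trans (le_of_eq ?_) (mul_le_mul_of_nonneg_right h13 h14)
      have : τ n ^ r ≠ 0 := by positivity
      field_simp
    · have hdlim : Tendsto (fun n : ℕ => ((fdrBoundary n (q n) (κ * k n) - (τ n ^ 2)⁻¹) / τ n) ^ r *
          (1 + 2 / (fdrBoundary n (q n) (κ * k n) - (τ n ^ 2)⁻¹) ^ 2) *
          (n * (2 * normalTail (fdrBoundary n (q n) (κ * k n) - (τ n ^ 2)⁻¹)) / k n)) atTop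
          (𝓝 (1 * (1 + 0) * (q₀ * κ))) := by
        refine (hratio.mul ?_).mul (H.tendsto_lowered_tail hq hq₀ hκ)
        exact (tendsto_const_nhds.div_atTop
          ((tendsto_pow_atTop two_ne_zero).comp hTh)).const_add 1
      rw [add_zero, one_mul, one_mul] at hdlim
      refine H.eventually_sum_div_lt
        (f := fun n m => exceedLoss r m (fdrBoundary n (q n) (κ * k n)) / τ n ^ r)
        (d := fun n => ((fdrBoundary n (q n) (κ * k n) - (τ n ^ 2)⁻¹) / τ n) ^ r *
          (1 + 2 / (fdrBoundary n (q n) (κ * k n) - (τ n ^ 2)⁻¹) ^ 2) *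
          (2 * normalTail (fdrBoundary n (q n) (κ * k n) - (τ n ^ 2)⁻¹)))
        two_pos ?_ (fun δ hδ0 hδ1 => ⟨2 ^ r * 3, ?_⟩) ?_ (hdlim.congr fun n => by ring) ha
      · filter_upwards [hτr.eventually_ge_atTop 1] with n h1 m _ _
        exact (div_le_self (exceedLoss_nonneg _ _ _) h1).trans (exceedLoss_le_two hr0 hr2 _ _)
      · filter_upwards [H.eventually_mid hq hκ hδ0, H.tendsto_tau.eventually_ge_atTop (2 / δ),
          H.tendsto_tau.eventually_gt_atTop 0,
          (H.tendsto_boundary_mul_div hq hκ).eventually (gt_mem_nhds one_lt_two)]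
          with n h1 h2 h3 h4 m h5 h6
        set T := fdrBoundary n (q n) (κ * k n) with hT
        set x := T - (1 - δ) * τ n with hx
        have hx1 : 1 ≤ x := by
          rw [div_le_iff₀ hδ0] at h2
          linarith [h1.1]
        have hx2 : x ≤ 2 * τ n := by
          rw [div_lt_iff₀ h3] at h4
          nlinarith
        have h7 := exceedLoss_le hr0 hr2 ((abs_of_nonneg h5).trans_le h6)
          (show (1 - δ) * τ n < T by linarith)
        rw [← hx] at h7
        have h8 : 1 + 2 / x ^ 2 ≤ 3 := by
          have : 2 / x ^ 2 ≤ 2 := div_le_self two_pos.le (one_le_pow₀ hx1)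
          linarith
        have h9 : x ^ r ≤ 2 ^ r * τ n ^ r := by
          rw [← Real.mul_rpow two_pos.le h3.le]
          exact Real.rpow_le_rpow (by linarith) hx2 hr0.le
        rw [div_le_iff₀ (by positivity)]
        refine h7.trans ?_
        calc x ^ r * (1 + 2 / x ^ 2) * (2 * normalTail x)
            ≤ (2 ^ r * τ n ^ r) * 3 * Real.exp (-(δ ^ 2 / 8) * τ n ^ 2) := by
              have := normalTail_nonneg x
              gcongr
              exact h1.2
          _ = _ := by ring
      · filter_upwards [hTh.eventually_gt_atTop 0, H.tendsto_tau.eventually_gt_atTop 0]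
          with n h1 h2
        refine ⟨?_, fun m h3 h4 => ?_⟩
        · have := normalTail_nonneg (fdrBoundary n (q n) (κ * k n) - (τ n ^ 2)⁻¹)
          positivity
        · have h5 := exceedLoss_le hr0 hr2 ((abs_of_nonneg h3).trans_le h4) (sub_pos.1 h1)
          rw [div_le_iff₀ (by positivity), Real.div_rpow h1.le h2.le]
          refine h5.trans (le_of_eq ?_)
          have : τ n ^ r ≠ 0 := by positivity
          field_simp
  have h := htop.add hrest
  rw [zero_add] at h
  refine h.congr fun n => ?_
  rw [← Finset.sum_div, div_div, mul_comm (τ n ^ r), ← add_div, Finset.sum_add_sum_compl]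

/-- A top coordinate is missed with probability tending to `Φ̃(α)`, and almost all of the mass
of the other means is missed. -/
lemma tendsto_sum_missed (H : TopGroupMeans r α S q μ k τ A) (hr0 : 0 < r) {q₀ : ℝ}
    (hq : ∀ᶠ n in atTop, 0 < q n ∧ q n < 1) (hq₀ : Tendsto q atTop (𝓝 q₀)) {κ : ℝ}
    (hκ : 0 < κ) :
    Tendsto (fun n => (∑ i, |μ n i| ^ r * (1 - exceedProb (μ n i) (fdrBoundary n (q n) (κ * k n))))
      / (k n * τ n ^ r)) atTop (𝓝 (normalTail α + S)) := by
  have hτr : Tendsto (fun n => τ n ^ r) atTop atTop := (tendsto_rpow_atTop hr0).comp H.tendsto_tau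
  have htopratio : Tendsto (fun n => |fdrBoundary n (q n) (k n) + α| / τ n) atTop (𝓝 1) := by
    have h := (H.tendsto_boundary_div.add
      ((tendsto_const_nhds (x := α)).div_atTop H.tendsto_tau)).abs
    rw [add_zero, abs_one] at h
    refine h.congr' ?_
    filter_upwards [H.tendsto_tau.eventually_gt_atTop 0] with n hn
    rw [← add_div, abs_div, abs_of_pos hn]
  have htop : Tendsto (fun n =>
      (∑ i ∈ A n, |μ n i| ^ r * (1 - exceedProb (μ n i) (fdrBoundary n (q n) (κ * k n))))
        / (k n * τ n ^ r)) atTop (𝓝 (normalTail α)) := by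
    have h2 := htopratio.rpow_const (p := r) (Or.inl one_ne_zero)
    rw [Real.one_rpow] at h2
    have h := (H.tendsto_card_top.mul h2).mul ((H.tendsto_exceedProb_top hq hκ).const_sub 1)
    rw [one_mul, one_mul, normalCdf_eq, normalTail_neg, sub_sub_cancel] at h
    refine h.congr' ?_
    filter_upwards [H.mean_top, H.tendsto_tau.eventually_gt_atTop 0] with n hn hτ
    rw [Finset.sum_congr rfl fun i hi => by rw [hn i hi], Finset.sum_const, nsmul_eq_mul,
      Real.div_rpow (abs_nonneg _) hτ.le, div_mul_div_comm]
    ring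
  have hrest : Tendsto (fun n => (∑ i ∈ (A n)ᶜ,
      |μ n i| ^ r * exceedProb (μ n i) (fdrBoundary n (q n) (κ * k n)) / τ n ^ r) / k n) atTop
      (𝓝 0) := by
    refine tendsto_order.2 ⟨fun a ha => ?_, fun a ha => ?_⟩
    · filter_upwards [H.num_pos, H.tendsto_tau.eventually_gt_atTop 0] with n h1 h2
      refine ha.trans_le (div_nonneg (Finset.sum_nonneg fun i _ => ?_) (by linarith))
      have := exceedProb_nonneg (μ n i) (fdrBoundary n (q n) (κ * k n))
      positivity
    · have hdlim : Tendsto (fun n : ℕ =>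
          (n * (2 * normalTail (fdrBoundary n (q n) (κ * k n) - (τ n ^ 2)⁻¹)) / k n) / τ n ^ r)
          atTop (𝓝 0) := (H.tendsto_lowered_tail hq hq₀ hκ).div_atTop hτr
      refine H.eventually_sum_div_lt
        (f := fun n m => |m| ^ r * exceedProb m (fdrBoundary n (q n) (κ * k n)) / τ n ^ r)
        (d := fun n => 2 * normalTail (fdrBoundary n (q n) (κ * k n) - (τ n ^ 2)⁻¹) / τ n ^ r)
        (show (0 : ℝ) < 2 ^ r by positivity) ?_ (fun δ hδ0 hδ1 => ⟨1, ?_⟩) ?_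
        (hdlim.congr fun n => by ring) ha
      · filter_upwards [H.tendsto_tau.eventually_gt_atTop 0,
          htopratio.eventually (gt_mem_nhds one_lt_two)] with n h1 h2 m h3 h4
        rw [div_lt_iff₀ h1] at h2
        rw [div_le_iff₀ (by positivity), ← Real.mul_rpow two_pos.le h1.le]
        refine (mul_le_of_le_one_right (by positivity) (exceedProb_le_one _ _)).trans ?_
        refine Real.rpow_le_rpow (abs_nonneg _) ?_ hr0.le
        rw [abs_of_nonneg h3]
        linarith [le_abs_self (fdrBoundary n (q n) (k n) + α)]
      · filter_upwards [H.eventually_mid hq hκ hδ0, H.eventually_boundary hq hκ,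
          H.tendsto_tau.eventually_gt_atTop 0] with n h1 h2 hτ m h3 h4
        have hm : |m| ≤ (1 - δ) * τ n := (abs_of_nonneg h3).trans_le h4
        rw [one_mul, div_le_iff₀ (by positivity), mul_comm]
        refine mul_le_mul ((exceedProb_le_two_mul hm h2.1).trans h1.2) ?_ (by positivity)
          (Real.exp_pos _).le
        exact Real.rpow_le_rpow (abs_nonneg _) (hm.trans (by nlinarith)) hr0.le
      · filter_upwards [H.eventually_boundary hq hκ, H.tendsto_tau.eventually_gt_atTop 0,
          H.tendsto_inv_tau_sq.eventually (gt_mem_nhds one_pos)] with n h2 hτ h1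
        have h0 := normalTail_nonneg (fdrBoundary n (q n) (κ * k n) - (τ n ^ 2)⁻¹)
        refine ⟨by positivity, fun m h3 h4 => ?_⟩
        have hm : |m| ≤ (τ n ^ 2)⁻¹ := (abs_of_nonneg h3).trans_le h4
        refine div_le_div_of_nonneg_right ?_ (by positivity)
        refine le_trans ?_ (exceedProb_le_two_mul hm h2.1)
        exact mul_le_of_le_one_left (exceedProb_nonneg _ _)
          (Real.rpow_le_one (abs_nonneg _) (hm.trans h1.le) hr0.le)
  have h := htop.add (H.tendsto_mass.sub hrest)
  rw [sub_zero] at h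
  refine h.congr fun n => ?_
  rw [← Finset.sum_div, div_div, mul_comm (τ n ^ r), ← sub_div, ← add_div,
    ← Finset.sum_sub_distrib, ← Finset.sum_add_sum_compl (A n)]
  simp only [mul_sub, mul_one]

/-- The risk of the FDR estimator on a mean vector with a top group. -/
theorem tendsto_risk (H : TopGroupMeans r α S q μ k τ A) (hr0 : 0 < r) (hr2 : r ≤ 2) {q₀ : ℝ}
    (hq1 : q₀ < 1) (hqpos : ∀ᶠ n in atTop, 0 < q n) (hq₀ : Tendsto q atTop (𝓝 q₀)) :
    Tendsto (fun n => risk r (fdrEstimator (q n)) (μ n) / (k n * τ n ^ r)) atTop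
      (𝓝 (normalTail α + S + normalCdf α * (q₀ / (1 - q₀)))) := by
  have hq : ∀ᶠ n in atTop, 0 < q n ∧ q n < 1 := hqpos.and (hq₀.eventually (gt_mem_nhds hq1))
  refine tendsto_risk_div hr0 hq1 hq₀ hqpos H.tendsto_num_div_log H.tendsto_num_div ?_ ?_
    (by rw [normalCdf_eq]; exact normalTail_pos _)
    (fun κ hκ => H.tendsto_sum_exceedProb hq hq₀ hκ)
    (fun κ hκ => H.tendsto_sum_exceedLoss hr0 hr2 hq hq₀ hκ)
    (fun κ hκ => H.tendsto_sum_missed hr0 hq hq₀ hκ)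
  · filter_upwards [H.num_pos, H.tendsto_tau.eventually_ge_atTop 1] with n h1 h2
    exact one_le_mul_of_one_le_of_one_le h1 (Real.one_le_rpow h2 hr0.le)
  · have h := (H.tendsto_boundary_div.add
      ((tendsto_const_nhds (x := α)).div_atTop H.tendsto_tau))
    rw [add_zero] at h
    filter_upwards [H.num_pos, H.tendsto_tau.eventually_ge_atTop 4, H.mean_nonneg, H.mean_le,
      (H.sparse 3).eventually (gt_mem_nhds one_pos), h.eventually (gt_mem_nhds one_lt_two),
      eventually_gt_atTop 0] with n h1 h2 h3 h4 h5 h6 h7 i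
    have hn : (0 : ℝ) < n := Nat.cast_pos.2 h7
    rw [div_lt_one hn] at h5
    rw [← add_div, div_lt_iff₀ (by linarith)] at h6
    have h8 : |μ n i| ≤ 2 * τ n := by
      rw [abs_of_nonneg (h3 i)]; linarith [h4 i]
    have h9 : (2 * τ n) ^ r ≤ (2 * τ n) ^ (2 : ℝ) :=
      Real.rpow_le_rpow_of_exponent_le (by linarith) hr2
    rw [Real.rpow_two] at h9
    refine (Real.rpow_le_rpow (abs_nonneg _) h8 hr0.le).trans (h9.trans ?_)
    have h10 : τ n ^ 3 ≤ k n * τ n ^ 3 := le_mul_of_one_le_left (by positivity) h1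
    nlinarith [sq_nonneg (τ n)]

end TopGroupMeans

/-! ### Growth of the calibration constants -/

lemma tauL0_sq {s : ℝ} (h0 : 0 < s) (h1 : s ≤ 1) : tauL0 s ^ 2 = 2 * Real.log s⁻¹ :=
  Real.sq_sqrt (mul_nonneg two_pos.le (Real.log_nonneg ((one_le_inv₀ h0).2 h1)))

lemma exp_neg_tauL0_sq {s : ℝ} (h0 : 0 < s) (h1 : s ≤ 1) : Real.exp (-(tauL0 s ^ 2 / 2)) = s := by
  rw [tauL0_sq h0 h1, mul_div_cancel_left₀ _ two_ne_zero, Real.log_inv, neg_neg, Real.exp_log h0]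

lemma tendsto_log_natCast : Tendsto (fun n : ℕ => Real.log n) atTop atTop :=
  Real.tendsto_log_atTop.comp tendsto_natCast_atTop_atTop

lemma SparsityRange.eventually_pos {s : ℕ → ℝ} (hs : SparsityRange s) : ∀ᶠ n in atTop, 0 < s n := by
  obtain ⟨b₂, b₃, -, -, h⟩ := hs
  filter_upwards [h, tendsto_log_natCast.eventually_gt_atTop 0, eventually_gt_atTop 0]
    with n h1 h2 h3
  have hn : (0 : ℝ) < n := Nat.cast_pos.2 h3
  exact lt_of_lt_of_le (by positivity) h1.1

lemma SparsityRange.tendsto_zero {s : ℕ → ℝ} (hs : SparsityRange s) :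
    Tendsto s atTop (𝓝 0) := by
  have hpos := hs.eventually_pos
  obtain ⟨b₂, b₃, -, hb₃, h⟩ := hs
  have h2 : Tendsto (fun n : ℕ => b₂ * (n : ℝ) ^ (-b₃)) atTop (𝓝 (b₂ * 0)) :=
    ((tendsto_rpow_neg_atTop hb₃).comp tendsto_natCast_atTop_atTop).const_mul b₂
  rw [mul_zero] at h2
  refine squeeze_zero' (hpos.mono fun n h => h.le) (h.mono fun n h => h.2) h2

/-- Under the sparsity assumption `τ²` is of exact order `log n`. -/
lemma SparsityRange.tauL0_sq_bounds {s : ℕ → ℝ} (hs : SparsityRange s) :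
    ∃ b : ℝ, 0 < b ∧ ∀ᶠ n : ℕ in atTop, b * Real.log n ≤ tauL0 (s n) ^ 2 ∧
      tauL0 (s n) ^ 2 ≤ 2 * Real.log n := by
  have hpos := hs.eventually_pos
  have h1 := hs.tendsto_zero.eventually (gt_mem_nhds one_pos)
  obtain ⟨b₂, b₃, hb₂, hb₃, h⟩ := hs
  refine ⟨b₃, hb₃, ?_⟩
  filter_upwards [hpos, h1, h, tendsto_log_natCast.eventually_ge_atTop 1,
    tendsto_log_natCast.eventually_ge_atTop (2 * Real.log b₂ / b₃), eventually_gt_atTop 0]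
    with n h2 h3 h4 h5 h6 h7
  have hn : (0 : ℝ) < n := Nat.cast_pos.2 h7
  rw [tauL0_sq h2 h3.le, Real.log_inv]
  constructor
  · have h8 := Real.log_le_log h2 h4.2
    rw [Real.log_mul hb₂.ne' (by positivity), Real.log_rpow hn] at h8
    rw [div_le_iff₀ hb₃] at h6
    linarith
  · have h9 : (n : ℝ)⁻¹ ≤ s n := by
      refine le_trans ?_ h4.1
      exact le_mul_of_one_le_right (by positivity) (one_le_pow₀ h5)
    have h8 := Real.log_le_log (by positivity) h9
    rw [Real.log_inv] at h8
    linarith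

lemma SparsityRange.tendsto_tauL0 {s : ℕ → ℝ} (hs : SparsityRange s) :
    Tendsto (fun n => tauL0 (s n)) atTop atTop := by
  have h : Tendsto (fun n => (s n)⁻¹) atTop atTop :=
    tendsto_inv_nhdsGT_zero.comp (tendsto_nhdsWithin_iff.2 ⟨hs.tendsto_zero, hs.eventually_pos⟩)
  exact Real.tendsto_sqrt_atTop.comp
    ((Real.tendsto_log_atTop.comp h).const_mul_atTop two_pos)

lemma FalseDiscoveryControl.exists_div_log_le {q : ℕ → ℝ} (hq : FalseDiscoveryControl q) :
    ∃ b : ℝ, 0 < b ∧ ∀ᶠ n : ℕ in atTop, b / Real.log n ≤ q n := by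
  obtain ⟨q₀, h0, -, hlim, hz⟩ := hq
  rcases h0.eq_or_lt with h | h
  · exact hz h.symm
  · refine ⟨q₀ / 2, by positivity, ?_⟩
    filter_upwards [hlim.eventually (lt_mem_nhds (show q₀ / 2 < q₀ by linarith)),
      tendsto_log_natCast.eventually_ge_atTop 1] with n h1 h2
    exact (div_le_self (by positivity) h2).trans h1.le

section Calibration

variable {s k τ : ℕ → ℝ} {e : ℝ}

/-- The lower end `log⁵ n / n` of the sparsity range leaves `k_n ≥ log⁴ n / 2`, since
`τ^e ≤ τ² ≤ 2 log n`. -/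
lemma tendsto_num_div_log_of_sparsityRange (hs : SparsityRange s) (he2 : e ≤ 2)
    (hτ : ∀ᶠ n in atTop, τ n = tauL0 (s n))
    (hk : ∀ᶠ n : ℕ in atTop, k n = n * s n * τ n ^ (-e)) :
    Tendsto (fun n : ℕ => k n / Real.log n) atTop atTop := by
  obtain ⟨b, hb, hbounds⟩ := hs.tauL0_sq_bounds
  have hlog := tendsto_log_natCast
  obtain ⟨b₂, b₃, -, -, h⟩ := id hs
  refine tendsto_atTop_mono' _ ?_ (hlog.atTop_div_const two_pos)
  filter_upwards [hτ, hk, hbounds, h, hs.tendsto_tauL0.eventually_ge_atTop 1,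
    hlog.eventually_ge_atTop 1, eventually_gt_atTop 0] with n h1 h2 h3 h4 h5 h6 h7
  have hn : (0 : ℝ) < n := Nat.cast_pos.2 h7
  rw [← h1] at h3 h5
  have h8 : Real.log n ^ 5 ≤ n * s n := by
    have := mul_le_mul_of_nonneg_left h4.1 hn.le
    rwa [mul_inv_cancel_left₀ hn.ne'] at this
  have h9 : τ n ^ e ≤ 2 * Real.log n := by
    refine (Real.rpow_le_rpow_of_exponent_le h5 he2).trans ?_
    rw [Real.rpow_two]; exact h3.2
  have h10 : 0 < τ n ^ e := by positivity
  rw [h2, Real.rpow_neg (by linarith), ← div_eq_mul_inv, div_div, div_le_div_iff₀ two_pos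
    (by positivity)]
  have h11 : Real.log n * (τ n ^ e * Real.log n) ≤ Real.log n * (2 * Real.log n * Real.log n) := by
    gcongr
  have h12 : Real.log n ^ 3 ≤ Real.log n ^ 5 := pow_le_pow_right₀ h6 (by norm_num)
  nlinarith

lemma tendsto_num_mul_pow_div_of_sparsityRange (hs : SparsityRange s) (he0 : 0 ≤ e)
    (hτ : ∀ᶠ n in atTop, τ n = tauL0 (s n))
    (hk : ∀ᶠ n : ℕ in atTop, k n = n * s n * τ n ^ (-e)) (M : ℕ) :
    Tendsto (fun n : ℕ => k n * τ n ^ M / n) atTop (𝓝 0) := by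
  have h1 : Tendsto (fun x : ℝ => x ^ M * Real.exp (-x)) atTop (𝓝 0) :=
    Real.tendsto_pow_mul_exp_neg_atTop_nhds_zero M
  have h2 := h1.comp hs.tendsto_tauL0
  refine squeeze_zero' ?_ ?_ h2
  · filter_upwards [hτ, hk, hs.eventually_pos, hs.tendsto_tauL0.eventually_gt_atTop 0]
      with n h3 h4 h5 h6
    rw [← h3] at h6
    rw [h4]; positivity
  · filter_upwards [hτ, hk, hs.eventually_pos, hs.tendsto_tauL0.eventually_ge_atTop 2,
      hs.tendsto_zero.eventually (gt_mem_nhds one_pos), eventually_gt_atTop 0]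
      with n h3 h4 h5 h6 h7 h8
    have hn : (0 : ℝ) < n := Nat.cast_pos.2 h8
    have h9 := exp_neg_tauL0_sq h5 h7.le
    simp only [Function.comp]
    rw [← h3] at h6 h9 ⊢
    have h10 : τ n ^ (-e) ≤ 1 := Real.rpow_le_one_of_one_le_of_nonpos (by linarith) (by linarith)
    have h11 : s n ≤ Real.exp (-τ n) := by
      rw [← h9]; exact Real.exp_le_exp.2 (by nlinarith)
    rw [h4, show n * s n * τ n ^ (-e) * τ n ^ M / n = τ n ^ M * (s n * τ n ^ (-e)) by
      field_simp]
    refine mul_le_mul_of_nonneg_left ?_ (by positivity)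
    exact (mul_le_of_le_one_right h5.le h10).trans h11

/-- `t[k_n] ~ τ`: the factors `q_n` and `τ^{-e}` in the level `k_n q_n / (2n)` are powers of
`log n` up to constants, hence invisible at the scale of `log η_n⁻¹`. -/
lemma tendsto_boundary_div_of_sparsityRange (hs : SparsityRange s) {q : ℕ → ℝ}
    (hq : FalseDiscoveryControl q) (he0 : 0 ≤ e)
    (hτ : ∀ᶠ n in atTop, τ n = tauL0 (s n))
    (hk : ∀ᶠ n : ℕ in atTop, k n = n * s n * τ n ^ (-e)) :
    Tendsto (fun n => fdrBoundary n (q n) (k n) / τ n) atTop (𝓝 1) := by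
  have hτlim : Tendsto τ atTop atTop := hs.tendsto_tauL0.congr' (hτ.mono fun n h => h.symm)
  obtain ⟨b₁, hb₁, hq1⟩ := hq.exists_div_log_le
  obtain ⟨b, hb, hbounds⟩ := hs.tauL0_sq_bounds
  obtain ⟨q₀, hq0, hqlt, hqlim, -⟩ := hq
  have hq2 : ∀ᶠ n in atTop, q n < 1 := hqlim.eventually (gt_mem_nhds hqlt)
  have hq3 : ∀ᶠ n in atTop, 0 < q n ∧ b₁ * b / τ n ^ 2 ≤ q n := by
    filter_upwards [hq1, hbounds, hτ, tendsto_log_natCast.eventually_gt_atTop 0,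
      hτlim.eventually_gt_atTop 0] with n h1 h2 h3 h4 h5
    refine ⟨lt_of_lt_of_le (by positivity) h1, le_trans ?_ h1⟩
    rw [← h3] at h2
    rw [div_le_div_iff₀ (by positivity) h4]
    nlinarith [h2.1]
  -- the logarithm of the level
  have hloglim : Tendsto (fun n => 2 * Real.log (s n * τ n ^ (-e) * q n / 2)⁻¹ / τ n ^ 2) atTop
      (𝓝 1) := by
    have hlogτ : Tendsto (fun n => Real.log (τ n) / τ n ^ 2) atTop (𝓝 0) := by
      have h := (isLittleO_log_rpow_atTop (r := 2) (by norm_num)).tendsto_div_nhds_zero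
      simp only [Real.rpow_two] at h
      exact h.comp hτlim
    have hconst : ∀ c : ℝ, Tendsto (fun n => c / τ n ^ 2) atTop (𝓝 0) := fun c =>
      tendsto_const_nhds.div_atTop ((tendsto_pow_atTop two_ne_zero).comp hτlim)
    have hlogq : Tendsto (fun n => Real.log (2 / q n) / τ n ^ 2) atTop (𝓝 0) := by
      have hup : Tendsto (fun n => Real.log (2 / (b₁ * b)) / τ n ^ 2
          + 2 * (Real.log (τ n) / τ n ^ 2)) atTop (𝓝 (0 + 2 * 0)) :=
        (hconst _).add (hlogτ.const_mul 2)
      rw [mul_zero, add_zero] at hup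
      refine squeeze_zero' ?_ ?_ hup
      · filter_upwards [hq2, hq3] with n h1 h2
        refine div_nonneg (Real.log_nonneg ?_) (by positivity)
        rw [one_le_div h2.1]; linarith
      · filter_upwards [hq3, hτlim.eventually_gt_atTop 0] with n h2 h3
        have h4 : 2 / q n ≤ 2 / (b₁ * b) * τ n ^ 2 := by
          rw [div_mul_eq_mul_div, div_le_div_iff₀ h2.1 (by positivity)]
          have := h2.2
          rw [div_le_iff₀ (by positivity)] at this
          linarith
        have h5 := Real.log_le_log (div_pos two_pos h2.1) h4
        rw [Real.log_mul (by positivity) (by positivity), Real.log_pow] at h5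
        rw [mul_div_assoc', ← add_div]
        push_cast at h5
        exact div_le_div_of_nonneg_right h5 (by positivity)
    have h := ((hlogτ.const_mul (2 * e)).const_add 1).add (hlogq.const_mul 2)
    simp only [mul_zero, add_zero] at h
    refine h.congr' ?_
    filter_upwards [hτ, hq3, hτlim.eventually_gt_atTop 0, hs.eventually_pos,
      hs.tendsto_zero.eventually (gt_mem_nhds one_pos)] with n h1 h2 h3 h4 h5
    have h6 := tauL0_sq h4 h5.le
    rw [← h1] at h6
    have h7 : (s n * τ n ^ (-e) * q n / 2)⁻¹ = (s n)⁻¹ * τ n ^ e * (2 / q n) := by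
      rw [Real.rpow_neg h3.le]
      have := h2.1.ne'
      have : τ n ^ e ≠ 0 := by positivity
      field_simp
    have h8 : 2 / q n ≠ 0 := (div_pos two_pos h2.1).ne'
    rw [h7, Real.log_mul (by positivity) h8, Real.log_mul (by positivity) (by positivity),
      Real.log_rpow h3]
    have h9 : τ n ^ 2 ≠ 0 := by positivity
    rw [show 2 * (Real.log (s n)⁻¹ + e * Real.log (τ n) + Real.log (2 / q n))
      = τ n ^ 2 + 2 * e * Real.log (τ n) + 2 * Real.log (2 / q n) by rw [h6]; ring]
    field_simp
  have hu : Tendsto (fun n => s n * τ n ^ (-e) * q n / 2) atTop (𝓝[>] 0) := by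
    refine tendsto_nhdsWithin_iff.2 ⟨?_, ?_⟩
    · refine squeeze_zero' ?_ ?_ hs.tendsto_zero
      · filter_upwards [hq3, hτlim.eventually_gt_atTop 0, hs.eventually_pos] with n h1 h2 h3
        have := h1.1
        positivity
      · filter_upwards [hq3, hq2, hτlim.eventually_ge_atTop 1, hs.eventually_pos]
          with n h1 h2 h3 h4
        have h5 : s n * τ n ^ (-e) ≤ s n := mul_le_of_le_one_right h4.le
          (Real.rpow_le_one_of_one_le_of_nonpos h3 (by linarith))
        have h6 : 0 ≤ s n * τ n ^ (-e) := by positivity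
        nlinarith [h1.1]
    · filter_upwards [hq3, hτlim.eventually_gt_atTop 0, hs.eventually_pos] with n h1 h2 h3
      have := h1.1
      exact Set.mem_Ioi.2 (by positivity)
  have hsq := (tendsto_upperQuantile_sq_div_log.comp hu).mul hloglim
  rw [one_mul] at hsq
  have hsqrt := (Real.continuous_sqrt.tendsto 1).comp hsq
  rw [Real.sqrt_one] at hsqrt
  refine hsqrt.congr' ?_
  have hupos := (tendsto_upperQuantile.comp hu).eventually_gt_atTop 0
  filter_upwards [hk, hupos, hτlim.eventually_gt_atTop 0, hu self_mem_nhdsWithin,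
    (hu.mono_right nhdsWithin_le_nhds).eventually (gt_mem_nhds one_pos), eventually_gt_atTop 0]
    with n h1 h2 h3 h4 h5 h6
  simp only [Function.comp] at h2 ⊢
  have h4 : 0 < s n * τ n ^ (-e) * q n / 2 := h4
  have hn : (n : ℝ) ≠ 0 := (Nat.cast_pos.2 h6).ne'
  have h7 : fdrBoundary n (q n) (k n) = upperQuantile (s n * τ n ^ (-e) * q n / 2) := by
    rw [fdrBoundary, h1]; congr 1; field_simp
  rw [h7]
  have h8 : 0 < Real.log (s n * τ n ^ (-e) * q n / 2)⁻¹ :=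
    Real.log_pos ((one_lt_inv₀ h4).2 h5)
  rw [div_mul_div_cancel₀ (by positivity), ← div_pow, Real.sqrt_sq (by positivity)]

end Calibration

lemma natCast_add_one_le_iff (l : ℕ) (x : ℝ) : (l : ℝ) + 1 ≤ x ↔ l < ⌊x⌋₊ := by
  rw [← Nat.add_one_le_iff, Nat.le_floor_iff' (Nat.succ_ne_zero _)]
  push_cast; rfl

lemma card_filter_add_one_le {n : ℕ} (x : ℝ) [DecidablePred fun l : Fin n => (l : ℝ) + 1 ≤ x] :
    (Finset.univ.filter fun l : Fin n => (l : ℝ) + 1 ≤ x).card = min n ⌊x⌋₊ := by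
  simp only [natCast_add_one_le_iff]
  rw [Fin.card_filter_val_lt]

lemma card_filter_add_one_le_le {n : ℕ} {x : ℝ} (hx : 0 ≤ x)
    [DecidablePred fun l : Fin n => (l : ℝ) + 1 ≤ x] :
    ((Finset.univ.filter fun l : Fin n => (l : ℝ) + 1 ≤ x).card : ℝ) ≤ x := by
  rw [card_filter_add_one_le]
  exact (Nat.cast_le.2 (min_le_right _ _)).trans (Nat.floor_le hx)

lemma tendsto_floor_div {k x : ℕ → ℝ} (hk : Tendsto k atTop atTop)
    (hx : Tendsto (fun n => x n / k n) atTop (𝓝 1)) :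
    Tendsto (fun n => (⌊x n⌋₊ : ℝ) / k n) atTop (𝓝 1) := by
  have hxinf : Tendsto x atTop atTop := by
    refine (hk.atTop_mul_pos one_pos hx).congr' ?_
    filter_upwards [hk.eventually_gt_atTop 0] with n hn
    field_simp
  have h := ((tendsto_nat_floor_div_atTop (R := ℝ)).comp hxinf).mul hx
  rw [one_mul] at h
  refine h.congr' ?_
  filter_upwards [hxinf.eventually_gt_atTop 0] with n hn
  simp only [Function.comp]
  field_simp

/-! ### The `ℓ_0` configuration -/

lemma topGroupMeans_meanL0 {r : ℝ} (hr0 : 0 < r) {q : ℕ → ℝ} (hq : FalseDiscoveryControl q)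
    (α : ℝ) {η : ℕ → ℝ} (hη : SparsityRange η) :
    TopGroupMeans r α 0 q (fun n => meanL0 n (q n) (η n) α) (fun n => effNumL0 n (η n))
      (fun n => tauL0 (η n))
      (fun n => open Classical in
        Finset.univ.filter fun l : Fin n => (l : ℝ) + 1 ≤ effNumL0 n (η n)) := by
  classical
  have hτ : ∀ᶠ n in atTop, tauL0 (η n) = tauL0 (η n) := Eventually.of_forall fun _ => rfl
  have hk : ∀ᶠ n : ℕ in atTop, effNumL0 n (η n) = n * η n * tauL0 (η n) ^ (-(0 : ℝ)) :=
    Eventually.of_forall fun n => by simp [effNumL0]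
  have hlog := tendsto_num_div_log_of_sparsityRange hη two_pos.le hτ hk
  have hsparse := tendsto_num_mul_pow_div_of_sparsityRange hη le_rfl hτ hk
  have hbd := tendsto_boundary_div_of_sparsityRange hη hq le_rfl hτ hk
  have hkinf : Tendsto (fun n : ℕ => effNumL0 n (η n)) atTop atTop := by
    refine tendsto_atTop_mono' _ ?_ hlog
    filter_upwards [tendsto_log_natCast.eventually_ge_atTop 1, hη.eventually_pos] with n h1 h2
    exact div_le_self (by unfold effNumL0; positivity) h1
  have htop : ∀ᶠ n : ℕ in atTop, 0 ≤ fdrBoundary n (q n) (effNumL0 n (η n)) + α := by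
    have h := hη.tendsto_tauL0.atTop_mul_pos one_pos hbd
    filter_upwards [h.eventually_ge_atTop (-α), hη.tendsto_tauL0.eventually_gt_atTop 0]
      with n h1 h2
    rw [mul_div_cancel₀ _ h2.ne'] at h1
    linarith
  refine ⟨hη.tendsto_tauL0, hlog, hsparse, hbd, ?_, ?_, ?_, ?_, ?_, ?_, ?_⟩
  · refine Eventually.of_forall fun n i hi => ?_
    rw [Finset.mem_filter] at hi
    simp [meanL0, hi.2]
  · have h := tendsto_floor_div hkinf (x := fun n => effNumL0 n (η n)) (by
      refine tendsto_const_nhds.congr' ?_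
      filter_upwards [hkinf.eventually_gt_atTop 0] with n hn
      rw [div_self hn.ne'])
    refine h.congr' ?_
    filter_upwards [hη.tendsto_zero.eventually (gt_mem_nhds one_pos)] with n hn
    rw [card_filter_add_one_le, min_eq_right]
    refine Nat.floor_le_of_le ?_
    exact mul_le_of_le_one_right (Nat.cast_nonneg n) hn.le
  · filter_upwards [htop] with n hn i
    unfold meanL0
    split_ifs
    · exact hn
    · exact le_rfl
  · filter_upwards [htop] with n hn i
    unfold meanL0
    split_ifs
    · exact le_rfl
    · exact hn
  · intro ε hε
    refine ⟨1 / 2, by norm_num, by norm_num, ?_⟩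
    filter_upwards [hkinf.eventually_gt_atTop 0, hη.tendsto_tauL0.eventually_gt_atTop 0]
      with n h1 h2
    rw [Finset.filter_eq_empty_iff.2, Finset.card_empty]
    · push_cast; positivity
    · intro i hi
      simp only [Finset.mem_compl, Finset.mem_filter, Finset.mem_univ, true_and] at hi
      simp only [meanL0, hi, if_false]
      rw [not_lt]; positivity
  · refine ⟨0, ?_⟩
    filter_upwards [hkinf.eventually_gt_atTop 0] with n hn
    rw [pow_zero, mul_one]
    refine le_trans ?_ (card_filter_add_one_le_le (n := n) hn.le)
    refine Nat.cast_le.2 (Finset.card_le_card (Finset.monotone_filter_right _ fun i _ hi => ?_))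
    by_contra h
    simp only [meanL0, h, if_false] at hi
    exact absurd hi (not_lt.2 (by positivity))
  · refine tendsto_const_nhds.congr fun n => ?_
    rw [Finset.sum_eq_zero, zero_div]
    intro i hi
    simp only [Finset.mem_compl, Finset.mem_filter, Finset.mem_univ, true_and] at hi
    simp only [meanL0, hi, if_false, abs_zero]
    exact Real.zero_rpow hr0.ne'

/-! ### The weak `ℓ_p` configuration -/

/-- Comparison of a tail of the series `∑ j ^ (-β)` with the integral. -/
lemma sum_Ico_rpow_bounds {β : ℝ} (hβ : 1 < β) {a n : ℕ} (ha : 0 < a) (han : a ≤ n) :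
    (((a : ℝ) + 1) ^ (1 - β) - ((n : ℝ) + 1) ^ (1 - β)) / (β - 1)
        ≤ ∑ j ∈ Finset.Ico a n, ((j : ℝ) + 1) ^ (-β) ∧
      ∑ j ∈ Finset.Ico a n, ((j : ℝ) + 1) ^ (-β) ≤ (a : ℝ) ^ (1 - β) / (β - 1) := by
  have hint : ∀ x y : ℝ, 0 < x → x ≤ y →
      ∫ t in x..y, t ^ (-β) = (x ^ (1 - β) - y ^ (1 - β)) / (β - 1) := by
    intro x y hx hxy
    rw [integral_rpow]
    · rw [← neg_div_neg_eq]
      congr 1 <;> ring_nf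
    · right
      refine ⟨by linarith, fun h => ?_⟩
      rw [Set.uIcc_of_le hxy] at h
      linarith [h.1]
  have hanti : ∀ x y : ℝ, 0 < x → AntitoneOn (fun t : ℝ => t ^ (-β)) (Set.Icc x y) := by
    intro x y hx s hs t _ hst
    exact Real.rpow_le_rpow_of_nonpos (hx.trans_le hs.1) hst (by linarith)
  have ha' : (0 : ℝ) < a := Nat.cast_pos.2 ha
  have han' : (a : ℝ) ≤ n := Nat.cast_le.2 han
  constructor
  · have h := AntitoneOn.integral_le_sum_Ico (a := a + 1) (b := n + 1) (by omega)
      (hanti ((a + 1 : ℕ) : ℝ) ((n + 1 : ℕ) : ℝ) (by positivity))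
    rw [hint _ _ (by positivity) (by exact_mod_cast Nat.succ_le_succ han),
      ← Finset.sum_Ico_add' (fun j : ℕ => (j : ℝ) ^ (-β)) a n 1] at h
    push_cast at h
    exact h
  · have h := AntitoneOn.sum_le_integral_Ico han (hanti (a : ℝ) (n : ℝ) ha')
    rw [hint _ _ ha' han'] at h
    push_cast at h
    refine h.trans (div_le_div_of_nonneg_right ?_ (by linarith))
    have : (0 : ℝ) ≤ (n : ℝ) ^ (1 - β) := by positivity
    linarith

lemma tendsto_sum_Ico_rpow {β : ℝ} (hβ : 1 < β) {k : ℕ → ℝ} {a : ℕ → ℕ}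
    (hk : Tendsto k atTop atTop) (hkn : Tendsto (fun n : ℕ => k n / n) atTop (𝓝 0))
    (ha : Tendsto (fun n => (a n : ℝ) / k n) atTop (𝓝 1)) :
    Tendsto (fun n => k n ^ (β - 1) * ∑ j ∈ Finset.Ico (a n) n, ((j : ℝ) + 1) ^ (-β)) atTop
      (𝓝 (1 / (β - 1))) := by
  have hk0 := hk.eventually_gt_atTop 0
  have haev : ∀ᶠ n in atTop, 0 < a n ∧ a n ≤ n := by
    filter_upwards [ha.eventually (lt_mem_nhds (show (0 : ℝ) < 1 by norm_num)),
      ha.eventually (gt_mem_nhds one_lt_two), hk0,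
      hkn.eventually (gt_mem_nhds (show (0 : ℝ) < 1 / 2 by norm_num)), eventually_gt_atTop 0]
      with n h1 h2 h3 h4 h5
    have hn : (0 : ℝ) < n := Nat.cast_pos.2 h5
    rw [div_lt_iff₀ h3] at h2
    rw [div_lt_iff₀ hn] at h4
    refine ⟨?_, ?_⟩
    · have : (0 : ℝ) < a n := by
        by_contra h
        exact absurd h1 (not_lt.2 (div_nonpos_of_nonpos_of_nonneg (not_lt.1 h) h3.le))
      exact_mod_cast this
    · have : (a n : ℝ) ≤ n := by linarith
      exact_mod_cast this
  have ha1 : Tendsto (fun n => ((a n : ℝ) + 1) / k n) atTop (𝓝 1) := by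
    have h := ha.add ((tendsto_const_nhds (x := (1 : ℝ))).div_atTop hk)
    rw [add_zero] at h
    exact h.congr fun n => by rw [add_div]
  have hup : Tendsto (fun n => ((a n : ℝ) / k n) ^ (1 - β) / (β - 1)) atTop (𝓝 (1 / (β - 1))) := by
    have h := (ha.rpow_const (p := 1 - β) (Or.inl one_ne_zero)).div_const (β - 1)
    rwa [Real.one_rpow] at h
  have hlow : Tendsto (fun n : ℕ => ((((a n : ℝ) + 1) / k n) ^ (1 - β)
      - (k n / (n + 1)) ^ (β - 1)) / (β - 1)) atTop (𝓝 (1 / (β - 1))) := by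
    have h1 : Tendsto (fun n : ℕ => k n / ((n : ℝ) + 1)) atTop (𝓝 0) := by
      refine squeeze_zero' ?_ ?_ hkn
      · filter_upwards [hk0] with n hn
        positivity
      · filter_upwards [hk0, eventually_gt_atTop 0] with n hn hn0
        have hn : (0 : ℝ) < n := Nat.cast_pos.2 hn0
        gcongr
        linarith
    have h2 := h1.rpow_const (p := β - 1) (Or.inr (by linarith))
    rw [Real.zero_rpow (by linarith)] at h2
    have h := ((ha1.rpow_const (p := 1 - β) (Or.inl one_ne_zero)).sub h2).div_const (β - 1)
    rwa [Real.one_rpow, sub_zero] at h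
  have hexp : 1 - β = -(β - 1) := by ring
  refine tendsto_of_tendsto_of_tendsto_of_le_of_le' hlow hup ?_ ?_
  · filter_upwards [hk0, haev] with n h1 h2
    have h3 := mul_le_mul_of_nonneg_left (sum_Ico_rpow_bounds hβ h2.1 h2.2).1
      (show 0 ≤ k n ^ (β - 1) by positivity)
    refine le_trans (le_of_eq ?_) h3
    have hn : (0 : ℝ) < (n : ℝ) + 1 := by positivity
    rw [Real.div_rpow (by positivity) h1.le, Real.div_rpow h1.le hn.le, hexp, Real.rpow_neg h1.le,
      Real.rpow_neg hn.le, div_inv_eq_mul]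
    ring
  · filter_upwards [hk0, haev] with n h1 h2
    have h3 := mul_le_mul_of_nonneg_left (sum_Ico_rpow_bounds hβ h2.1 h2.2).2
      (show 0 ≤ k n ^ (β - 1) by positivity)
    refine h3.trans (le_of_eq ?_)
    rw [Real.div_rpow (by positivity) h1.le, hexp, Real.rpow_neg h1.le, div_inv_eq_mul]
    ring

lemma extremalWeak_eq {n : ℕ} {p η : ℝ} (hp : 0 < p) (hη : 0 < η) (l : Fin n) :
    extremalWeak n p η l = (n * η ^ p / ((l : ℝ) + 1)) ^ (1 / p) := by
  have hl : (0 : ℝ) < (l : ℝ) + 1 := by positivity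
  rw [extremalWeak, Real.div_rpow (by positivity) hl.le, Real.mul_rpow (by positivity)
    (by positivity), ← Real.rpow_mul hη.le, mul_one_div_cancel hp.ne', Real.rpow_one,
    Real.rpow_neg hl.le]
  ring

lemma le_extremalWeak_iff {n : ℕ} {p η m : ℝ} (hp : 0 < p) (hη : 0 < η) (hm : 0 < m)
    (l : Fin n) : m ≤ extremalWeak n p η l ↔ (l : ℝ) + 1 ≤ n * η ^ p / m ^ p := by
  have hl : (0 : ℝ) < (l : ℝ) + 1 := by positivity
  rw [extremalWeak_eq hp hη, one_div, Real.le_rpow_inv_iff_of_pos hm.le (by positivity) hp,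
    le_div_iff₀ hl, le_div_iff₀ (by positivity), mul_comm]

/-- The top group consists of the coordinates truncated at `m = t[k_n] + α`, which are those with
`l ≤ n η^p m^{-p} = k_n (τ / m)^p ~ k_n`. -/
lemma topGroupMeans_meanWeak {r p : ℝ} (hr2 : r ≤ 2) (hp0 : 0 < p) (hpr : p < r) {q : ℕ → ℝ}
    (hq : FalseDiscoveryControl q) (α : ℝ) {η : ℕ → ℝ} (hη0 : ∀ᶠ n in atTop, 0 < η n)
    (hη : SparsityRange fun n => η n ^ p) :
    TopGroupMeans r α (p / (r - p)) q (fun n => meanWeak n (q n) p (η n) α)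
      (fun n => effNumWeak n p (η n)) (fun n => tauWeak p (η n))
      (fun n => open Classical in Finset.univ.filter fun l : Fin n =>
        (l : ℝ) + 1 ≤ n * η n ^ p
          / (fdrBoundary n (q n) (effNumWeak n p (η n)) + α) ^ p) := by
  classical
  have hτ : ∀ᶠ n in atTop, tauWeak p (η n) = tauL0 (η n ^ p) := by
    filter_upwards [hη0] with n hn
    rw [tauWeak, tauL0, Real.rpow_neg hn.le]
  have hk : ∀ᶠ n : ℕ in atTop, effNumWeak n p (η n) = n * η n ^ p * tauWeak p (η n) ^ (-p) :=
    Eventually.of_forall fun _ => rfl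
  have hp2 : p ≤ 2 := by linarith
  have hlog := tendsto_num_div_log_of_sparsityRange hη hp2 hτ hk
  have hsparse := tendsto_num_mul_pow_div_of_sparsityRange hη hp0.le hτ hk
  have hbd := tendsto_boundary_div_of_sparsityRange hη hq hp0.le hτ hk
  have hτlim : Tendsto (fun n => tauWeak p (η n)) atTop atTop :=
    hη.tendsto_tauL0.congr' (hτ.mono fun n h => h.symm)
  set τ : ℕ → ℝ := fun n => tauWeak p (η n) with hτdef
  set k : ℕ → ℝ := fun n => effNumWeak n p (η n) with hkdef
  set m : ℕ → ℝ := fun n => fdrBoundary n (q n) (k n) + α with hmdef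
  have hτ0 : ∀ᶠ n in atTop, 0 < τ n := hτlim.eventually_gt_atTop 0
  have hk0 : ∀ᶠ n in atTop, 0 < k n := by
    filter_upwards [hτ0, hη0, eventually_gt_atTop 0] with n h1 h2 h3
    have hn : (0 : ℝ) < n := Nat.cast_pos.2 h3
    have h1 : 0 < tauWeak p (η n) := h1
    simp only [hkdef, effNumWeak]
    positivity
  have hkinf : Tendsto k atTop atTop := by
    refine tendsto_atTop_mono' _ ?_ hlog
    filter_upwards [tendsto_log_natCast.eventually_ge_atTop 1, hk0] with n h1 h2
    exact div_le_self h2.le h1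
  have hkn : Tendsto (fun n : ℕ => k n / n) atTop (𝓝 0) := by simpa using hsparse 0
  have hkτ : ∀ᶠ n : ℕ in atTop, n * η n ^ p = k n * τ n ^ p := by
    filter_upwards [hτ0] with n h1
    have h2 : τ n ^ p ≠ 0 := by positivity
    have h3 : k n = n * η n ^ p * τ n ^ (-p) := rfl
    rw [h3, Real.rpow_neg h1.le, inv_mul_cancel_right₀ h2]
  have hm : Tendsto (fun n => m n / τ n) atTop (𝓝 1) := by
    have h := hbd.add ((tendsto_const_nhds (x := α)).div_atTop hτlim)
    rw [add_zero] at h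
    exact h.congr fun n => by rw [← add_div]
  have hm0 : ∀ᶠ n in atTop, 0 < m n := by
    filter_upwards [hm.eventually (lt_mem_nhds one_pos), hτ0] with n h1 h2
    have := mul_pos h1 h2
    rwa [div_mul_cancel₀ _ h2.ne'] at this
  -- the number of coordinates that are truncated at `m`
  have hN : Tendsto (fun n => (n * η n ^ p / m n ^ p) / k n) atTop (𝓝 1) := by
    have h := (hm.rpow_const (p := p) (Or.inl one_ne_zero)).inv₀ (by simp)
    rw [Real.one_rpow, inv_one] at h
    refine h.congr' ?_
    filter_upwards [hkτ, hk0, hm0, hτ0] with n h1 h2 h3 h4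
    rw [h1, Real.div_rpow h3.le h4.le, inv_div]
    field_simp
  have hcard : ∀ᶠ n in atTop, (Finset.univ.filter fun l : Fin n =>
      (l : ℝ) + 1 ≤ n * η n ^ p / m n ^ p).card = ⌊n * η n ^ p / m n ^ p⌋₊ := by
    have h := hN.mul hkn
    rw [mul_zero] at h
    filter_upwards [h.eventually (gt_mem_nhds one_pos), hk0, eventually_gt_atTop 0]
      with n h1 h2 h3
    have hn : (0 : ℝ) < n := Nat.cast_pos.2 h3
    rw [card_filter_add_one_le, min_eq_right]
    refine Nat.floor_le_of_le ?_
    rw [div_mul_div_cancel₀ h2.ne', div_lt_one hn] at h1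
    exact h1.le
  have hcardlim := (tendsto_floor_div hkinf hN).congr'
    (hcard.mono fun n h => by rw [← h])
  have hcount : ∀ᶠ n in atTop, ∀ c : ℝ, 0 < c → ∀ l : Fin n, c * τ n ≤ extremalWeak n p (η n) l →
      (l : ℝ) + 1 ≤ k n * c ^ (-p) := by
    filter_upwards [hη0, hτ0, hkτ] with n h1 h2 h3 c hc l hl
    rw [le_extremalWeak_iff hp0 h1 (by positivity), h3, Real.mul_rpow hc.le h2.le,
      mul_div_mul_right _ _ (by positivity : τ n ^ p ≠ 0)] at hl
    rw [Real.rpow_neg hc.le]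
    exact hl
  refine ⟨hτlim, hlog, hsparse, hbd, ?_, hcardlim, ?_, ?_, ?_, ?_, ?_⟩
  · filter_upwards [hη0, hm0] with n h1 h2 i hi
    rw [Finset.mem_filter] at hi
    exact min_eq_right ((le_extremalWeak_iff hp0 h1 h2 i).2 hi.2)
  · filter_upwards [hη0, hm0] with n h1 h2 i
    refine le_min ?_ h2.le
    unfold extremalWeak
    positivity
  · exact Eventually.of_forall fun n i => min_le_right _ _
  · intro ε hε
    -- `δ` is chosen so that at most `(1 + ε / 2) k` coordinates exceed `(1 - δ) τ`
    have hδ : ∃ δ : ℝ, (1 - δ) ^ (-p) < 1 + ε / 2 ∧ δ ∈ Set.Ioo (0 : ℝ) 1 := by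
      have h1 : Tendsto (fun δ : ℝ => 1 - δ) (𝓝 0) (𝓝 (1 - 0)) := tendsto_id.const_sub 1
      have h2 := h1.rpow_const (p := -p) (Or.inl (by simp))
      rw [sub_zero, Real.one_rpow] at h2
      have hev : ∀ᶠ δ : ℝ in 𝓝[>] 0, (1 - δ) ^ (-p) < 1 + ε / 2 ∧ δ ∈ Set.Ioo (0 : ℝ) 1 :=
        ((h2.eventually (gt_mem_nhds (show (1 : ℝ) < 1 + ε / 2 by linarith))).filter_mono
          nhdsWithin_le_nhds).and (Ioo_mem_nhdsGT one_pos)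
      exact hev.exists
    obtain ⟨δ, hδ1, hδ2⟩ := hδ
    have hδ3 : 0 < 1 - δ := by linarith [hδ2.2]
    refine ⟨δ, hδ2.1, hδ2.2, ?_⟩
    filter_upwards [hcount, hcardlim.eventually (lt_mem_nhds (show 1 - ε / 2 < 1 by linarith)), hk0,
      hm.eventually (lt_mem_nhds (show 1 - δ < 1 by linarith [hδ2.1])), hη0, hm0, hτ0]
      with n h1 h2 h3 h4 h5 h6 h7
    set An := Finset.univ.filter fun l : Fin n => (l : ℝ) + 1 ≤ n * η n ^ p / m n ^ p with hAn
    set Big := Finset.univ.filter fun l : Fin n => (l : ℝ) + 1 ≤ k n * (1 - δ) ^ (-p) with hBig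
    rw [lt_div_iff₀ h7] at h4
    rw [lt_div_iff₀ h3] at h2
    have hsub : An ⊆ Big := by
      intro l hl
      rw [hAn, Finset.mem_filter, ← le_extremalWeak_iff hp0 h5 h6] at hl
      exact Finset.mem_filter.2 ⟨Finset.mem_univ _, h1 _ hδ3 l (h4.le.trans hl.2)⟩
    have hsub2 : (Anᶜ.filter fun i => (1 - δ) * τ n < meanWeak n (q n) p (η n) α i) ⊆ Big \ An := by
      intro l hl
      rw [Finset.mem_filter, Finset.mem_compl] at hl
      refine Finset.mem_sdiff.2 ⟨Finset.mem_filter.2 ⟨Finset.mem_univ _, ?_⟩, hl.1⟩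
      exact h1 _ hδ3 l (hl.2.le.trans (min_le_left _ _))
    have hc1 : (Big.card : ℝ) ≤ k n * (1 - δ) ^ (-p) := card_filter_add_one_le_le (by positivity)
    have hc2 : ((Anᶜ.filter fun i => (1 - δ) * τ n < meanWeak n (q n) p (η n) α i).card : ℝ)
        ≤ Big.card - An.card := by
      rw [← Nat.cast_sub (Finset.card_le_card hsub), ← Finset.card_sdiff_of_subset hsub]
      exact Nat.cast_le.2 (Finset.card_le_card hsub2)
    have hc3 := mul_le_mul_of_nonneg_left hδ1.le h3.le
    linarith
  · refine ⟨6, ?_⟩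
    filter_upwards [hcount, hτlim.eventually_ge_atTop 1, hk0] with n h1 h2 h3
    have h0 : 0 < τ n := by linarith
    have h4 : ((τ n ^ 3)⁻¹ : ℝ) ^ (-p) ≤ τ n ^ 6 := by
      rw [Real.rpow_neg (by positivity), Real.inv_rpow (by positivity), inv_inv,
        ← Real.rpow_natCast, ← Real.rpow_mul h0.le, ← Real.rpow_natCast]
      refine Real.rpow_le_rpow_of_exponent_le h2 ?_
      push_cast; linarith
    refine le_trans ?_ (mul_le_mul_of_nonneg_left h4 h3.le)
    refine le_trans ?_ (card_filter_add_one_le_le (n := n) (by positivity))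
    refine Nat.cast_le.2 (Finset.card_le_card (Finset.monotone_filter_right _ fun i _ hi => ?_))
    refine h1 _ (by positivity) i ?_
    have h5 : (τ n ^ 3)⁻¹ * τ n = (τ n ^ 2)⁻¹ := by field_simp
    rw [h5]
    exact hi.le.trans (min_le_left _ _)
  · have hβ : 1 < r / p := (one_lt_div hp0).2 hpr
    have hlim := tendsto_sum_Ico_rpow hβ hkinf hkn (tendsto_floor_div hkinf hN)
    have hconst : 1 / (r / p - 1) = p / (r - p) := by
      have : r - p ≠ 0 := by linarith
      rw [div_sub_one hp0.ne', one_div_div]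
    rw [hconst] at hlim
    refine hlim.congr' ?_
    filter_upwards [hη0, hm0, hk0, hτ0, hkτ, eventually_gt_atTop 0] with n h1 h2 h3 h4 h5 h6
    set a := ⌊n * η n ^ p / m n ^ p⌋₊ with ha
    have hterm : ∀ l ∈ (Finset.univ.filter fun l : Fin n =>
        (l : ℝ) + 1 ≤ n * η n ^ p / m n ^ p)ᶜ, |meanWeak n (q n) p (η n) α l| ^ r
          = (k n * τ n ^ p) ^ (r / p) * ((l : ℝ) + 1) ^ (-(r / p)) := by
      intro l hl
      simp only [Finset.mem_compl, Finset.mem_filter, Finset.mem_univ, true_and] at hl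
      rw [← le_extremalWeak_iff hp0 h1 h2, not_le] at hl
      have hl0 : (0 : ℝ) < (l : ℝ) + 1 := by positivity
      have hpos : 0 ≤ n * η n ^ p / ((l : ℝ) + 1) := by positivity
      rw [meanWeak, min_eq_left hl.le, extremalWeak_eq hp0 h1, abs_of_nonneg (by positivity),
        ← Real.rpow_mul hpos, one_div_mul_eq_div, h5, Real.div_rpow (by positivity) hl0.le,
        Real.rpow_neg hl0.le, div_eq_mul_inv]
    have hsum : ∑ l ∈ (Finset.univ.filter fun l : Fin n =>
        (l : ℝ) + 1 ≤ n * η n ^ p / m n ^ p)ᶜ, ((l : ℝ) + 1) ^ (-(r / p))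
          = ∑ j ∈ Finset.Ico a n, ((j : ℝ) + 1) ^ (-(r / p)) := by
      have hcond : ∀ l : Fin n, ¬ ((l : ℝ) + 1 ≤ n * η n ^ p / m n ^ p) ↔ a ≤ (l : ℕ) := by
        intro l
        rw [natCast_add_one_le_iff, not_lt]
      rw [Finset.compl_filter, Finset.sum_filter]
      simp only [hcond]
      rw [Fin.sum_univ_eq_sum_range (fun j : ℕ => if a ≤ j then ((j : ℝ) + 1) ^ (-(r / p)) else 0),
        ← Finset.sum_filter]
      refine Finset.sum_congr ?_ fun _ _ => rfl
      ext j
      simp only [Finset.mem_filter, Finset.mem_range, Finset.mem_Ico]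
      tauto
    rw [Finset.sum_congr rfl hterm, ← Finset.mul_sum, hsum, Real.mul_rpow h3.le (by positivity),
      ← Real.rpow_mul h4.le, mul_div_cancel₀ _ hp0.ne', Real.rpow_sub_one h3.ne']
    have : τ n ^ r ≠ 0 := by positivity
    field_simp

/-- Convergence of a normalised risk, restated as an asymptotic equivalence with the coefficient
`C + φ q_n / (1 - q_n)`. -/
lemma isEquivalent_of_tendsto_div {ρ w q : ℕ → ℝ} {q₀ C φ : ℝ} (hC : 0 < C) (hφ : 0 ≤ φ)
    (hq0 : 0 ≤ q₀) (hq1 : q₀ < 1) (hq : Tendsto q atTop (𝓝 q₀)) (hw : ∀ᶠ n in atTop, w n ≠ 0)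
    (h : Tendsto (fun n => ρ n / w n) atTop (𝓝 (C + φ * (q₀ / (1 - q₀))))) :
    ρ ~[atTop] fun n => (C + φ * (q n / (1 - q n))) * w n := by
  have h1 : 0 < 1 - q₀ := by linarith
  have hc : C + φ * (q₀ / (1 - q₀)) ≠ 0 := by positivity
  have h2 : Tendsto (fun n => C + φ * (q n / (1 - q n))) atTop (𝓝 (C + φ * (q₀ / (1 - q₀)))) :=
    ((hq.div (hq.const_sub 1) h1.ne').const_mul φ).const_add C
  have h3 := ((isEquivalent_const_iff_tendsto hc).2 h).trans
    ((isEquivalent_const_iff_tendsto hc).2 h2).symm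
  refine (h3.mul (IsEquivalent.refl (u := w))).congr_left ?_
  filter_upwards [hw] with n hn
  exact div_mul_cancel₀ _ hn

lemma TopGroupMeans.isEquivalent_risk {r α S : ℝ} {q : ℕ → ℝ} {μ : ∀ n, Fin n → ℝ} {k τ : ℕ → ℝ}
    {A : ∀ n, Finset (Fin n)} (H : TopGroupMeans r α S q μ k τ A) (hr0 : 0 < r) (hr2 : r ≤ 2)
    (hS : 0 ≤ S) (hq : FalseDiscoveryControl q) :
    (fun n => risk r (fdrEstimator (q n)) (μ n)) ~[atTop]
      fun n => (normalTail α + S + normalCdf α * (q n / (1 - q n))) * (k n * τ n ^ r) := by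
  have hqpos : ∀ᶠ n in atTop, 0 < q n := by
    obtain ⟨b, hb, h⟩ := hq.exists_div_log_le
    filter_upwards [h, tendsto_log_natCast.eventually_gt_atTop 0] with n h1 h2
    exact lt_of_lt_of_le (by positivity) h1
  obtain ⟨q₀, h0, h1, hlim, -⟩ := hq
  refine isEquivalent_of_tendsto_div (add_pos_of_pos_of_nonneg (normalTail_pos α) hS)
    (by rw [normalCdf_eq]; exact normalTail_nonneg _) h0 h1 hlim ?_
    (H.tendsto_risk hr0 hr2 h1 hqpos hlim)
  filter_upwards [H.num_pos, H.tendsto_tau.eventually_gt_atTop 0] with n h2 h3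
  positivity

end GaussianFDR

theorem mainTheorem6 (r : ℝ) (hr0 : 0 < r) (hr2 : r ≤ 2)
    (q : ℕ → ℝ) (hq : GaussianFDR.FalseDiscoveryControl q) (α : ℝ) :
    (∀ η : ℕ → ℝ, GaussianFDR.SparsityRange η →
      (∀ n, Integrable
        (fun y => GaussianFDR.lrLoss r (GaussianFDR.fdrEstimator (q n) y)
          (GaussianFDR.meanL0 n (q n) (η n) α))
        (GaussianFDR.observationLaw (GaussianFDR.meanL0 n (q n) (η n) α))) ∧
      (fun n => GaussianFDR.risk r (GaussianFDR.fdrEstimator (q n))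
          (GaussianFDR.meanL0 n (q n) (η n) α))
        ~[atTop]
      (fun n => (GaussianFDR.normalTail α + GaussianFDR.normalCdf α * (q n / (1 - q n))) *
          (GaussianFDR.effNumL0 n (η n) * GaussianFDR.tauL0 (η n) ^ r))) ∧
    (∀ p : ℝ, 0 < p → p < r →
      ∀ η : ℕ → ℝ, (∀ᶠ n in atTop, 0 < η n) → GaussianFDR.SparsityRange (fun n => η n ^ p) →
      (∀ n, Integrable
        (fun y => GaussianFDR.lrLoss r (GaussianFDR.fdrEstimator (q n) y)
          (GaussianFDR.meanWeak n (q n) p (η n) α))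
        (GaussianFDR.observationLaw (GaussianFDR.meanWeak n (q n) p (η n) α))) ∧
      (fun n => GaussianFDR.risk r (GaussianFDR.fdrEstimator (q n))
          (GaussianFDR.meanWeak n (q n) p (η n) α))
        ~[atTop]
      (fun n => (GaussianFDR.normalTail α + p / (r - p)
            + GaussianFDR.normalCdf α * (q n / (1 - q n))) *
          (GaussianFDR.effNumWeak n p (η n) * GaussianFDR.tauWeak p (η n) ^ r))) := by
  refine ⟨fun η hη => ⟨fun n => GaussianFDR.integrable_fdr_loss _ _ hr0.le, ?_⟩,
    fun p hp0 hpr η hη0 hη => ⟨fun n => GaussianFDR.integrable_fdr_loss _ _ hr0.le, ?_⟩⟩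
  · simpa only [add_zero] using
      (GaussianFDR.topGroupMeans_meanL0 hr0 hq α hη).isEquivalent_risk hr0 hr2 le_rfl hq
  · exact (GaussianFDR.topGroupMeans_meanWeak hr2 hp0 hpr hq α hη0 hη).isEquivalent_risk hr0 hr2
      (div_nonneg hp0.le (sub_nonneg.2 hpr.le)) hq
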